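/- Let $k>0$ and let $\rho_0>0$, $u_0$ be functions on $\mathbb R$. For an interval $I\ni 0$ of times $t\ge 0$ and $2\le n\le\infty$, a *nice $C^n$ solution on $I$ with data $(\rho_0,u_0)$* is a triple $(\rho,u,E)$ of functions of $(x,t)\in\mathbb R\times I$ with $\rho\in C^n$, $u\in C^{n+1}$, $\rho>0$, $\rho(\cdot,0)=\rho_0$, $u(\cdot,0)=u_0$, that satisfies $$\rho_t+(\rho u)_x=0,\qquad u_t+uu_x=kE+\Big(\frac{u_x}{\rho}\Big)_x,\qquad E_x=\rho ,$$ such that $u$ is bounded on $\mathbb R\times (I\cap[0,\tau])$ for every $\tau<\infty$, and such that $u_x/\rho$ is sub-linear in $x$: for some $\gamma>0$, $\left|u_x/\rho\right|/(e^{\gamma t}|x|)\to 0$ as $|x|\to\infty$, uniformly in $t\in I$. The field $E$ is called *balanced* if $\rho(\cdot,t)$ is integrable and $E(x,t)=\frac12\big(\int_{-\infty}^x\rho(\xi,t)\,d\xi-\int_x^\infty\rho(\xi,t)\,d\xi\big)$ for all $t\in I$. (1) If for some $\alpha\in\mathbb R$ $$\sup_x\frac{u_0'(x)}{\rho_0(x)}<-\sqrt{\frac{2k}{\rho_0(\alpha)}},$$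 then nice solutions break down in finite time: there is a finite $T_c>0$ such that every nice $C^n$ solution ($n\ge2$) with data $(\rho_0,u_0)$ on an interval $[0,T)$ has $T\le T_c$; in particular there is none on $[0,\infty)$. (2) If for all $\alpha\in\mathbb R$ $$\inf_x\frac{u_0'(x)}{\rho_0(x)}>-\sqrt{\frac{2k}{\rho_0(\alpha)}},$$ then nice solutions stay smooth for all time, in the following sense. Let $0<T<\infty$. For every nice $C^n$ solution ($n\ge 2$) on $[0,T)$ with data $(\rho_0,u_0)$, the functions $\rho$, $1/\rho$ and $u_x$ are bounded on $[-R,R]\times[0,T)$ for every $R$; and every nice $C^\infty$ solution on $[0,T)$ with balanced $E$ extends to a nice $C^\infty$ solution on the closed interval $[0,T]$ with balanced $E$. Moreover, if in case (2) also $\sup_x u_0'/\rho_0<\infty$, then every nice $C^n$ solution ($n\ge2$) on $[0,\infty)$ with data $(\rho_0,u_0)$ satisfies, as $t\to\infty$, $$\rho\sim\frac{2}{kt^2},\qquad u_x\sim\frac2t$$ along every particle path $x=X(t)$, $X'(t)=u(X(t),t)$, and, if $E$ is balanced, also at every fixed $x\in\mathbb R$. -/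

import Mathlib

open Set Filter Asymptotics MeasureTheory

namespace ViscousEP

/-- Spatial derivative `∂ₓ f (x, t)` of a function `f x t`. -/
noncomputable def dx (f : ℝ → ℝ → ℝ) (x t : ℝ) : ℝ :=
  deriv (fun y => f y t) x

/-- Time derivative `∂ₜ f (x, t)` relative to the time interval `I`
(one-sided at an end point belonging to `I`). -/
noncomputable def dt (I : Set ℝ) (f : ℝ → ℝ → ℝ) (x t : ℝ) : ℝ :=
  derivWithin (fun s => f x s) I t

/-- The ratio `β = uₓ / ρ`. -/
noncomputable def ratio (ρ u : ℝ → ℝ → ℝ) (x t : ℝ) : ℝ :=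
  dx u x t / ρ x t

/-- `(ρ, u, E)` is a classical solution with positive density, `ρ ∈ C^n` and `u ∈ C^(n+1)` on
`ℝ × I`, of
`ρ_t + (ρ u)_x = 0`, `u_t + u u_x = k E + (u_x / ρ)_x`, `E_x = ρ`. -/
structure IsSolution (n : ℕ∞) (k : ℝ) (I : Set ℝ) (ρ u E : ℝ → ℝ → ℝ) : Prop where
  smooth_density : ContDiffOn ℝ (n : WithTop ℕ∞) (fun p : ℝ × ℝ => ρ p.1 p.2) (univ ×ˢ I)
  smooth_velocity :
    ContDiffOn ℝ ((n + 1 : ℕ∞) : WithTop ℕ∞) (fun p : ℝ × ℝ => u p.1 p.2) (univ ×ˢ I)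
  density_pos : ∀ t ∈ I, ∀ x, 0 < ρ x t
  mass : ∀ t ∈ I, ∀ x, dt I ρ x t + dx (fun y s => ρ y s * u y s) x t = 0
  momentum : ∀ t ∈ I, ∀ x,
    dt I u x t + u x t * dx u x t = k * E x t + dx (ratio ρ u) x t
  poisson : ∀ t ∈ I, ∀ x, HasDerivAt (fun y => E y t) (ρ x t) x

/-- `u_x / ρ` is sub-linear in `x` and at most exponential in `t`:
`|u_x / ρ| ≪ e^(γ t) |x|` as `|x| → ∞`, uniformly in `t ∈ I`, for some `γ > 0`. -/
def SublinearRatio (I : Set ℝ) (ρ u : ℝ → ℝ → ℝ) : Prop :=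
  ∃ γ > 0, ∀ ε > 0, ∃ R : ℝ, ∀ t ∈ I, ∀ x : ℝ, R ≤ |x| →
    |ratio ρ u x t| ≤ ε * Real.exp (γ * t) * |x|

/-- The velocity is bounded on bounded time intervals, uniformly in `x`. -/
def VelocityBounded (I : Set ℝ) (u : ℝ → ℝ → ℝ) : Prop :=
  ∀ τ : ℝ, ∃ C : ℝ, ∀ t ∈ I, t ≤ τ → ∀ x, |u x t| ≤ C

/-- A well-behaved solution on the time interval `I` with initial data `(ρ₀, u₀)`. -/
structure IsNiceSolution (n : ℕ∞) (k : ℝ) (ρ₀ u₀ : ℝ → ℝ) (I : Set ℝ)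
    (ρ u E : ℝ → ℝ → ℝ) : Prop where
  solution : IsSolution n k I ρ u E
  bounded : VelocityBounded I u
  sublinear : SublinearRatio I ρ u
  initial_density : ∀ x, ρ x 0 = ρ₀ x
  initial_velocity : ∀ x, u x 0 = u₀ x

/-- `E` is the electric field generated by a density of finite total mass, normalized by
`E(∞, t) = -E(-∞, t)`. The equation `E_x = ρ` alone leaves a function of `t` free. -/
def IsBalancedField (I : Set ℝ) (ρ E : ℝ → ℝ → ℝ) : Prop :=
  ∀ t ∈ I, Integrable (fun ξ => ρ ξ t) ∧
    ∀ x, E x t = ((∫ ξ in Iic x, ρ ξ t) - ∫ ξ in Ioi x, ρ ξ t) / 2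

/-- `X` is the particle path (characteristic curve) of `u` on `[0, ∞)` starting at `α`. -/
def IsParticlePath (u : ℝ → ℝ → ℝ) (α : ℝ) (X : ℝ → ℝ) : Prop :=
  X 0 = α ∧ ∀ t ∈ Ici (0 : ℝ), HasDerivWithinAt X (u (X t) t) (Ici 0) t

/-- The supremum of `u₀' / ρ₀`, as an extended real number. -/
noncomputable def supRatio (ρ₀ u₀ : ℝ → ℝ) : EReal :=
  ⨆ x : ℝ, ((deriv u₀ x / ρ₀ x : ℝ) : EReal)

/-- The infimum of `u₀' / ρ₀`, as an extended real number. -/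
noncomputable def infRatio (ρ₀ u₀ : ℝ → ℝ) : EReal :=
  ⨅ x : ℝ, ((deriv u₀ x / ρ₀ x : ℝ) : EReal)

/-- The threshold `-√(2k / ρ₀(α))`. -/
noncomputable def threshold (k : ℝ) (ρ₀ : ℝ → ℝ) (α : ℝ) : ℝ :=
  -Real.sqrt (2 * k / ρ₀ α)

end ViscousEP

/-! Put β = u_x/ρ. Conservation of mass says that 1/ρ has derivative β along particle paths.
Differentiating the momentum equation in x and using E_x = ρ gives β_t + uβ_x = k + β_xx/ρ
(`IsSolution.ratio_pde`): the nonlocal field has become the constant k. A maximum principle on the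
line (`le_of_sublinear`) then keeps β between inf β(·,0) + kt and sup β(·,0) + kt, and 1/ρ along the
path from α between parabolas 1/ρ₀(α) + Mt + kt²/2. The thresholds are discriminant conditions for
these parabolas. In case (1) the upper parabola is negative at its vertex t = -M/k (`lifespan_le`).
In case (2) the lower one stays positive, uniformly for starting points in a compact set; since the
velocity is bounded, this yields local bounds (`Flow.exists_local_bounds`). The common leading
coefficient k/2 gives the asymptotics along paths.

Paths are obtained as level sets of a mass coordinate m with m_x = ρ, m_t = -ρu
(`Flow.exists_path`). A balanced E is such a coordinate, with range (-H, H). On a band |E| ≤ η the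
velocity is ktE up to an error that is bounded plus a small multiple of t
(`Flow.velocity_le_of_band`). Hence the paths labelled ±η escape to ±∞, a fixed x eventually meets
only paths that start in a compact set, and the path asymptotics become asymptotics at x.

For the extension to t = T, the derivations D = ∂_t + u∂ₓ and δ = ρ⁻¹∂ₓ commute, and 1/ρ, β and q =
βₓ satisfy transport and parabolic equations in them (`MassSystem`). Bernstein's method, a maximum
principle for ζ²g² + λf² with the cut-off ζ = η² - E² (so that Dζ = 0), bounds q
(`IsLabel.gradient_estimate`, `IsLabel.flux_mem_bounded`). The same estimate, applied to
δ-derivatives of q, bounds all derivatives by induction (`MassSystem.derivsIn_all`). Functions whose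
derivatives of all orders are locally bounded near T extend smoothly to T
(`IsTame.contDiffOn_extend`), and the equations persist by continuity (`IsNiceSolution.extend`). -/

namespace ViscousEP

open scoped Topology ContDiff

/-! ### Partial derivatives of functions on the plane -/

/-- Partial derivative in the first variable. -/
noncomputable def px (f : ℝ × ℝ → ℝ) (p : ℝ × ℝ) : ℝ := fderiv ℝ f p (1, 0)

/-- Partial derivative in the second variable. -/
noncomputable def pt (f : ℝ × ℝ → ℝ) (p : ℝ × ℝ) : ℝ := fderiv ℝ f p (0, 1)

/-- The open space-time strip. -/
def strip (T : ℝ) : Set (ℝ × ℝ) := univ ×ˢ Ioo 0 T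

/-- The space-time strip including the initial time. -/
def strip₀ (T : ℝ) : Set (ℝ × ℝ) := univ ×ˢ Ico 0 T

theorem isOpen_strip (T : ℝ) : IsOpen (strip T) := isOpen_univ.prod isOpen_Ioo

theorem strip_subset (T : ℝ) : strip T ⊆ strip₀ T :=
  prod_mono subset_rfl Ioo_subset_Ico_self

theorem mem_strip {T x t : ℝ} : (x, t) ∈ strip T ↔ 0 < t ∧ t < T := by simp [strip]

theorem mem_strip₀ {T x t : ℝ} : (x, t) ∈ strip₀ T ↔ 0 ≤ t ∧ t < T := by simp [strip₀]

theorem strip_mem_nhds {T : ℝ} {p : ℝ × ℝ} (hp : p ∈ strip T) : strip T ∈ 𝓝 p :=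
  (isOpen_strip T).mem_nhds hp

theorem hasDerivAt_comp_curve {f : ℝ × ℝ → ℝ} {X : ℝ → ℝ} {t x' : ℝ}
    (hf : DifferentiableAt ℝ f (X t, t)) (hX : HasDerivAt X x' t) :
    HasDerivAt (fun s => f (X s, s)) (pt f (X t, t) + x' * px f (X t, t)) t := by
  have h := HasFDerivAt.comp_hasDerivAt (f := fun s => (X s, s)) t hf.hasFDerivAt
    (hX.prodMk (hasDerivAt_id t))
  have e : ((x', 1) : ℝ × ℝ) = (0, 1) + x' • (1, 0) := by simp
  refine h.congr_deriv ?_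
  rw [e, map_add, map_smul]
  simp [px, pt]

theorem hasDerivAt_px {f : ℝ × ℝ → ℝ} {x t : ℝ} (hf : DifferentiableAt ℝ f (x, t)) :
    HasDerivAt (fun y => f (y, t)) (px f (x, t)) x :=
  hf.hasFDerivAt.comp_hasDerivAt x ((hasDerivAt_id x).prodMk (hasDerivAt_const x t))

theorem hasDerivAt_pt {f : ℝ × ℝ → ℝ} {x t : ℝ} (hf : DifferentiableAt ℝ f (x, t)) :
    HasDerivAt (fun s => f (x, s)) (pt f (x, t)) t :=
  hf.hasFDerivAt.comp_hasDerivAt t ((hasDerivAt_const t x).prodMk (hasDerivAt_id t))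

theorem px_congr {f g : ℝ × ℝ → ℝ} {p : ℝ × ℝ} (h : f =ᶠ[𝓝 p] g) : px f p = px g p := by
  simp only [px, h.fderiv_eq]

theorem pt_congr {f g : ℝ × ℝ → ℝ} {p : ℝ × ℝ} (h : f =ᶠ[𝓝 p] g) : pt f p = pt g p := by
  simp only [pt, h.fderiv_eq]

section Rules

variable {f g : ℝ × ℝ → ℝ} {p : ℝ × ℝ}

theorem px_add (hf : DifferentiableAt ℝ f p) (hg : DifferentiableAt ℝ g p) :
    px (fun q => f q + g q) p = px f p + px g p := by
  simp only [px]; rw [fderiv_fun_add hf hg]; simp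

theorem px_mul (hf : DifferentiableAt ℝ f p) (hg : DifferentiableAt ℝ g p) :
    px (fun q => f q * g q) p = f p * px g p + g p * px f p := by
  simp only [px]; rw [fderiv_fun_mul hf hg]; simp

theorem pt_mul (hf : DifferentiableAt ℝ f p) (hg : DifferentiableAt ℝ g p) :
    pt (fun q => f q * g q) p = f p * pt g p + g p * pt f p := by
  simp only [pt]; rw [fderiv_fun_mul hf hg]; simp

theorem px_inv (hf : DifferentiableAt ℝ f p) (h0 : f p ≠ 0) :
    px (fun q => (f q)⁻¹) p = -(px f p) / f p ^ 2 := by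
  have h : HasFDerivAt (fun q => (f q)⁻¹) _ p := (hasFDerivAt_inv h0).comp p hf.hasFDerivAt
  simp only [px]
  rw [h.fderiv]; simp; field_simp

theorem pt_inv (hf : DifferentiableAt ℝ f p) (h0 : f p ≠ 0) :
    pt (fun q => (f q)⁻¹) p = -(pt f p) / f p ^ 2 := by
  have h : HasFDerivAt (fun q => (f q)⁻¹) _ p := (hasFDerivAt_inv h0).comp p hf.hasFDerivAt
  simp only [pt]
  rw [h.fderiv]; simp; field_simp

theorem px_pt_comm (hf : ContDiffAt ℝ 2 f p) : px (pt f) p = pt (px f) p := by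
  have hs : IsSymmSndFDerivAt ℝ f p := hf.isSymmSndFDerivAt (by simp)
  have hd : DifferentiableAt ℝ (fderiv ℝ f) p :=
    (hf.fderiv_right (m := 1) (by norm_num)).differentiableAt (by norm_num)
  have e1 : px (pt f) p = fderiv ℝ (fderiv ℝ f) p (1, 0) (0, 1) := by
    change fderiv ℝ (fun q => fderiv ℝ f q (0, 1)) p (1, 0) = _
    rw [fderiv_clm_apply hd (differentiableAt_const _)]; simp
  have e2 : pt (px f) p = fderiv ℝ (fderiv ℝ f) p (0, 1) (1, 0) := by
    change fderiv ℝ (fun q => fderiv ℝ f q (1, 0)) p (0, 1) = _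
    rw [fderiv_clm_apply hd (differentiableAt_const _)]; simp
  rw [e1, e2]; exact hs.eq _ _

theorem contDiffOn_px {U : Set (ℝ × ℝ)} (hU : IsOpen U) {m n : WithTop ℕ∞}
    (hf : ContDiffOn ℝ n f U) (hmn : m + 1 ≤ n) : ContDiffOn ℝ m (px f) U :=
  (hf.fderiv_of_isOpen hU hmn).clm_apply contDiffOn_const

theorem contDiffOn_pt {U : Set (ℝ × ℝ)} (hU : IsOpen U) {m n : WithTop ℕ∞}
    (hf : ContDiffOn ℝ n f U) (hmn : m + 1 ≤ n) : ContDiffOn ℝ m (pt f) U :=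
  (hf.fderiv_of_isOpen hU hmn).clm_apply contDiffOn_const

end Rules

/-- The classical facts about a solution on `[0, T)` that do not involve the field:
`r` is the density, `v` the velocity, `b = vₓ / r`, and `m` a mass coordinate. -/
structure Flow (k T C : ℝ) (r v b m : ℝ × ℝ → ℝ) : Prop where
  cont_r : ContinuousOn r (strip₀ T)
  cont_v : ContinuousOn v (strip₀ T)
  cont_b : ContinuousOn b (strip₀ T)
  cont_m : ContinuousOn m (strip₀ T)
  r_pos : ∀ p ∈ strip₀ T, 0 < r p
  v_le : ∀ p ∈ strip₀ T, |v p| ≤ C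
  diff_r : ContDiffOn ℝ 2 r (strip T)
  diff_v : ContDiffOn ℝ 3 v (strip T)
  diff_b : ContDiffOn ℝ 2 b (strip T)
  px_v : ∀ p ∈ strip T, px v p = b p * r p
  mass : ∀ p ∈ strip T, pt r p + v p * px r p + r p * px v p = 0
  b_pde : ∀ p ∈ strip T, pt b p + v p * px b p = k + px (px b) p / r p
  m_fderiv : ∀ p ∈ strip T, HasFDerivAt m
    (r p • ContinuousLinearMap.fst ℝ ℝ ℝ - (r p * v p) • ContinuousLinearMap.snd ℝ ℝ ℝ) p
  m_deriv : ∀ x t, (x, t) ∈ strip₀ T → HasDerivAt (fun y => m (y, t)) (r (x, t)) x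

/-- The mass coordinate of a density `r` with velocity `v`. -/
noncomputable def massCoord (r v : ℝ × ℝ → ℝ) (p : ℝ × ℝ) : ℝ :=
  (∫ y in (0 : ℝ)..p.1, r (y, p.2)) - ∫ s in (0 : ℝ)..p.2, r (0, s) * v (0, s)

/-! ### The mass coordinate: an antiderivative of the closed form ρ dx - ρu dt -/

section MassCoord

variable {T : ℝ} {r v : ℝ × ℝ → ℝ}

theorem continuous_slice {f : ℝ × ℝ → ℝ} (hf : ContinuousOn f (strip₀ T)) {t : ℝ} (ht : 0 ≤ t)
    (ht' : t < T) : Continuous fun y => f (y, t) := by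
  rw [← continuousOn_univ]
  exact hf.comp (by fun_prop) (fun y _ => mem_strip₀.2 ⟨ht, ht'⟩)

theorem continuousOn_vertical {f : ℝ × ℝ → ℝ} (hf : ContinuousOn f (strip₀ T)) (x : ℝ) :
    ContinuousOn (fun s => f (x, s)) (Ico 0 T) :=
  hf.comp (by fun_prop) (fun _ hs => mem_strip₀.2 hs)

theorem continuousOn_massCoord (hr : ContinuousOn r (strip₀ T)) (hv : ContinuousOn v (strip₀ T)) :
    ContinuousOn (massCoord r v) (strip₀ T) := by
  rintro ⟨x, t⟩ hp
  obtain ⟨h0, hT⟩ := mem_strip₀.1 hp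
  obtain ⟨τ, htτ, hτ⟩ := exists_between hT
  let c : ℝ → ℝ := fun s => max 0 (min s τ)
  -- Clamping time to [0, τ] makes the integrands continuous on the whole plane, as continuity of
  -- parametric integrals requires; near (x, t) within the strip the clamp changes nothing.
  have hc : Continuous c := by fun_prop
  have hcm : ∀ y s, ((y, c s) : ℝ × ℝ) ∈ strip₀ T := fun y s => mem_strip₀.2
    ⟨le_max_left _ _, max_lt (h0.trans_lt hT) ((min_le_right _ _).trans_lt hτ)⟩
  have hce : ∀ s, 0 ≤ s → s ≤ τ → c s = s := fun s h1 h2 => by simp [c, h1, h2]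
  have hr' : Continuous fun q : ℝ × ℝ => r (q.1, c q.2) := by
    rw [← continuousOn_univ]
    exact hr.comp (by fun_prop) (fun q _ => hcm _ _)
  have hv' : Continuous fun q : ℝ × ℝ => v (q.1, c q.2) := by
    rw [← continuousOn_univ]
    exact hv.comp (by fun_prop) (fun q _ => hcm _ _)
  have h1 : Continuous fun p : ℝ × ℝ => ∫ y in (0 : ℝ)..p.1, r (y, c p.2) :=
    intervalIntegral.continuous_parametric_intervalIntegral_of_continuous
      (f := fun (p : ℝ × ℝ) y => r (y, c p.2))
      (hr'.comp (by fun_prop : Continuous fun z : (ℝ × ℝ) × ℝ => (z.2, z.1.2))) continuous_fst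
  have h2 : Continuous fun p : ℝ × ℝ => ∫ s in (0 : ℝ)..p.2, r (0, c s) * v (0, c s) :=
    intervalIntegral.continuous_parametric_intervalIntegral_of_continuous
      (f := fun (_ : ℝ × ℝ) s => r (0, c s) * v (0, c s))
      ((hr'.comp (by fun_prop : Continuous fun z : (ℝ × ℝ) × ℝ => ((0 : ℝ), z.2))).mul
        (hv'.comp (by fun_prop : Continuous fun z : (ℝ × ℝ) × ℝ => ((0 : ℝ), z.2))))
      continuous_snd
  have h3 := (h1.sub h2).continuousWithinAt (s := strip₀ T) (x := (x, t))
  refine h3.congr_of_eventuallyEq_of_mem ?_ hp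
  have hev : ∀ᶠ q : ℝ × ℝ in 𝓝[strip₀ T] (x, t), q.2 < τ :=
    nhdsWithin_le_nhds ((continuous_snd.tendsto (x, t)).eventually (gt_mem_nhds htτ))
  filter_upwards [hev, self_mem_nhdsWithin] with q hq hqs
  obtain ⟨y, s⟩ := q
  have hs0 : 0 ≤ s := (mem_strip₀.1 hqs).1
  simp only [massCoord]
  congr 1
  · simp only [hce s hs0 (le_of_lt hq)]
  · refine intervalIntegral.integral_congr fun z hz => ?_
    rw [uIcc_of_le hs0] at hz
    simp only [hce z hz.1 (hz.2.trans (le_of_lt hq))]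

theorem hasDerivAt_massCoord_fst (hr : ContinuousOn r (strip₀ T)) {x t : ℝ}
    (hp : (x, t) ∈ strip₀ T) : HasDerivAt (fun y => massCoord r v (y, t)) (r (x, t)) x := by
  have hc := continuous_slice hr (mem_strip₀.1 hp).1 (mem_strip₀.1 hp).2
  have h := intervalIntegral.integral_hasDerivAt_right (hc.intervalIntegrable 0 x)
    (hc.stronglyMeasurableAtFilter _ _) hc.continuousAt
  exact h.sub_const (∫ s in (0 : ℝ)..t, r (0, s) * v (0, s))

/-- Differentiation under the integral sign gives ∫ r_t, which conservation of mass turns into a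
difference of fluxes at 0 and x. The time integral in `massCoord` cancels the flux at 0. -/
theorem hasDerivAt_massCoord_snd (hr : ContinuousOn r (strip₀ T))
    (hv : ContinuousOn v (strip₀ T)) (hr1 : ContDiffOn ℝ 1 r (strip T))
    (hv1 : ContDiffOn ℝ 1 v (strip T))
    (hm : ∀ p ∈ strip T, pt r p + v p * px r p + r p * px v p = 0) {x t : ℝ}
    (hp : (x, t) ∈ strip T) :
    HasDerivAt (fun s => massCoord r v (x, s)) (-(r (x, t) * v (x, t))) t := by
  obtain ⟨h0, hT⟩ := mem_strip.1 hp
  have dr : ∀ y s, (y, s) ∈ strip T → DifferentiableAt ℝ r (y, s) := fun y s h =>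
    (hr1.contDiffAt (strip_mem_nhds h)).differentiableAt (by norm_num)
  have dv : ∀ y s, (y, s) ∈ strip T → DifferentiableAt ℝ v (y, s) := fun y s h =>
    (hv1.contDiffAt (strip_mem_nhds h)).differentiableAt (by norm_num)
  have cpt : ContinuousOn (pt r) (strip T) :=
    (contDiffOn_pt (m := 0) (isOpen_strip T) hr1 (by norm_num)).continuousOn
  obtain ⟨t₁, ht₁, ht₁'⟩ := exists_between h0
  obtain ⟨t₂, ht₂, ht₂'⟩ := exists_between hT
  have hsub : uIcc 0 x ×ˢ Icc t₁ t₂ ⊆ strip T := fun q hq =>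
    mem_strip.2 ⟨ht₁.trans_le hq.2.1, hq.2.2.trans_lt ht₂'⟩
  obtain ⟨B, hB⟩ := (isCompact_uIcc.prod isCompact_Icc).exists_bound_of_continuousOn
    (cpt.mono hsub)
  have hint := (intervalIntegral.hasDerivAt_integral_of_dominated_loc_of_deriv_le
    (μ := volume) (a := 0) (b := x) (F := fun s y => r (y, s)) (F' := fun s y => pt r (y, s))
    (x₀ := t) (s := Ioo t₁ t₂) (bound := fun _ => B) (Ioo_mem_nhds ht₁' ht₂) ?_ ?_ ?_ ?_ ?_ ?_).2
  · have hflux : ∫ y in (0 : ℝ)..x, pt r (y, t) =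
        -(r (x, t) * v (x, t)) + r (0, t) * v (0, t) := by
      have hst : ∀ y, (y, t) ∈ strip T := fun y => mem_strip.2 ⟨h0, hT⟩
      have : ∫ y in (0 : ℝ)..x, pt r (y, t) =
          -(r (x, t) * v (x, t)) - -(r (0, t) * v (0, t)) := by
        refine intervalIntegral.integral_eq_sub_of_hasDerivAt
          (f := fun y => -(r (y, t) * v (y, t))) (fun y _ => ?_) ?_
        · refine ((hasDerivAt_px (dr y t (hst y))).mul
            (hasDerivAt_px (dv y t (hst y)))).neg.congr_deriv ?_
          linear_combination -hm (y, t) (hst y)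
        · refine ContinuousOn.intervalIntegrable ?_
          exact cpt.comp (by fun_prop) (fun y _ => hst y)
      rw [this]; ring
    have h2 : HasDerivAt (fun s' => ∫ s in (0 : ℝ)..s', r (0, s) * v (0, s))
        (r (0, t) * v (0, t)) t := by
      have hc : ContinuousOn (fun s => r (0, s) * v (0, s)) (Ico 0 T) :=
        (continuousOn_vertical hr 0).mul (continuousOn_vertical hv 0)
      refine intervalIntegral.integral_hasDerivAt_right ?_ ?_ ?_
      · refine (hc.mono ?_).intervalIntegrable
        rw [uIcc_of_le h0.le]
        exact fun s hs => ⟨hs.1, hs.2.trans_lt hT⟩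
      · exact (hc.mono Ioo_subset_Ico_self).stronglyMeasurableAtFilter isOpen_Ioo t ⟨h0, hT⟩
      · exact hc.continuousAt (Ico_mem_nhds h0 hT)
    refine (hint.sub h2).congr_deriv ?_
    rw [hflux]; ring
  · filter_upwards [Ioo_mem_nhds h0 hT] with s hs
    exact (continuous_slice hr hs.1.le hs.2).aestronglyMeasurable
  · exact (continuous_slice hr h0.le hT).intervalIntegrable _ _
  · refine ContinuousOn.aestronglyMeasurable ?_ measurableSet_uIoc
    exact cpt.comp (by fun_prop) (fun y _ => mem_strip.2 ⟨h0, hT⟩)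
  · exact ae_of_all _ fun y hy s hs => hB (y, s) ⟨uIoc_subset_uIcc hy, Ioo_subset_Icc_self hs⟩
  · exact intervalIntegrable_const
  · exact ae_of_all _ fun y hy s hs => hasDerivAt_pt (dr y s
      (mem_strip.2 ⟨ht₁.trans hs.1, hs.2.trans ht₂'⟩))

/-- Continuity of both partial derivatives upgrades them to a joint derivative, which the chain rule
along paths needs. -/
theorem hasFDerivAt_of_partial {m f g : ℝ × ℝ → ℝ} {U : Set (ℝ × ℝ)} (hU : IsOpen U)
    (hf : ContinuousOn f U) (hg : ContinuousOn g U)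
    (h1 : ∀ p ∈ U, HasDerivAt (fun y => m (y, p.2)) (f p) p.1)
    (h2 : ∀ p ∈ U, HasDerivAt (fun s => m (p.1, s)) (g p) p.2) {p : ℝ × ℝ} (hp : p ∈ U) :
    HasFDerivAt m
      (f p • ContinuousLinearMap.fst ℝ ℝ ℝ + g p • ContinuousLinearMap.snd ℝ ℝ ℝ) p := by
  have key := hasStrictFDerivAt_uncurry_coprod (𝕜 := ℝ) (u := p) (f := fun x t => m (x, t))
    (f₁ := fun x t => ContinuousLinearMap.toSpanSingleton ℝ (f (x, t)))
    (f₂ := fun x t => ContinuousLinearMap.toSpanSingleton ℝ (g (x, t))) ?_ ?_ ?_ ?_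
  · refine HasFDerivAt.congr_fderiv (f := m) key.hasFDerivAt ?_
    refine ContinuousLinearMap.ext fun z => ?_
    change z.1 * f p + z.2 * g p = f p * z.1 + g p * z.2
    ring
  · filter_upwards [hU.mem_nhds hp] with q hq
    exact (h1 q hq).hasFDerivAt
  · filter_upwards [hU.mem_nhds hp] with q hq
    exact (h2 q hq).hasFDerivAt
  · exact ((ContinuousLinearMap.toSpanSingletonCLE (𝕜 := ℝ) (E := ℝ)).continuous.continuousAt.comp
      (hf.continuousAt (hU.mem_nhds hp)))
  · exact ((ContinuousLinearMap.toSpanSingletonCLE (𝕜 := ℝ) (E := ℝ)).continuous.continuousAt.comp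
      (hg.continuousAt (hU.mem_nhds hp)))

end MassCoord

end ViscousEP

namespace ViscousEP

open scoped Topology ContDiff

/-! ### From solutions to flows -/

/-- A curried function of space and time as a function on the plane. -/
def unc (f : ℝ → ℝ → ℝ) (p : ℝ × ℝ) : ℝ := f p.1 p.2

theorem dx_eq_px {f : ℝ → ℝ → ℝ} {x t : ℝ} (hf : DifferentiableAt ℝ (unc f) (x, t)) :
    dx f x t = px (unc f) (x, t) :=
  (hasDerivAt_px hf).deriv

theorem dt_eq_pt {f : ℝ → ℝ → ℝ} {x t T : ℝ} (hf : DifferentiableAt ℝ (unc f) (x, t))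
    (ht : 0 < t) (hT : t < T) : dt (Ico 0 T) f x t = pt (unc f) (x, t) := by
  rw [dt, derivWithin_of_mem_nhds (Ico_mem_nhds ht hT)]
  exact (hasDerivAt_pt hf).deriv

theorem dx_eq_fderivWithin {f : ℝ → ℝ → ℝ} {I : Set ℝ} {x t : ℝ} (ht : t ∈ I)
    (hf : DifferentiableWithinAt ℝ (unc f) (univ ×ˢ I) (x, t)) :
    HasDerivAt (fun y => f y t) (fderivWithin ℝ (unc f) (univ ×ˢ I) (x, t) (1, 0)) x := by
  have h1 : HasDerivWithinAt (fun y : ℝ => ((y, t) : ℝ × ℝ)) (1, 0) univ x :=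
    ((hasDerivAt_id x).prodMk (hasDerivAt_const x t)).hasDerivWithinAt
  have h2 := HasFDerivWithinAt.comp_hasDerivWithinAt (f := fun y : ℝ => ((y, t) : ℝ × ℝ)) x
    hf.hasFDerivWithinAt h1 (fun y _ => ⟨mem_univ _, ht⟩)
  exact hasDerivWithinAt_univ.1 h2

theorem uniqueDiffOn_strip₀ (T : ℝ) : UniqueDiffOn ℝ (strip₀ T) :=
  uniqueDiffOn_univ.prod (uniqueDiffOn_Ico 0 T)

section

variable {n : ℕ∞} {k T : ℝ} {ρ₀ u₀ : ℝ → ℝ} {ρ u E : ℝ → ℝ → ℝ}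

theorem IsSolution.continuousOn_density {I : Set ℝ} (h : IsSolution n k I ρ u E) :
    ContinuousOn (unc ρ) (univ ×ˢ I) := h.smooth_density.continuousOn

theorem IsSolution.diff_density (hn : 2 ≤ n) (h : IsSolution n k (Ico 0 T) ρ u E) :
    ContDiffOn ℝ 2 (unc ρ) (strip T) :=
  (h.smooth_density.of_le
    (show ((2 : ℕ∞) : WithTop ℕ∞) ≤ n from WithTop.coe_le_coe.2 hn)).mono (strip_subset T)

theorem IsSolution.diff_velocity₀ (hn : 2 ≤ n) (h : IsSolution n k (Ico 0 T) ρ u E) :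
    ContDiffOn ℝ 3 (unc u) (strip₀ T) := by
  have h3 : (3 : ℕ∞) ≤ n + 1 := by
    have : (3 : ℕ∞) = 2 + 1 := by norm_num
    rw [this]; gcongr
  exact h.smooth_velocity.of_le
    (show ((3 : ℕ∞) : WithTop ℕ∞) ≤ (n + 1 : ℕ∞) from WithTop.coe_le_coe.2 h3)

theorem IsSolution.diff_velocity (hn : 2 ≤ n) (h : IsSolution n k (Ico 0 T) ρ u E) :
    ContDiffOn ℝ 3 (unc u) (strip T) := (h.diff_velocity₀ hn).mono (strip_subset T)

theorem IsSolution.differentiableAt_density (hn : 2 ≤ n) (h : IsSolution n k (Ico 0 T) ρ u E)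
    {p : ℝ × ℝ} (hp : p ∈ strip T) : DifferentiableAt ℝ (unc ρ) p :=
  ((h.diff_density hn).contDiffAt (strip_mem_nhds hp)).differentiableAt (by norm_num)

theorem IsSolution.differentiableAt_velocity (hn : 2 ≤ n) (h : IsSolution n k (Ico 0 T) ρ u E)
    {p : ℝ × ℝ} (hp : p ∈ strip T) : DifferentiableAt ℝ (unc u) p :=
  ((h.diff_velocity hn).contDiffAt (strip_mem_nhds hp)).differentiableAt (by norm_num)

theorem IsSolution.unc_density_pos (h : IsSolution n k (Ico 0 T) ρ u E) {p : ℝ × ℝ}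
    (hp : p ∈ strip₀ T) : 0 < unc ρ p := h.density_pos p.2 hp.2 p.1

theorem IsSolution.ratio_eq (hn : 2 ≤ n) (h : IsSolution n k (Ico 0 T) ρ u E) {p : ℝ × ℝ}
    (hp : p ∈ strip T) : unc (ratio ρ u) p = px (unc u) p / unc ρ p := by
  have := dx_eq_px (f := u) (x := p.1) (t := p.2) (h.differentiableAt_velocity hn hp)
  simp only [unc, ratio] at this ⊢
  rw [this]

theorem IsSolution.diff_ratio (hn : 2 ≤ n) (h : IsSolution n k (Ico 0 T) ρ u E) :
    ContDiffOn ℝ 2 (unc (ratio ρ u)) (strip T) :=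
  ((contDiffOn_px (isOpen_strip T) (h.diff_velocity hn) (by norm_num)).div (h.diff_density hn)
    (fun _ hp => (h.unc_density_pos (strip_subset T hp)).ne')).congr fun _ hp => h.ratio_eq hn hp

/-- Continuity down to t = 0 is what lets comparison arguments start from the initial data. There
the x-derivative is read off from the derivative within the strip, which is continuous up to the
edge. -/
theorem IsSolution.continuousOn_ratio (hn : 2 ≤ n) (h : IsSolution n k (Ico 0 T) ρ u E) :
    ContinuousOn (unc (ratio ρ u)) (strip₀ T) := by
  have h1 := h.diff_velocity₀ hn
  have hc : ContinuousOn (fun p => fderivWithin ℝ (unc u) (strip₀ T) p (1, 0)) (strip₀ T) :=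
    (h1.continuousOn_fderivWithin (uniqueDiffOn_strip₀ T) (by norm_num)).clm_apply
      continuousOn_const
  refine (hc.div h.continuousOn_density fun p hp => (h.unc_density_pos hp).ne').congr ?_
  intro p hp
  have := (dx_eq_fderivWithin (f := u) (x := p.1) hp.2
    (h1.differentiableOn (by norm_num) _ hp)).deriv
  simp only [unc, ratio, dx]
  rw [this]
  rfl

theorem IsSolution.mass_px (hn : 2 ≤ n) (h : IsSolution n k (Ico 0 T) ρ u E) {p : ℝ × ℝ}
    (hp : p ∈ strip T) : pt (unc ρ) p + unc u p * px (unc ρ) p + unc ρ p * px (unc u) p = 0 := by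
  have dr := h.differentiableAt_density hn hp
  have dv := h.differentiableAt_velocity hn hp
  have e := h.mass p.2 (strip_subset T hp).2 p.1
  rw [dt_eq_pt (x := p.1) (t := p.2) dr hp.2.1 hp.2.2, dx_eq_px (x := p.1) (t := p.2)
    (f := fun y s => ρ y s * u y s) (dr.mul dv)] at e
  have e2 : px (unc fun y s => ρ y s * u y s) (p.1, p.2) =
      unc ρ p * px (unc u) p + unc u p * px (unc ρ) p := px_mul dr dv
  rw [e2] at e
  linear_combination e

theorem IsSolution.momentum_px (hn : 2 ≤ n) (h : IsSolution n k (Ico 0 T) ρ u E) {p : ℝ × ℝ}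
    (hp : p ∈ strip T) :
    pt (unc u) p + unc u p * px (unc u) p = k * unc E p + px (unc (ratio ρ u)) p := by
  have dv := h.differentiableAt_velocity hn hp
  have db := ((h.diff_ratio hn).contDiffAt (strip_mem_nhds hp)).differentiableAt (by norm_num)
  have e := h.momentum p.2 (strip_subset T hp).2 p.1
  rwa [dt_eq_pt (x := p.1) (t := p.2) dv hp.2.1 hp.2.2, dx_eq_px (x := p.1) (t := p.2) dv,
    dx_eq_px (x := p.1) (t := p.2) db] at e

/-- After ∂ₓ of the momentum equation, substitute u_x = βρ: the terms in which ρ is differentiated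
combine into β times the mass equation and vanish. The field enters only through E_x = ρ, so its
free function of t is harmless. -/
theorem IsSolution.ratio_pde (hn : 2 ≤ n) (h : IsSolution n k (Ico 0 T) ρ u E) {p : ℝ × ℝ}
    (hp : p ∈ strip T) :
    pt (unc (ratio ρ u)) p + unc u p * px (unc (ratio ρ u)) p =
      k + px (px (unc (ratio ρ u))) p / unc ρ p := by
  have hO := isOpen_strip T
  have hN := strip_mem_nhds hp
  have hr0 := h.unc_density_pos (strip_subset T hp)
  have d1 : ∀ {f : ℝ × ℝ → ℝ}, ContDiffOn ℝ 1 f (strip T) → DifferentiableAt ℝ f p :=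
    fun hf => (hf.contDiffAt hN).differentiableAt (by norm_num)
  have cv := h.diff_velocity hn
  have cb := h.diff_ratio hn
  have cr := h.diff_density hn
  have dv := h.differentiableAt_velocity hn hp
  have dr := h.differentiableAt_density hn hp
  have db : DifferentiableAt ℝ (unc (ratio ρ u)) p := d1 (cb.of_le (by norm_num))
  have dvx : DifferentiableAt ℝ (px (unc u)) p := d1 (contDiffOn_px hO cv (by norm_num))
  have dvt : DifferentiableAt ℝ (pt (unc u)) p := d1 (contDiffOn_pt hO cv (by norm_num))
  have dbx : DifferentiableAt ℝ (px (unc (ratio ρ u))) p := d1 (contDiffOn_px hO cb (by norm_num))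
  -- differentiate the momentum equation in space
  have hE : px (fun q => pt (unc u) q + unc u q * px (unc u) q) p =
      k * unc ρ p + px (px (unc (ratio ρ u))) p := by
    have h1 : HasDerivAt (fun y => k * E y p.2 + px (unc (ratio ρ u)) (y, p.2))
        (k * ρ p.1 p.2 + px (px (unc (ratio ρ u))) p) p.1 :=
      ((h.poisson p.2 (strip_subset T hp).2 p.1).const_mul k).add (hasDerivAt_px (x := p.1)
        (t := p.2) dbx)
    have h2 := hasDerivAt_px (x := p.1) (t := p.2) (dvt.add (dv.mul dvx))
    refine h2.unique (h1.congr_of_eventuallyEq (Eventually.of_forall fun y => ?_))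
    exact h.momentum_px hn (p := (y, p.2)) ⟨mem_univ _, hp.2⟩
  rw [px_add dvt (dv.fun_mul dvx), px_mul dv dvx, px_pt_comm
    ((cv.of_le (by norm_num)).contDiffAt hN)] at hE
  have heq : px (unc u) =ᶠ[𝓝 p] fun q => unc (ratio ρ u) q * unc ρ q := by
    filter_upwards [hN] with q hq
    rw [h.ratio_eq hn hq, div_mul_cancel₀ _ (h.unc_density_pos (strip_subset T hq)).ne']
  have e1 := pt_congr heq
  have e2 := px_congr heq
  rw [pt_mul db dr] at e1
  rw [px_mul db dr] at e2
  rw [e1, e2, heq.self_of_nhds] at hE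
  have hm := h.mass_px hn hp
  rw [heq.self_of_nhds] at hm
  field_simp
  linear_combination hE - unc (ratio ρ u) p * hm

theorem IsNiceSolution.exists_flow (hn : 2 ≤ n) (h : IsNiceSolution n k ρ₀ u₀ (Ico 0 T) ρ u E) :
    ∃ C, 0 ≤ C ∧
      Flow k T C (unc ρ) (unc u) (unc (ratio ρ u)) (massCoord (unc ρ) (unc u)) := by
  obtain ⟨C, hC⟩ := h.bounded T
  have hs := h.solution
  have cr : ContinuousOn (unc ρ) (strip₀ T) := hs.continuousOn_density
  have cv : ContinuousOn (unc u) (strip₀ T) := (hs.diff_velocity₀ hn).continuousOn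
  have dr := (hs.diff_density hn).of_le (show (1 : WithTop ℕ∞) ≤ 2 by norm_num)
  have dv := (hs.diff_velocity hn).of_le (show (1 : WithTop ℕ∞) ≤ 3 by norm_num)
  refine ⟨max C 0, le_max_right _ _, cr, cv, hs.continuousOn_ratio hn,
    continuousOn_massCoord cr cv, fun p => hs.unc_density_pos,
    fun p hp => (hC p.2 hp.2 hp.2.2.le p.1).trans (le_max_left _ _), hs.diff_density hn,
    hs.diff_velocity hn, hs.diff_ratio hn, fun p hp => ?_, fun p => hs.mass_px hn,
    fun p => hs.ratio_pde hn, fun p hp => ?_, fun x t => hasDerivAt_massCoord_fst cr⟩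
  · rw [hs.ratio_eq hn hp, div_mul_cancel₀ _ (hs.unc_density_pos (strip_subset T hp)).ne']
  · have := hasFDerivAt_of_partial (m := massCoord (unc ρ) (unc u)) (f := unc ρ)
      (g := fun q => -(unc ρ q * unc u q)) (isOpen_strip T) (cr.mono (strip_subset T))
      ((cr.mul cv).neg.mono (strip_subset T))
      (fun q hq => hasDerivAt_massCoord_fst (x := q.1) (t := q.2) cr (strip_subset T hq))
      (fun q hq => hasDerivAt_massCoord_snd (x := q.1) (t := q.2) cr cv dr dv
        (fun z => hs.mass_px hn) hq) hp
    refine this.congr_fderiv ?_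
    refine ContinuousLinearMap.ext fun z => ?_
    change unc ρ p * z.1 + -(unc ρ p * unc u p) * z.2 = unc ρ p * z.1 - unc ρ p * unc u p * z.2
    ring

theorem IsNiceSolution.restrict (h : IsNiceSolution n k ρ₀ u₀ (Ici 0) ρ u E) (T : ℝ) :
    IsNiceSolution n k ρ₀ u₀ (Ico 0 T) ρ u E := by
  have hsub : Ico 0 T ⊆ Ici (0 : ℝ) := Ico_subset_Ici_self
  -- The two time intervals agree near every t < T, including the one-sided situation at t = 0.
  have hdt : ∀ (f : ℝ → ℝ → ℝ) x, ∀ t ∈ Ico 0 T, dt (Ico 0 T) f x t = dt (Ici 0) f x t := by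
    intro f x t ht
    refine derivWithin_congr_set ?_
    filter_upwards [Iio_mem_nhds ht.2] with s hs
    exact propext ⟨fun h => h.1, fun h => ⟨h, hs⟩⟩
  have hs := h.solution
  refine ⟨⟨hs.smooth_density.mono (prod_mono subset_rfl hsub),
    hs.smooth_velocity.mono (prod_mono subset_rfl hsub), fun t ht => hs.density_pos t (hsub ht),
    fun t ht x => ?_, fun t ht x => ?_, fun t ht => hs.poisson t (hsub ht)⟩,
    fun τ => ?_, ?_, h.initial_density, h.initial_velocity⟩
  · rw [hdt _ _ _ ht]; exact hs.mass t (hsub ht) x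
  · rw [hdt _ _ _ ht]; exact hs.momentum t (hsub ht) x
  · obtain ⟨C, hC⟩ := h.bounded τ
    exact ⟨C, fun t ht => hC t (hsub ht)⟩
  · obtain ⟨γ, hγ, hR⟩ := h.sublinear
    refine ⟨γ, hγ, fun ε hε => ?_⟩
    obtain ⟨R, hR⟩ := hR ε hε
    exact ⟨R, fun t ht => hR t (hsub ht)⟩

end

end ViscousEP

namespace ViscousEP

open scoped Topology ContDiff

/-! ### Maximum principles -/

/-- Were d > 0, the point would also be a local minimum, so f would be locally constant and d would
be 0. -/
theorem secondDeriv_nonpos_of_isLocalMax {f f' : ℝ → ℝ} {x d : ℝ} (h : IsLocalMax f x)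
    (hf : ∀ᶠ y in 𝓝 x, HasDerivAt f (f' y) y) (hf' : HasDerivAt f' d x) : d ≤ 0 := by
  by_contra! hd
  have he : deriv f =ᶠ[𝓝 x] f' := hf.mono fun y hy => hy.deriv
  have h2 : deriv (deriv f) x = d := by rw [he.deriv_eq]; exact hf'.deriv
  have hmin := isLocalMin_of_deriv_deriv_pos (by rw [h2]; exact hd) h.deriv_eq_zero
    hf.self_of_nhds.continuousAt
  have hc : f =ᶠ[𝓝 x] fun _ => f x := by
    filter_upwards [h, hmin] with y h1 h3 using le_antisymm h1 h3
  have : deriv (deriv f) x = 0 := by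
    rw [hc.deriv.deriv_eq]; simp
  linarith

theorem deriv_nonneg_of_left_max {g : ℝ → ℝ} {t d : ℝ} (hg : HasDerivAt g d t)
    (h : ∀ᶠ s in 𝓝[<] t, g s ≤ g t) : 0 ≤ d := by
  have h1 := (hasDerivAt_iff_tendsto_slope.1 hg).mono_left (nhdsLT_le_nhdsNE t)
  refine ge_of_tendsto h1 ?_
  filter_upwards [h, self_mem_nhdsWithin] with s hs hst
  rw [slope_def_field]
  exact div_nonneg_of_nonpos (by linarith) (by linarith [mem_Iio.1 hst])

/-- First and second order conditions at a maximum over the past. -/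
theorem parabolic_max_conditions {F : ℝ × ℝ → ℝ} {Fx : ℝ → ℝ} {Fxx Ft x t : ℝ}
    (hmax : ∀ᶠ q in 𝓝 (x, t), q.2 ≤ t → F q ≤ F (x, t))
    (hx : ∀ᶠ y in 𝓝 x, HasDerivAt (fun z => F (z, t)) (Fx y) y) (hxx : HasDerivAt Fx Fxx x)
    (ht : HasDerivAt (fun s => F (x, s)) Ft t) : Fx x = 0 ∧ Fxx ≤ 0 ∧ 0 ≤ Ft := by
  have hl : IsLocalMax (fun z => F (z, t)) x := by
    have := (Continuous.prodMk_left t).tendsto x |>.eventually hmax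
    filter_upwards [this] with y hy using hy le_rfl
  refine ⟨hl.hasDerivAt_eq_zero hx.self_of_nhds, secondDeriv_nonpos_of_isLocalMax hl hx hxx,
    deriv_nonneg_of_left_max ht ?_⟩
  have := (Continuous.prodMk_right x).tendsto t |>.eventually hmax
  filter_upwards [nhdsWithin_le_nhds this, self_mem_nhdsWithin] with s hs hst using hs hst.le

/-- A nonnegative maximum over the rectangle is excluded at the bottom and on the sides. It may
still lie on the top edge, so only points of the past are compared and the time derivative has a
sign instead of vanishing. -/
theorem neg_of_rectangle {F : ℝ × ℝ → ℝ} {Fx Fxx Ft : ℝ → ℝ → ℝ} {R τ : ℝ}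
    (hc : ContinuousOn F (Icc (-R) R ×ˢ Icc 0 τ))
    (h0 : ∀ x, |x| ≤ R → F (x, 0) < 0)
    (hR : ∀ x t, |x| = R → 0 ≤ t → t ≤ τ → F (x, t) < 0)
    (hx : ∀ x t, 0 < t → t ≤ τ → HasDerivAt (fun z => F (z, t)) (Fx x t) x)
    (hxx : ∀ x t, 0 < t → t ≤ τ → HasDerivAt (fun z => Fx z t) (Fxx x t) x)
    (ht : ∀ x t, 0 < t → t ≤ τ → HasDerivAt (fun s => F (x, s)) (Ft x t) t)
    (hneg : ∀ x t, |x| ≤ R → 0 < t → t ≤ τ → Fx x t = 0 → Fxx x t ≤ 0 → Ft x t < 0)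
    {x t : ℝ} (hxR : |x| ≤ R) (ht0 : 0 ≤ t) (htτ : t ≤ τ) : F (x, t) < 0 := by
  by_contra! hF
  obtain ⟨⟨y, s⟩, ⟨hy, hs⟩, hmax⟩ := (isCompact_Icc.prod isCompact_Icc).exists_isMaxOn
    ⟨(x, t), abs_le.1 hxR, ht0, htτ⟩ hc
  have hFy : 0 ≤ F (y, s) := hF.trans (hmax ⟨abs_le.1 hxR, ht0, htτ⟩)
  have hyR : |y| ≤ R := abs_le.2 hy
  have hs0 : 0 < s := by
    rcases hs.1.eq_or_lt with h | h
    · rw [← show 0 = s from h] at hFy; linarith [h0 y hyR]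
    · exact h
  have hyR' : |y| < R := hyR.lt_of_ne fun h => by linarith [hR y s h hs.1 hs.2]
  have hloc : ∀ᶠ q in 𝓝 (y, s), q.2 ≤ s → F q ≤ F (y, s) := by
    have h1 : ∀ᶠ q : ℝ × ℝ in 𝓝 (y, s), |q.1| < R :=
      (continuous_fst.abs.tendsto (y, s)).eventually (gt_mem_nhds hyR')
    have h2 : ∀ᶠ q : ℝ × ℝ in 𝓝 (y, s), 0 < q.2 :=
      (continuous_snd.tendsto (y, s)).eventually (lt_mem_nhds hs0)
    filter_upwards [h1, h2] with q hq1 hq2 hq3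
    exact hmax ⟨abs_le.1 hq1.le, hq2.le, hq3.trans hs.2⟩
  obtain ⟨e1, e2, e3⟩ := parabolic_max_conditions hloc
    (Eventually.of_forall fun z => hx z s hs0 hs.2) (hxx y s hs0 hs.2) (ht y s hs0 hs.2)
  linarith [hneg y s hyR hs0 hs.2 e1 e2]

/-- A smooth function that agrees with `|x|` for `1 ≤ |x|`. -/
noncomputable def smoothAbs (x : ℝ) : ℝ := x * (2 * Real.smoothTransition ((x + 1) / 2) - 1)

theorem contDiff_smoothAbs : ContDiff ℝ ∞ smoothAbs := by
  have h : ContDiff ℝ ∞ fun x : ℝ => Real.smoothTransition ((x + 1) / 2) :=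
    Real.smoothTransition.contDiff.comp (by fun_prop)
  exact contDiff_id.mul ((contDiff_const.mul h).sub contDiff_const)

theorem smoothAbs_of_one_le {x : ℝ} (hx : 1 ≤ x) : smoothAbs x = x := by
  rw [smoothAbs, Real.smoothTransition.one_of_one_le (by linarith)]; ring

theorem smoothAbs_of_le_neg_one {x : ℝ} (hx : x ≤ -1) : smoothAbs x = -x := by
  rw [smoothAbs, Real.smoothTransition.zero_of_nonpos (by linarith)]; ring

theorem smoothAbs_of_one_le_abs {x : ℝ} (hx : 1 ≤ |x|) : smoothAbs x = |x| := by
  rcases le_abs.1 hx with h | h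
  · rw [smoothAbs_of_one_le h, abs_of_nonneg (by linarith)]
  · rw [smoothAbs_of_le_neg_one (by linarith), abs_of_nonpos (by linarith)]

theorem neg_one_le_smoothAbs (x : ℝ) : -1 ≤ smoothAbs x := by
  rcases le_total 1 |x| with h | h
  · rw [smoothAbs_of_one_le_abs h]; linarith [abs_nonneg x]
  · have h1 := Real.smoothTransition.nonneg ((x + 1) / 2)
    have h2 := Real.smoothTransition.le_one ((x + 1) / 2)
    have h3 : |smoothAbs x| ≤ 1 := by
      rw [smoothAbs, abs_mul]
      exact mul_le_one₀ h (abs_nonneg _) (abs_le.2 ⟨by linarith, by linarith⟩)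
    exact (abs_le.1 h3).1

/-- Outside [-1, 1] the barrier is affine, so a possibly unbounded coefficient 1/ρ has no second
derivative to multiply there. -/
theorem deriv_smoothAbs_of_one_lt_abs {x : ℝ} (hx : 1 < |x|) :
    |deriv smoothAbs x| ≤ 1 ∧ deriv (deriv smoothAbs) x = 0 := by
  rcases lt_abs.1 hx with h | h
  · have e : smoothAbs =ᶠ[𝓝 x] id := by
      filter_upwards [lt_mem_nhds h] with y hy using smoothAbs_of_one_le hy.le
    refine ⟨by rw [e.deriv_eq]; simp, ?_⟩
    rw [e.deriv.deriv_eq]; simp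
  · have e : smoothAbs =ᶠ[𝓝 x] fun y => -y := by
      filter_upwards [gt_mem_nhds (show x < -1 by linarith)] with y hy
        using smoothAbs_of_le_neg_one hy.le
    refine ⟨by rw [e.deriv_eq]; simp, ?_⟩
    rw [e.deriv.deriv_eq]; simp

theorem hasDerivAt_smoothAbs (x : ℝ) : HasDerivAt smoothAbs (deriv smoothAbs x) x :=
  (contDiff_smoothAbs.differentiable (by simp) x).hasDerivAt

theorem contDiff_deriv_smoothAbs : ContDiff ℝ 1 (deriv smoothAbs) := by
  have : ContDiff ℝ (1 + 1) smoothAbs := contDiff_smoothAbs.of_le (by norm_cast)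
  exact (contDiff_succ_iff_deriv.1 this).2.2

theorem hasDerivAt_deriv_smoothAbs (x : ℝ) :
    HasDerivAt (deriv smoothAbs) (deriv (deriv smoothAbs) x) x :=
  (contDiff_deriv_smoothAbs.differentiable (by norm_num) x).hasDerivAt

theorem exists_smoothAbs_bounds :
    ∃ B, 0 ≤ B ∧ ∀ x, |deriv smoothAbs x| ≤ B ∧ |deriv (deriv smoothAbs) x| ≤ B := by
  obtain ⟨B₁, h₁⟩ := (isCompact_Icc (a := (-1 : ℝ)) (b := 1)).exists_bound_of_continuousOn
    contDiff_deriv_smoothAbs.continuous.continuousOn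
  obtain ⟨B₂, h₂⟩ := (isCompact_Icc (a := (-1 : ℝ)) (b := 1)).exists_bound_of_continuousOn
    (contDiff_deriv_smoothAbs.continuous_deriv (by norm_num)).continuousOn
  refine ⟨max 1 (max B₁ B₂), zero_le_one.trans (le_max_left _ _), fun x => ?_⟩
  rcases le_or_gt |x| 1 with h | h
  · exact ⟨(h₁ x (abs_le.1 h)).trans ((le_max_left _ _).trans (le_max_right _ _)),
      (h₂ x (abs_le.1 h)).trans ((le_max_right _ _).trans (le_max_right _ _))⟩
  · obtain ⟨h3, h4⟩ := deriv_smoothAbs_of_one_lt_abs h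
    refine ⟨h3.trans (le_max_left _ _), ?_⟩
    rw [h4, abs_zero]; exact zero_le_one.trans (le_max_left _ _)

/-! ### Comparison principles for b_t + v b_x = κ + b_xx / r -/

section Comparison

variable {T C κ : ℝ} {r v b : ℝ × ℝ → ℝ}

theorem hasDerivAt_px_px (db : ContDiffOn ℝ 2 b (strip T)) {x t : ℝ} (h : (x, t) ∈ strip T) :
    HasDerivAt (fun y => px b (y, t)) (px (px b) (x, t)) x :=
  hasDerivAt_px (((contDiffOn_px (m := 1) (isOpen_strip T) db (by norm_num)).contDiffAt
    (strip_mem_nhds h)).differentiableAt (by norm_num))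

theorem differentiableAt_of_strip {n : WithTop ℕ∞} (db : ContDiffOn ℝ n b (strip T)) (hn : 1 ≤ n)
    {p : ℝ × ℝ} (h : p ∈ strip T) : DifferentiableAt ℝ b p :=
  (db.contDiffAt (strip_mem_nhds h)).differentiableAt (by positivity)

/-- Comparison on a bounded interval. -/
theorem le_of_local_bounds (hb : ContinuousOn b (strip₀ T)) (db : ContDiffOn ℝ 2 b (strip T))
    (hr : ∀ p ∈ strip₀ T, 0 < r p)
    (pde : ∀ p ∈ strip T, pt b p + v p * px b p = κ + px (px b) p / r p) {R N : ℝ}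
    (h0 : ∀ x, |x| ≤ R → b (x, 0) ≤ N)
    (hR : ∀ x t, |x| = R → 0 ≤ t → t < T → b (x, t) ≤ N + κ * t)
    {x t : ℝ} (hx : |x| ≤ R) (ht0 : 0 ≤ t) (ht : t < T) : b (x, t) ≤ N + κ * t := by
  refine le_of_forall_pos_lt_add fun ε hε => ?_
  have hst : ∀ y s, 0 < s → s ≤ t → (y, s) ∈ strip T := fun y s h1 h2 =>
    mem_strip.2 ⟨h1, h2.trans_lt ht⟩
  -- The term δ(1 + s) makes all inequalities strict and costs exactly ε at the time t.
  set δ := ε / (1 + t)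
  have hδ : 0 < δ := by positivity
  have key := neg_of_rectangle (F := fun p => b p - N - κ * p.2 - δ * (1 + p.2)) (R := R) (τ := t)
    (Fx := fun y s => px b (y, s)) (Fxx := fun y s => px (px b) (y, s))
    (Ft := fun y s => pt b (y, s) - κ - δ) ?_ ?_ ?_ ?_ ?_ ?_ ?_ hx ht0 le_rfl
  · have : δ * (1 + t) = ε := by simp only [δ]; field_simp
    simp only at key; linarith
  · have : ContinuousOn b (Icc (-R) R ×ˢ Icc 0 t) :=
      hb.mono fun q hq => ⟨mem_univ _, hq.2.1, hq.2.2.trans_lt ht⟩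
    fun_prop
  · intro y hy; simp only; linarith [h0 y hy]
  · intro y s hy h1 h2; simp only
    have := mul_nonneg hδ.le h1
    linarith [hR y s hy h1 (h2.trans_lt ht)]
  · intro y s h1 h2
    exact (((hasDerivAt_px (differentiableAt_of_strip db (by norm_num) (hst y s h1 h2))).sub_const
      N).sub_const (κ * s)).sub_const (δ * (1 + s))
  · intro y s h1 h2
    exact hasDerivAt_px_px db (hst y s h1 h2)
  · intro y s h1 h2
    have e := (((hasDerivAt_pt
      (differentiableAt_of_strip db (by norm_num) (hst y s h1 h2))).sub_const
      N).sub ((hasDerivAt_id s).const_mul κ)).sub (((hasDerivAt_id s).const_add 1).const_mul δ)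
    refine e.congr_deriv (by ring)
  · intro y s _ h1 h2 e1 e2
    have e := pde _ (hst y s h1 h2)
    rw [e1] at e
    have : px (px b) (y, s) / r (y, s) ≤ 0 :=
      div_nonpos_of_nonpos_of_nonneg e2 (hr _ (strip_subset T (hst y s h1 h2))).le
    linarith

/-- Comparison on the whole line under sub-linear growth. The coefficient `1 / r` may be
unbounded, because the comparison function is affine near infinity. -/
theorem le_of_sublinear (hb : ContinuousOn b (strip₀ T)) (db : ContDiffOn ℝ 2 b (strip T))
    (hr : ∀ p ∈ strip₀ T, 0 < r p) (cr : ContinuousOn r (strip₀ T))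
    (hv : ∀ p ∈ strip₀ T, |v p| ≤ C)
    (pde : ∀ p ∈ strip T, pt b p + v p * px b p = κ + px (px b) p / r p)
    (hsub : ∀ ε > 0, ∃ R : ℝ, ∀ t, 0 ≤ t → t < T → ∀ x : ℝ, R ≤ |x| → b (x, t) ≤ ε * |x|) {M : ℝ}
    (h0 : ∀ x, b (x, 0) ≤ M) {x t : ℝ} (ht0 : 0 ≤ t) (ht : t < T) : b (x, t) ≤ M + κ * t := by
  have hst : ∀ y s, 0 < s → s ≤ t → (y, s) ∈ strip T := fun y s h1 h2 =>
    mem_strip.2 ⟨h1, h2.trans_lt ht⟩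
  obtain ⟨B, hB0, hB⟩ := exists_smoothAbs_bounds
  have hsub1 : Icc (-1 : ℝ) 1 ×ˢ Icc 0 t ⊆ strip₀ T := fun q hq =>
    ⟨mem_univ _, hq.2.1, hq.2.2.trans_lt ht⟩
  -- A bound on 1/r is needed only over [-1, 1], where the second derivative of the barrier lives.
  obtain ⟨W, hW⟩ := (isCompact_Icc.prod isCompact_Icc).exists_bound_of_continuousOn
    ((cr.mono hsub1).inv₀ fun q hq => (hr q (hsub1 hq)).ne')
  have hW0 : 0 ≤ W := (norm_nonneg _).trans (hW (0, 0) ⟨by simp, by simp [ht0]⟩)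
  have hC0 : 0 ≤ C := (abs_nonneg _).trans (hv (0, 0) (mem_strip₀.2 ⟨le_rfl, ht0.trans_lt ht⟩))
  -- The growth rate of the barrier: C·B beats the drift, W·B the diffusion, and 1 gives strictness.
  set A := C * B + W * B + 1
  have hA : 0 < A := by positivity
  have key : ∀ ε > 0, b (x, t) < M + κ * t + ε * (smoothAbs x + 2 + A * t) := by
    intro ε hε
    obtain ⟨R₀, hR₀⟩ := hsub (ε / 2) (by positivity)
    -- The interval contains x; at its ends the barrier equals |x|, half of εR dominates b by
    -- sub-linearity, and the other half dominates M and κs.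
    set R := max (max R₀ |x|) (max 1 (2 * (|M| + |κ| * t) / ε))
    have hRx : |x| ≤ R := (le_max_right _ _).trans (le_max_left _ _)
    have hRR : R₀ ≤ R := (le_max_left _ _).trans (le_max_left _ _)
    have hR1 : 1 ≤ R := (le_max_left _ _).trans (le_max_right _ _)
    have hR2 : 2 * (|M| + |κ| * t) / ε ≤ R := (le_max_right _ _).trans (le_max_right _ _)
    rw [div_le_iff₀ hε] at hR2
    have := neg_of_rectangle (F := fun p => b p - M - κ * p.2 - ε * (smoothAbs p.1 + 2 + A * p.2))
      (R := R) (τ := t)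
      (Fx := fun y s => px b (y, s) - ε * deriv smoothAbs y)
      (Fxx := fun y s => px (px b) (y, s) - ε * deriv (deriv smoothAbs) y)
      (Ft := fun y s => pt b (y, s) - κ - ε * A) ?_ ?_ ?_ ?_ ?_ ?_ ?_ hRx ht0 le_rfl
    · simp only at this; linarith
    · have : ContinuousOn b (Icc (-R) R ×ˢ Icc 0 t) :=
        hb.mono fun q hq => ⟨mem_univ _, hq.2.1, hq.2.2.trans_lt ht⟩
      have h2 := contDiff_smoothAbs.continuous
      fun_prop
    · intro y hy; simp only
      have := neg_one_le_smoothAbs y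
      have : 0 < ε * (smoothAbs y + 2 + A * 0) := mul_pos hε (by linarith)
      linarith [h0 y]
    · intro y s hy h1 h2; simp only
      have e1 := hR₀ s h1 (h2.trans_lt ht) y (by rw [hy]; exact hRR)
      rw [smoothAbs_of_one_le_abs (by rw [hy]; exact hR1), hy]
      rw [hy] at e1
      have e2 : 0 ≤ ε * (A * s) := by positivity
      have e3 : -(κ * s) ≤ |κ| * t := by
        have : -(κ * s) ≤ |κ| * s := by
          have := neg_abs_le κ
          nlinarith
        exact this.trans (mul_le_mul_of_nonneg_left h2 (abs_nonneg _))
      have e4 := neg_abs_le M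
      nlinarith
    · intro y s h1 h2
      have e := (((hasDerivAt_px (differentiableAt_of_strip db (by norm_num)
        (hst y s h1 h2))).sub_const M).sub_const (κ * s)).sub
        ((((hasDerivAt_smoothAbs y).add_const 2).add_const (A * s)).const_mul ε)
      exact e
    · intro y s h1 h2
      exact (hasDerivAt_px_px db (hst y s h1 h2)).sub ((hasDerivAt_deriv_smoothAbs y).const_mul ε)
    · intro y s h1 h2
      have e := (((hasDerivAt_pt (differentiableAt_of_strip db (by norm_num)
        (hst y s h1 h2))).sub_const M).sub ((hasDerivAt_id s).const_mul κ)).sub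
        ((((hasDerivAt_id s).const_mul A).const_add (smoothAbs y + 2)).const_mul ε)
      exact e.congr_deriv (by ring)
    · intro y s _ h1 h2 e1 e2
      have hs := hst y s h1 h2
      have e := pde _ hs
      have hr' := hr _ (strip_subset T hs)
      have e3 : px b (y, s) = ε * deriv smoothAbs y := by linarith
      have e4 : px (px b) (y, s) / r (y, s) ≤ ε * (W * B) := by
        have h5 : px (px b) (y, s) / r (y, s) ≤ ε * deriv (deriv smoothAbs) y / r (y, s) := by
          gcongr; linarith
        refine h5.trans ?_
        rw [mul_div_assoc]
        refine mul_le_mul_of_nonneg_left ?_ hε.le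
        rcases le_or_gt |y| 1 with hy | hy
        · have h6 := hW (y, s) ⟨abs_le.1 hy, h1.le, h2⟩
          simp only [Real.norm_eq_abs] at h6
          have h7 : (r (y, s))⁻¹ ≤ W := (abs_le.1 h6).2
          have h9 : (0 : ℝ) ≤ (r (y, s))⁻¹ := (inv_pos.2 hr').le
          rw [div_eq_mul_inv, mul_comm]
          exact (mul_le_mul_of_nonneg_left (le_abs_self _) h9).trans
            (mul_le_mul h7 (hB y).2 (abs_nonneg _) hW0)
        · rw [(deriv_smoothAbs_of_one_lt_abs hy).2]; simp; positivity
      have e5 : -(v (y, s) * px b (y, s)) ≤ ε * (C * B) := by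
        rw [e3]
        have h6 : |v (y, s) * deriv smoothAbs y| ≤ C * B := by
          rw [abs_mul]; exact mul_le_mul (hv _ (strip_subset T hs)) (hB y).1 (abs_nonneg _) hC0
        have h7 := (abs_le.1 h6).1
        nlinarith
      simp only [A]; nlinarith
  refine le_of_forall_pos_lt_add fun ε hε => ?_
  have hs2 : 0 < smoothAbs x + 2 + A * t := by
    have := neg_one_le_smoothAbs x; have : 0 ≤ A * t := by positivity
    linarith
  have := key (ε / (smoothAbs x + 2 + A * t)) (by positivity)
  rwa [div_mul_cancel₀ _ hs2.ne'] at this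

end Comparison

end ViscousEP

namespace ViscousEP

open scoped Topology ContDiff

/-! ### Particle paths -/

namespace Flow

variable {k T C : ℝ} {r v b m : ℝ × ℝ → ℝ}

theorem C_nonneg (h : Flow k T C r v b m) {p : ℝ × ℝ} (hp : p ∈ strip₀ T) : 0 ≤ C :=
  (abs_nonneg _).trans (h.v_le p hp)

theorem strictMono_m (h : Flow k T C r v b m) {t : ℝ} (h0 : 0 ≤ t) (hT : t < T) :
    StrictMono fun x => m (x, t) :=
  strictMono_of_hasDerivAt_pos (fun x => h.m_deriv x t (mem_strip₀.2 ⟨h0, hT⟩))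
    (fun _ => h.r_pos _ (mem_strip₀.2 ⟨h0, hT⟩))

theorem differentiableAt_m (h : Flow k T C r v b m) {p : ℝ × ℝ} (hp : p ∈ strip T) :
    DifferentiableAt ℝ m p := (h.m_fderiv p hp).differentiableAt

theorem px_m (h : Flow k T C r v b m) {p : ℝ × ℝ} (hp : p ∈ strip T) : px m p = r p := by
  simp [px, (h.m_fderiv p hp).fderiv]

theorem pt_m (h : Flow k T C r v b m) {p : ℝ × ℝ} (hp : p ∈ strip T) :
    pt m p = -(r p * v p) := by
  simp [pt, (h.m_fderiv p hp).fderiv]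

/-- The mass coordinate is monotone along lines with the extremal speeds. -/
theorem cone (h : Flow k T C r v b m) {x s t : ℝ} (hs : 0 ≤ s) (hst : s ≤ t) (hT : t < T) :
    m (x, s) ≤ m (x + C * (t - s), t) ∧ m (x - C * (t - s), t) ≤ m (x, s) := by
  have hmem : ∀ τ ∈ Icc s t, ∀ y, (y, τ) ∈ strip₀ T := fun τ hτ y =>
    mem_strip₀.2 ⟨hs.trans hτ.1, hτ.2.trans_lt hT⟩
  have hmem' : ∀ τ ∈ Ioo s t, ∀ y, (y, τ) ∈ strip T := fun τ hτ y =>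
    mem_strip.2 ⟨hs.trans_lt hτ.1, hτ.2.trans hT⟩
  have cont : ∀ c : ℝ, ContinuousOn (fun τ => m (x + c * (τ - s), τ)) (Icc s t) := fun c =>
    h.cont_m.comp (by fun_prop) (fun τ hτ => hmem τ hτ _)
  have der : ∀ c : ℝ, ∀ τ ∈ Ioo s t, HasDerivAt (fun τ => m (x + c * (τ - s), τ))
      (r (x + c * (τ - s), τ) * (c - v (x + c * (τ - s), τ))) τ := by
    intro c τ hτ
    have hl : HasDerivAt (fun τ => x + c * (τ - s)) c τ := by
      refine ((((hasDerivAt_id τ).sub_const s).const_mul c).const_add x).congr_deriv (by ring)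
    refine (hasDerivAt_comp_curve (h.differentiableAt_m (hmem' τ hτ _)) hl).congr_deriv ?_
    rw [h.px_m (hmem' τ hτ _), h.pt_m (hmem' τ hτ _)]; ring
  constructor
  · have := monotoneOn_of_deriv_nonneg (convex_Icc s t) (cont C) (fun τ hτ => by
      rw [interior_Icc] at hτ
      exact (der C τ hτ).differentiableAt.differentiableWithinAt) (fun τ hτ => by
      rw [interior_Icc] at hτ
      rw [(der C τ hτ).deriv]
      have h1 := h.r_pos _ (strip_subset T (hmem' τ hτ (x + C * (τ - s))))
      have h2 := (abs_le.1 (h.v_le _ (strip_subset T (hmem' τ hτ (x + C * (τ - s)))))).2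
      exact mul_nonneg h1.le (by linarith))
    simpa using this (left_mem_Icc.2 hst) (right_mem_Icc.2 hst) hst
  · have := antitoneOn_of_deriv_nonpos (convex_Icc s t) (cont (-C)) (fun τ hτ => by
      rw [interior_Icc] at hτ
      exact (der (-C) τ hτ).differentiableAt.differentiableWithinAt) (fun τ hτ => by
      rw [interior_Icc] at hτ
      rw [(der (-C) τ hτ).deriv]
      have h1 := h.r_pos _ (strip_subset T (hmem' τ hτ (x + -C * (τ - s))))
      have h2 := (abs_le.1 (h.v_le _ (strip_subset T (hmem' τ hτ (x + -C * (τ - s)))))).1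
      exact mul_nonpos_of_nonneg_of_nonpos h1.le (by linarith))
    simpa [sub_eq_add_neg] using this (left_mem_Icc.2 hst) (right_mem_Icc.2 hst) hst

theorem cone_abs (h : Flow k T C r v b m) {x s t : ℝ} (hs : 0 ≤ s) (hsT : s < T) (ht : 0 ≤ t)
    (hT : t < T) :
    m (x, s) ≤ m (x + C * |t - s|, t) ∧ m (x - C * |t - s|, t) ≤ m (x, s) := by
  rcases le_total s t with hst | hst
  · rw [abs_of_nonneg (by linarith)]; exact h.cone hs hst hT
  · rw [abs_of_nonpos (by linarith), neg_sub]
    refine ⟨?_, ?_⟩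
    · simpa using (h.cone (x := x + C * (s - t)) ht hst hsT).2
    · simpa using (h.cone (x := x - C * (s - t)) ht hst hsT).1

/-- Finite speed of propagation: `cone_abs` brackets the level between x ± C|t - s|, and the
intermediate value theorem finds it. The distance bound makes level curves Lipschitz and defined on
all of [0, T). -/
theorem exists_level (h : Flow k T C r v b m) {x s t : ℝ} (hs : 0 ≤ s) (hsT : s < T) (ht : 0 ≤ t)
    (hT : t < T) : ∃ y, m (y, t) = m (x, s) ∧ |y - x| ≤ C * |t - s| := by
  have hC := h.C_nonneg (mem_strip₀.2 ⟨hs, hsT⟩ : (x, s) ∈ strip₀ T)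
  have hd : 0 ≤ C * |t - s| := by positivity
  obtain ⟨h1, h2⟩ := h.cone_abs (x := x) hs hsT ht hT
  obtain ⟨y, hy, e⟩ := intermediate_value_Icc (show x - C * |t - s| ≤ x + C * |t - s| by linarith)
    (continuous_slice h.cont_m ht hT).continuousOn ⟨h2, h1⟩
  exact ⟨y, e, abs_le.2 ⟨by linarith [hy.1], by linarith [hy.2]⟩⟩

/-- Level curves of the mass coordinate are particle paths. -/
theorem exists_path (h : Flow k T C r v b m) {x₀ t₀ : ℝ} (h0 : 0 ≤ t₀) (hT : t₀ < T) :
    ∃ X : ℝ → ℝ, X t₀ = x₀ ∧ ContinuousOn X (Ico 0 T) ∧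
      (∀ t ∈ Ioo 0 T, HasDerivAt X (v (X t, t)) t) ∧
      (∀ t ∈ Ico 0 T, m (X t, t) = m (x₀, t₀)) ∧
      ∀ s ∈ Ico 0 T, ∀ t ∈ Ico 0 T, |X t - X s| ≤ C * |t - s| := by
  have hC := h.C_nonneg (mem_strip₀.2 ⟨h0, hT⟩ : (x₀, t₀) ∈ strip₀ T)
  have hex : ∀ t, ∃ y, t ∈ Ico 0 T → m (y, t) = m (x₀, t₀) := by
    intro t
    by_cases ht : t ∈ Ico 0 T
    · obtain ⟨y, hy, _⟩ := h.exists_level (x := x₀) h0 hT ht.1 ht.2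
      exact ⟨y, fun _ => hy⟩
    · exact ⟨0, fun h => absurd h ht⟩
  choose X hX using hex
  have hlip : ∀ s ∈ Ico 0 T, ∀ t ∈ Ico 0 T, |X t - X s| ≤ C * |t - s| := by
    intro s hs t ht
    obtain ⟨y, hy, hyd⟩ := h.exists_level (x := X s) hs.1 hs.2 ht.1 ht.2
    have : y = X t := (h.strictMono_m ht.1 ht.2).injective
      (show m (y, t) = m (X t, t) by rw [hy, hX s hs, hX t ht])
    rwa [← this]
  have hcont : ContinuousOn X (Ico 0 T) := by
    have : LipschitzOnWith ⟨C, hC⟩ X (Ico 0 T) :=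
      LipschitzOnWith.of_dist_le_mul fun t ht s hs => by
        rw [Real.dist_eq, Real.dist_eq]; exact hlip s hs t ht
    exact this.continuousOn
  refine ⟨X, ?_, hcont, fun t ht => ?_, hX, hlip⟩
  · exact (h.strictMono_m h0 hT).injective (hX t₀ ⟨h0, hT⟩)
  · have htI := Ioo_subset_Ico_self ht
    have hp : (X t, t) ∈ strip T := mem_strip.2 ht
    have hr := h.r_pos _ (strip_subset T hp)
    have hev : ∀ᶠ s in 𝓝 t, s ∈ Ico 0 T := Ico_mem_nhds ht.1 ht.2
    have hcX : ContinuousAt (fun s => (X s, s)) t :=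
      (hcont.continuousAt (Ico_mem_nhds ht.1 ht.2)).prodMk continuousAt_id
    have ho := (h.m_fderiv _ hp).isLittleO.comp_tendsto hcX
    -- The Lipschitz bound turns the error of the expansion of m into o(s - t).
    have hO : (fun s => ((X s, s) : ℝ × ℝ) - (X t, t)) =O[𝓝 t] fun s => s - t := by
      refine IsBigO.of_bound (max C 1) ?_
      filter_upwards [hev] with s hs
      rw [Prod.mk_sub_mk, Prod.norm_def]
      simp only [Real.norm_eq_abs]
      refine max_le ((hlip t htI s hs).trans ?_) ?_
      · exact mul_le_mul_of_nonneg_right (le_max_left _ _) (abs_nonneg _)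
      · exact le_mul_of_one_le_left (abs_nonneg _) (le_max_right _ _)
    -- As m is constant along X, its expansion reads r(ΔX - vΔs) = o(Δs); division by r > 0
    -- identifies the derivative of X.
    have h1 := (ho.trans_isBigO hO).const_mul_left (-(r (X t, t))⁻¹)
    rw [hasDerivAt_iff_isLittleO]
    refine h1.congr' ?_ EventuallyEq.rfl
    filter_upwards [hev] with s hs
    have e : m (X s, s) - m (X t, t) = 0 := by rw [hX s hs, hX t htI, sub_self]
    simp only [Function.comp, e]
    simp
    field_simp
    ring

/-- The specific volume along a path. -/
theorem hasDerivAt_inv (h : Flow k T C r v b m) {X : ℝ → ℝ} {t : ℝ} (ht : t ∈ Ioo 0 T)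
    (hX : HasDerivAt X (v (X t, t)) t) :
    HasDerivAt (fun s => (r (X s, s))⁻¹) (b (X t, t)) t := by
  have hp : (X t, t) ∈ strip T := mem_strip.2 ht
  have hr := h.r_pos _ (strip_subset T hp)
  have h1 := hasDerivAt_comp_curve (differentiableAt_of_strip h.diff_r (by norm_num) hp) hX
  refine (h1.fun_inv hr.ne').congr_deriv ?_
  have e := h.mass _ hp
  rw [h.px_v _ hp] at e
  have : pt r (X t, t) + v (X t, t) * px r (X t, t) =
      -(r (X t, t) * (b (X t, t) * r (X t, t))) := by
    linarith
  rw [this]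
  field_simp

theorem continuousOn_inv_path (h : Flow k T C r v b m) {X : ℝ → ℝ} (hX : ContinuousOn X (Ico 0 T)) :
    ContinuousOn (fun s => (r (X s, s))⁻¹) (Ico 0 T) := by
  have hmap : MapsTo (fun s => (X s, s)) (Ico 0 T) (strip₀ T) := fun s hs => mem_strip₀.2 hs
  exact (h.cont_r.comp (hX.prodMk continuousOn_id) hmap).inv₀ fun s hs => (h.r_pos _ (hmap hs)).ne'

/-- The derivative of 1/r along the path is b, so an affine bound on b integrates to a quadratic
one. At the initial time only continuity is used. -/
theorem inv_ge_along_path (h : Flow k T C r v b m) {X : ℝ → ℝ} (hX : ContinuousOn X (Ico 0 T))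
    (hX' : ∀ t ∈ Ioo 0 T, HasDerivAt X (v (X t, t)) t) {M κ : ℝ}
    (hb : ∀ t ∈ Ioo 0 T, M + κ * t ≤ b (X t, t)) {t : ℝ} (ht : t ∈ Ico 0 T) :
    (r (X 0, 0))⁻¹ + M * t + κ * t ^ 2 / 2 ≤ (r (X t, t))⁻¹ := by
  have hder : ∀ s ∈ Ioo 0 T, HasDerivAt
      (fun s => (r (X s, s))⁻¹ - (M * s + κ * s ^ 2 / 2)) (b (X s, s) - (M + κ * s)) s := by
    intro s hs
    have e : HasDerivAt (fun s : ℝ => M * s + κ * s ^ 2 / 2) (M + κ * s) s :=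
      (((hasDerivAt_id s).const_mul M).add
        ((((hasDerivAt_id s).pow 2).const_mul κ).div_const 2)).congr_deriv (by simp; ring)
    exact (h.hasDerivAt_inv hs (hX' s hs)).sub e
  have hcont : ContinuousOn (fun s => (r (X s, s))⁻¹ - (M * s + κ * s ^ 2 / 2)) (Ico 0 T) :=
    (h.continuousOn_inv_path hX).sub (by fun_prop)
  have hmono := monotoneOn_of_deriv_nonneg (convex_Ico 0 T) hcont
    (fun s hs => by
      rw [interior_Ico] at hs
      exact (hder s hs).differentiableAt.differentiableWithinAt)
    (fun s hs => by
      rw [interior_Ico] at hs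
      rw [(hder s hs).deriv]
      linarith [hb s hs])
  have := hmono ⟨le_rfl, ht.1.trans_lt ht.2⟩ ht ht.1
  norm_num at this
  linarith

theorem inv_le_along_path (h : Flow k T C r v b m) {X : ℝ → ℝ} (hX : ContinuousOn X (Ico 0 T))
    (hX' : ∀ t ∈ Ioo 0 T, HasDerivAt X (v (X t, t)) t) {M κ : ℝ}
    (hb : ∀ t ∈ Ioo 0 T, b (X t, t) ≤ M + κ * t) {t : ℝ} (ht : t ∈ Ico 0 T) :
    (r (X t, t))⁻¹ ≤ (r (X 0, 0))⁻¹ + M * t + κ * t ^ 2 / 2 := by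
  have hder : ∀ s ∈ Ioo 0 T, HasDerivAt
      (fun s => (r (X s, s))⁻¹ - (M * s + κ * s ^ 2 / 2)) (b (X s, s) - (M + κ * s)) s := by
    intro s hs
    have e : HasDerivAt (fun s : ℝ => M * s + κ * s ^ 2 / 2) (M + κ * s) s :=
      (((hasDerivAt_id s).const_mul M).add
        ((((hasDerivAt_id s).pow 2).const_mul κ).div_const 2)).congr_deriv (by simp; ring)
    exact (h.hasDerivAt_inv hs (hX' s hs)).sub e
  have hcont : ContinuousOn (fun s => (r (X s, s))⁻¹ - (M * s + κ * s ^ 2 / 2)) (Ico 0 T) :=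
    (h.continuousOn_inv_path hX).sub (by fun_prop)
  have hanti := antitoneOn_of_deriv_nonpos (convex_Ico 0 T) hcont
    (fun s hs => by
      rw [interior_Ico] at hs
      exact (hder s hs).differentiableAt.differentiableWithinAt)
    (fun s hs => by
      rw [interior_Ico] at hs
      rw [(hder s hs).deriv]
      linarith [hb s hs])
  have := hanti ⟨le_rfl, ht.1.trans_lt ht.2⟩ ht ht.1
  norm_num at this
  linarith

/-- Sub-linear growth of `b` at fixed final time. -/
def Sublinear (T : ℝ) (b : ℝ × ℝ → ℝ) : Prop :=
  ∀ ε > 0, ∃ R : ℝ, ∀ t, 0 ≤ t → t < T → ∀ x : ℝ, R ≤ |x| → |b (x, t)| ≤ ε * |x|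

theorem b_le (h : Flow k T C r v b m) (hs : Sublinear T b) {M : ℝ} (h0 : ∀ x, b (x, 0) ≤ M)
    {x t : ℝ} (ht0 : 0 ≤ t) (ht : t < T) : b (x, t) ≤ M + k * t := by
  refine le_of_sublinear h.cont_b h.diff_b h.r_pos h.cont_r h.v_le h.b_pde (fun ε hε => ?_)
    h0 ht0 ht
  obtain ⟨R, hR⟩ := hs ε hε
  exact ⟨R, fun t h1 h2 x hx => (le_abs_self _).trans (hR t h1 h2 x hx)⟩

/-- The equation is linear in b, so the upper comparison applies to -b with source -k. -/
theorem le_b (h : Flow k T C r v b m) (hs : Sublinear T b) {M : ℝ} (h0 : ∀ x, M ≤ b (x, 0))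
    {x t : ℝ} (ht0 : 0 ≤ t) (ht : t < T) : M + k * t ≤ b (x, t) := by
  have ex : px (fun p => -b p) = fun p => -px b p := by
    funext p; simp [px, fderiv_fun_neg]
  have et : pt (fun p => -b p) = fun p => -pt b p := by
    funext p; simp [pt, fderiv_fun_neg]
  have exx : px (fun p => -px b p) = fun p => -px (px b) p := by
    funext p; rw [px, fderiv_fun_neg]; rfl
  have := le_of_sublinear (b := fun p => -b p) (κ := -k) (M := -M) (x := x) h.cont_b.neg
    h.diff_b.neg h.r_pos h.cont_r h.v_le (fun p hp => ?_) (fun ε hε => ?_)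
    (fun x => neg_le_neg (h0 x)) ht0 ht
  · linarith
  · rw [ex, et, exx]
    have := h.b_pde p hp
    linear_combination -this
  · obtain ⟨R, hR⟩ := hs ε hε
    exact ⟨R, fun t h1 h2 x hx => (neg_le_abs _).trans (hR t h1 h2 x hx)⟩

/-- Local bounds on `b`, uniform up to the final time. -/
theorem exists_b_le (h : Flow k T C r v b m) (hk : 0 < k) (hs : Sublinear T b) (hT : 0 < T)
    (R : ℝ) :
    ∃ N, 0 ≤ N ∧ ∀ x t, |x| ≤ R → 0 ≤ t → t < T → b (x, t) ≤ N := by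
  obtain ⟨R₁, hR₁⟩ := hs 1 one_pos
  -- At |x| = R' ≥ R₁ sub-linearity with ε = 1 gives b ≤ R' for all times. Thus no global upper
  -- bound on the initial ratio is needed.
  set R' := max R (max R₁ 0)
  obtain ⟨N₀, hN₀⟩ := (isCompact_Icc (a := -R') (b := R')).exists_bound_of_continuousOn
    (continuous_slice h.cont_b le_rfl hT).continuousOn
  refine ⟨max N₀ R' + k * T, ?_, fun x t hx h0 ht => ?_⟩
  · have : 0 ≤ R' := (le_max_right _ _).trans (le_max_right _ _)
    have : 0 ≤ max N₀ R' := this.trans (le_max_right _ _)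
    positivity
  · have := le_of_local_bounds (N := max N₀ R') (R := R') h.cont_b h.diff_b h.r_pos h.b_pde
      (fun y hy => (le_abs_self _).trans ((hN₀ y (abs_le.1 hy)).trans (le_max_left _ _)))
      (fun y s hy h1 h2 => ?_) (hx.trans (le_max_left _ _)) h0 ht
    · have e : k * t ≤ k * T := by gcongr
      linarith
    · have e := hR₁ s h1 h2 y (by rw [hy]; exact (le_max_left _ _).trans (le_max_right _ _))
      rw [hy, one_mul] at e
      have : 0 ≤ k * s := by positivity
      linarith [le_abs_self (b (y, s)), le_max_right N₀ R']

/-- A lower bound on the initial ratio prevents both concentration and vacuum. -/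
theorem exists_local_bounds (h : Flow k T C r v b m) (hk : 0 < k) (hs : Sublinear T b) (hT : 0 < T)
    {M : ℝ} (h0 : ∀ x, M ≤ b (x, 0)) (hM : ∀ x, (min M 0) ^ 2 / (2 * k) < (r (x, 0))⁻¹) (R : ℝ) :
    ∃ A, 0 < A ∧ ∀ x t, |x| ≤ R → 0 ≤ t → t < T →
      A⁻¹ ≤ r (x, t) ∧ r (x, t) ≤ A ∧ |b (x, t)| ≤ A := by
  have hC := h.C_nonneg (mem_strip₀.2 ⟨le_rfl, hT⟩ : ((0 : ℝ), (0 : ℝ)) ∈ strip₀ T)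
  rcases lt_or_ge R 0 with hR | hR
  · exact ⟨1, one_pos, fun x t hx => absurd (hx.trans_lt hR) (not_lt.2 (abs_nonneg x))⟩
  -- Paths that meet [-R, R] before T stay in [-R', R'].
  set R' := R + C * T
  have hR' : 0 ≤ R' := by positivity
  obtain ⟨N, hN0, hN⟩ := h.exists_b_le hk hs hT R'
  have hinv : Continuous fun x => (r (x, 0))⁻¹ := (continuous_slice h.cont_r le_rfl hT).inv₀
    fun x => (h.r_pos _ (mem_strip₀.2 ⟨le_rfl, hT⟩)).ne'
  obtain ⟨W, hW⟩ := (isCompact_Icc (a := -R') (b := R')).exists_bound_of_continuousOn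
    hinv.continuousOn
  obtain ⟨y₀, _, hy₀⟩ := (isCompact_Icc (a := -R') (b := R')).exists_isMinOn
    ⟨0, by simp [hR']⟩ hinv.continuousOn
  -- The minimum of the lower parabola for the worst starting point in [-R', R']; it is positive by
  -- the threshold condition at y₀.
  set c := (r (y₀, 0))⁻¹ - (min M 0) ^ 2 / (2 * k)
  have hc : 0 < c := by simp only [c]; linarith [hM y₀]
  have hW0 : 0 ≤ W := (norm_nonneg _).trans (hW 0 ⟨by linarith, hR'⟩)
  have hup : 0 < W + N * T + 1 := by positivity
  refine ⟨max c⁻¹ (max (W + N * T + 1) (max N |M|)), lt_max_of_lt_left (inv_pos.2 hc),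
    fun x t hx h0t ht => ?_⟩
  have htI : t ∈ Ico 0 T := ⟨h0t, ht⟩
  have h0I : (0 : ℝ) ∈ Ico 0 T := ⟨le_rfl, hT⟩
  obtain ⟨X, hXt, hXc, hX', -, hlip⟩ := h.exists_path (x₀ := x) h0t ht
  have hXb : ∀ s ∈ Ico 0 T, |X s| ≤ R' := by
    intro s hs
    have e1 := hlip t htI s hs
    rw [hXt] at e1
    have e2 : |s - t| ≤ T := abs_le.2 ⟨by linarith [hs.1], by linarith [hs.2]⟩
    have e3 : C * |s - t| ≤ C * T := by gcongr
    have e4 : |X s| ≤ |X s - x| + |x| := by simpa using abs_add_le (X s - x) x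
    simp only [R']; linarith
  have hlow := h.inv_ge_along_path hXc hX' (M := M) (κ := k)
    (fun s hs' => h.le_b hs h0 hs'.1.le hs'.2) htI
  have hhigh := h.inv_le_along_path hXc hX' (M := N) (κ := 0)
    (fun s hs' => by simpa using hN _ s (hXb s (Ioo_subset_Ico_self hs')) hs'.1.le hs'.2) htI
  rw [hXt] at hlow hhigh
  have hX0 := hXb 0 h0I
  have hr := h.r_pos (x, t) (mem_strip₀.2 htI)
  have e1 : c ≤ (r (x, t))⁻¹ := by
    have h1 : (r (y₀, 0))⁻¹ ≤ (r (X 0, 0))⁻¹ := hy₀ (abs_le.1 hX0)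
    -- Completing the square. Only a negative M can lower the parabola, hence min M 0.
    have h2 : -((min M 0) ^ 2 / (2 * k)) ≤ M * t + k * t ^ 2 / 2 := by
      have h3 : min M 0 * t ≤ M * t := by gcongr; exact min_le_left _ _
      have h4 : 0 ≤ (min M 0 + k * t) ^ 2 / (2 * k) := by positivity
      have h5 : (min M 0 + k * t) ^ 2 / (2 * k) =
        (min M 0) ^ 2 / (2 * k) + min M 0 * t + k * t ^ 2 / 2 := by field_simp; ring
      linarith
    simp only [c]; linarith
  have e2 : (r (x, t))⁻¹ ≤ W + N * T + 1 := by
    have h1 := (le_abs_self _).trans (hW (X 0) (abs_le.1 hX0))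
    have h2 : N * t ≤ N * T := by gcongr
    linarith
  refine ⟨?_, ?_, abs_le.2 ⟨?_, ?_⟩⟩
  · rw [inv_le_comm₀ (lt_max_of_lt_left (inv_pos.2 hc)) hr]
    exact e2.trans ((le_max_left _ _).trans (le_max_right _ _))
  · exact (le_inv_of_le_inv₀ hc (by simpa using e1)).trans (le_max_left _ _)
  · have h1 := h.le_b (x := x) hs h0 h0t ht
    have h2 : |M| ≤ max c⁻¹ (max (W + N * T + 1) (max N |M|)) :=
      (le_max_right _ _).trans ((le_max_right _ _).trans (le_max_right _ _))
    have h3 : 0 ≤ k * t := by positivity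
    linarith [neg_abs_le M]
  · have hxR : |x| ≤ R' := hx.trans (by simp only [R']; linarith [mul_nonneg hC hT.le])
    exact (hN x t hxR h0t ht).trans
      ((le_max_left _ _).trans ((le_max_right _ _).trans (le_max_right _ _)))

end Flow

end ViscousEP

namespace ViscousEP

open scoped Topology ContDiff

/-! ### Breakdown, local bounds, and behaviour along particle paths -/

section

variable {n : ℕ∞} {k T : ℝ} {ρ₀ u₀ : ℝ → ℝ} {ρ u E : ℝ → ℝ → ℝ}

theorem IsNiceSolution.sublinear_ratio (h : IsNiceSolution n k ρ₀ u₀ (Ico 0 T) ρ u E) :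
    Flow.Sublinear T (unc (ratio ρ u)) := by
  obtain ⟨γ, hγ, hR⟩ := h.sublinear
  intro ε hε
  obtain ⟨R, hR⟩ := hR (ε / Real.exp (γ * T)) (by positivity)
  refine ⟨R, fun t h0 hT x hx => (hR t ⟨h0, hT⟩ x hx).trans ?_⟩
  have : Real.exp (γ * t) ≤ Real.exp (γ * T) := by gcongr
  refine mul_le_mul_of_nonneg_right ?_ (abs_nonneg x)
  rw [div_mul_eq_mul_div, div_le_iff₀ (Real.exp_pos _)]
  gcongr

theorem IsNiceSolution.initial_ratio {I : Set ℝ} (h : IsNiceSolution n k ρ₀ u₀ I ρ u E) (x : ℝ) :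
    unc (ratio ρ u) (x, 0) = deriv u₀ x / ρ₀ x := by
  have : (fun y => u y 0) = u₀ := funext h.initial_velocity
  simp only [unc, ratio, dx, this, h.initial_density]

theorem exists_of_supRatio_lt {c : EReal} (h : supRatio ρ₀ u₀ < c) :
    ∃ M : ℝ, (M : EReal) < c ∧ ∀ x, deriv u₀ x / ρ₀ x ≤ M := by
  obtain ⟨M, h1, h2⟩ := EReal.lt_iff_exists_real_btwn.1 h
  exact ⟨M, h2, fun x => EReal.coe_le_coe_iff.1
    ((le_iSup (fun x => ((deriv u₀ x / ρ₀ x : ℝ) : EReal)) x).trans h1.le)⟩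

/-- The infimum itself serves as M: it is finite, lying below the ratio at 0 and above the threshold
at 0. Taking it exactly keeps the strict inequality for every α at once. -/
theorem exists_of_lt_infRatio (h : ∀ α, (threshold k ρ₀ α : EReal) < infRatio ρ₀ u₀) :
    ∃ M : ℝ, (∀ α, threshold k ρ₀ α < M) ∧ ∀ x, M ≤ deriv u₀ x / ρ₀ x := by
  have hle : ∀ x, infRatio ρ₀ u₀ ≤ ((deriv u₀ x / ρ₀ x : ℝ) : EReal) := fun x => iInf_le _ x
  have htop : infRatio ρ₀ u₀ ≠ ⊤ := fun e => by simpa [e] using hle 0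
  have hbot : infRatio ρ₀ u₀ ≠ ⊥ := fun e => by simpa [e] using h 0
  have hM := EReal.coe_toReal htop hbot
  refine ⟨(infRatio ρ₀ u₀).toReal, fun α => ?_, fun x => ?_⟩
  · rw [← EReal.coe_lt_coe_iff, hM]; exact h α
  · rw [← EReal.coe_le_coe_iff, hM]; exact hle x

/-- At its vertex t = -M/k the upper parabola for the path from α equals 1/ρ₀(α) - M²/(2k), which is
negative below the threshold. A solution alive at that time would have 1/ρ < 0. -/
theorem lifespan_le (hk : 0 < k) {α M : ℝ} (hM : M < threshold k ρ₀ α)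
    (hle : ∀ x, deriv u₀ x / ρ₀ x ≤ M) (hn : 2 ≤ n)
    (h : IsNiceSolution n k ρ₀ u₀ (Ico 0 T) ρ u E) : T ≤ -M / k := by
  by_contra! hT
  have hsq : √(2 * k / ρ₀ α) < -M := by simp only [threshold] at hM; linarith
  have hM0 : 0 < -M := (Real.sqrt_nonneg _).trans_lt hsq
  have ht0 : 0 < -M / k := div_pos hM0 hk
  obtain ⟨C, -, hf⟩ := h.exists_flow hn
  obtain ⟨X, hX0, hXc, hX', -⟩ := hf.exists_path (x₀ := α) le_rfl (ht0.trans hT)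
  have htI : -M / k ∈ Ico 0 T := ⟨ht0.le, hT⟩
  have h1 := hf.inv_le_along_path hXc hX' (M := M) (κ := k) (fun s hs => hf.b_le h.sublinear_ratio
    (fun x => by rw [h.initial_ratio]; exact hle x) hs.1.le hs.2) htI
  have h2 := inv_pos.2 (hf.r_pos (X (-M / k), -M / k) (mem_strip₀.2 htI))
  rw [hX0] at h1
  have h3 : unc ρ (α, 0) = ρ₀ α := h.initial_density α
  rw [h3] at h1
  have h4 : 2 * k / ρ₀ α < (-M) ^ 2 := (Real.sqrt_lt' hM0).1 hsq
  have h5 : M * (-M / k) + k * (-M / k) ^ 2 / 2 = -((-M) ^ 2 / (2 * k)) := by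
    field_simp; ring
  have h6 : (ρ₀ α)⁻¹ < (-M) ^ 2 / (2 * k) := by
    rw [lt_div_iff₀ (by positivity)]
    calc _ = 2 * k / ρ₀ α := by ring
      _ < _ := h4
  linarith

theorem sq_min_lt_of_threshold_lt (hk : 0 < k) (hρ₀ : ∀ x, 0 < ρ₀ x) {M : ℝ}
    (hM : ∀ α, threshold k ρ₀ α < M) (x : ℝ) : (min M 0) ^ 2 / (2 * k) < (ρ₀ x)⁻¹ := by
  have h1 : -(min M 0) < √(2 * k / ρ₀ x) := by
    rcases le_total M 0 with h | h
    · rw [min_eq_left h]; have := hM x; simp only [threshold] at this; linarith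
    · rw [min_eq_right h, neg_zero]; have := hρ₀ x; positivity
  have h2 : 0 ≤ -(min M 0) := by simp
  rw [Real.lt_sqrt h2, neg_sq] at h1
  rw [div_lt_iff₀ (by positivity)]
  calc _ < _ := h1
    _ = _ := by ring

theorem IsNiceSolution.exists_local_bounds (hk : 0 < k) (hρ₀ : ∀ x, 0 < ρ₀ x) {M : ℝ}
    (hM : ∀ α, threshold k ρ₀ α < M) (hle : ∀ x, M ≤ deriv u₀ x / ρ₀ x) (hn : 2 ≤ n) (hT : 0 < T)
    (h : IsNiceSolution n k ρ₀ u₀ (Ico 0 T) ρ u E) (R : ℝ) :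
    ∃ A, 0 < A ∧ ∀ x t, |x| ≤ R → 0 ≤ t → t < T →
      A⁻¹ ≤ unc ρ (x, t) ∧ unc ρ (x, t) ≤ A ∧ |unc (ratio ρ u) (x, t)| ≤ A := by
  obtain ⟨C, -, hf⟩ := h.exists_flow hn
  refine hf.exists_local_bounds hk h.sublinear_ratio hT (M := M)
    (fun x => by rw [h.initial_ratio]; exact hle x) (fun x => ?_) R
  rw [show unc ρ (x, 0) = ρ₀ x from h.initial_density x]
  exact sq_min_lt_of_threshold_lt hk hρ₀ hM x

/-- Errors O(1 + t) and O(1) are negligible against kt²/2 and kt, and asymptotic equivalence passes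
to inverses and products. -/
theorem asymptotics_of_bounds (hk : 0 < k) {a c : ℝ → ℝ} {A : ℝ}
    (ha : ∀ᶠ t in atTop, |(a t)⁻¹ - k * t ^ 2 / 2| ≤ A * (1 + t))
    (hc : ∀ᶠ t in atTop, |c t - k * t| ≤ A) :
    a ~[atTop] (fun t => 2 / (k * t ^ 2)) ∧ (fun t => c t * a t) ~[atTop] fun t => 2 / t := by
  have h1 : (fun t : ℝ => 1 + t) =o[atTop] fun t : ℝ => k * t ^ 2 / 2 := by
    have e1 : (fun t : ℝ => 1 + t) =O[atTop] fun t : ℝ => t := by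
      refine ((isLittleO_const_id_atTop (1 : ℝ)).isBigO).add (isBigO_refl _ _)
    have e2 : (fun t : ℝ => t) =o[atTop] fun t : ℝ => t ^ 2 := by
      simpa using isLittleO_pow_pow_atTop_of_lt (𝕜 := ℝ) (show 1 < 2 by norm_num)
    have e3 : (fun t : ℝ => t ^ 2) =O[atTop] fun t : ℝ => k * t ^ 2 / 2 := by
      have : (fun t : ℝ => k * t ^ 2 / 2) = fun t => k / 2 * t ^ 2 := by funext t; ring
      rw [this]
      exact isBigO_self_const_mul (by positivity) _ _
    exact (e1.trans_isLittleO e2).trans_isBigO e3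
  have h2 : (fun t => (a t)⁻¹) ~[atTop] fun t => k * t ^ 2 / 2 := by
    refine IsBigO.trans_isLittleO (IsBigO.of_bound A ?_) h1
    filter_upwards [ha, eventually_ge_atTop 0] with t ht h0
    simp only [Pi.sub_apply, Real.norm_eq_abs]
    rwa [abs_of_nonneg (show 0 ≤ 1 + t by linarith)]
  have h3 : a ~[atTop] fun t => 2 / (k * t ^ 2) := by
    have e := h2.inv
    have e1 : (fun t => (a t)⁻¹)⁻¹ = a := by funext t; simp
    have e2 : (fun t : ℝ => k * t ^ 2 / 2)⁻¹ = fun t => 2 / (k * t ^ 2) := by funext t; simp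
    rwa [e1, e2] at e
  have h4 : c ~[atTop] fun t => k * t := by
    have e : (fun _ : ℝ => (1 : ℝ)) =o[atTop] fun t : ℝ => k * t :=
      (isLittleO_const_id_atTop (1 : ℝ)).trans_isBigO (isBigO_self_const_mul hk.ne' _ _)
    refine IsBigO.trans_isLittleO (IsBigO.of_bound A ?_) e
    filter_upwards [hc] with t ht
    simpa using ht
  refine ⟨h3, (h4.mul h3).congr_right ?_⟩
  filter_upwards [eventually_gt_atTop 0] with t ht
  simp only [Pi.mul_apply]
  field_simp

theorem IsNiceSolution.ratio_mem (hn : 2 ≤ n) (h : IsNiceSolution n k ρ₀ u₀ (Ici 0) ρ u E)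
    {M N : ℝ} (hM : ∀ x, M ≤ deriv u₀ x / ρ₀ x) (hN : ∀ x, deriv u₀ x / ρ₀ x ≤ N) {x t : ℝ}
    (ht : 0 ≤ t) : M + k * t ≤ unc (ratio ρ u) (x, t) ∧ unc (ratio ρ u) (x, t) ≤ N + k * t := by
  -- Flows live on half-open intervals [0, T); T = t + 1 is one that contains t.
  have h' := h.restrict (t + 1)
  obtain ⟨C, -, hf⟩ := h'.exists_flow hn
  exact ⟨hf.le_b h'.sublinear_ratio (fun x => by rw [h'.initial_ratio]; exact hM x) ht
      (by linarith),
    hf.b_le h'.sublinear_ratio (fun x => by rw [h'.initial_ratio]; exact hN x) ht (by linarith)⟩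

theorem IsNiceSolution.dx_eq_mul {I : Set ℝ} (h : IsNiceSolution n k ρ₀ u₀ I ρ u E) {x t : ℝ}
    (ht : t ∈ I) : dx u x t = unc (ratio ρ u) (x, t) * ρ x t := by
  simp only [unc, ratio]
  rw [div_mul_cancel₀ _ (h.solution.density_pos t ht x).ne']

theorem abs_le_of_quadratic_bounds {w w₀ W M N t : ℝ} (ht : 0 ≤ t) (hw0 : 0 ≤ w₀) (hW : w₀ ≤ W)
    (h1 : w₀ + M * t + k * t ^ 2 / 2 ≤ w) (h2 : w ≤ w₀ + N * t + k * t ^ 2 / 2) :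
    |w - k * t ^ 2 / 2| ≤ (W + |M| + |N|) * (1 + t) := by
  have e1 := neg_abs_le M
  have e2 := le_abs_self N
  have e3 := abs_nonneg M
  have e4 := abs_nonneg N
  have e5 : 0 ≤ W * t := mul_nonneg (hw0.trans hW) ht
  have e6 := mul_nonneg e3 ht
  have e7 := mul_nonneg e4 ht
  have e8 : -(|M| * t) ≤ M * t := by nlinarith
  have e9 : N * t ≤ |N| * t := by nlinarith
  rw [abs_le]
  constructor <;> nlinarith

/-- Upper and lower parabola share the leading coefficient k/2, so they differ by O(t) once both
bounds on the initial ratio are available. -/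
theorem IsNiceSolution.asymptotics_along_path (hk : 0 < k) (hn : 2 ≤ n)
    (h : IsNiceSolution n k ρ₀ u₀ (Ici 0) ρ u E) {M N : ℝ} (hM : ∀ x, M ≤ deriv u₀ x / ρ₀ x)
    (hN : ∀ x, deriv u₀ x / ρ₀ x ≤ N) {α : ℝ} {X : ℝ → ℝ} (hX : IsParticlePath u α X) :
    (fun t => ρ (X t) t) ~[atTop] (fun t => 2 / (k * t ^ 2)) ∧
      (fun t => dx u (X t) t) ~[atTop] (fun t => 2 / t) := by
  have hrm := fun {x t} => h.ratio_mem hn hM hN (x := x) (t := t)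
  have hw : ∀ t, 0 ≤ t → |(ρ (X t) t)⁻¹ - k * t ^ 2 / 2| ≤
      ((ρ (X 0) 0)⁻¹ + |M| + |N|) * (1 + t) := by
    intro t ht
    obtain ⟨C, -, hf⟩ := (h.restrict (t + 1)).exists_flow hn
    have hXc : ContinuousOn X (Ico 0 (t + 1)) := fun s hs =>
      (hX.2 s hs.1).continuousWithinAt.mono Ico_subset_Ici_self
    have hX' : ∀ s ∈ Ioo 0 (t + 1), HasDerivAt X (unc u (X s, s)) s := fun s hs =>
      (hX.2 s hs.1.le).hasDerivAt (Ici_mem_nhds hs.1)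
    have htI : t ∈ Ico 0 (t + 1) := ⟨ht, by linarith⟩
    have h1 := hf.inv_ge_along_path hXc hX' (M := M) (κ := k) (fun s hs => (hrm hs.1.le).1) htI
    have h2 := hf.inv_le_along_path hXc hX' (M := N) (κ := k) (fun s hs => (hrm hs.1.le).2) htI
    exact abs_le_of_quadratic_bounds ht
      (inv_pos.2 (h.solution.density_pos 0 self_mem_Ici (X 0))).le le_rfl h1 h2
  have hA : 0 ≤ (ρ (X 0) 0)⁻¹ := (inv_pos.2 (h.solution.density_pos 0 self_mem_Ici (X 0))).le
  obtain ⟨h1, h2⟩ := asymptotics_of_bounds hk (a := fun t => ρ (X t) t)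
    (c := fun t => unc (ratio ρ u) (X t, t)) (A := (ρ (X 0) 0)⁻¹ + |M| + |N|)
    ((eventually_ge_atTop 0).mono hw) ((eventually_ge_atTop 0).mono fun t ht => by
      obtain ⟨e1, e2⟩ := hrm (x := X t) ht
      have e3 := neg_abs_le M
      have e4 := le_abs_self N
      have e5 := abs_nonneg M
      have e6 := abs_nonneg N
      rw [abs_le]; constructor <;> linarith)
  refine ⟨h1, h2.congr_left ?_⟩
  filter_upwards [eventually_ge_atTop 0] with t ht
  rw [h.dx_eq_mul ht]

end

end ViscousEP

namespace ViscousEP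

open scoped Topology ContDiff

/-! ### Balanced fields -/

section

variable {n : ℕ∞} {k T C : ℝ} {ρ₀ u₀ : ℝ → ℝ} {ρ u E : ℝ → ℝ → ℝ} {r v b m : ℝ × ℝ → ℝ}

theorem Flow.tendsto_m_atTop (h : Flow k T C r v b m) {t : ℝ} (h0 : 0 ≤ t) (hT : t < T)
    (hi : Integrable fun ξ => r (ξ, t)) (x : ℝ) :
    Tendsto (fun y => m (y, t)) atTop (𝓝 (m (x, t) + ∫ ξ in Ioi x, r (ξ, t))) := by
  have h1 := intervalIntegral_tendsto_integral_Ioi x hi.integrableOn tendsto_id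
  have h2 := h1.const_add (m (x, t))
  refine h2.congr fun y => ?_
  have : ∫ ξ in x..y, r (ξ, t) = m (y, t) - m (x, t) :=
    intervalIntegral.integral_eq_sub_of_hasDerivAt
      (fun z _ => h.m_deriv z t (mem_strip₀.2 ⟨h0, hT⟩))
      ((continuous_slice h.cont_r h0 hT).intervalIntegrable _ _)
  simp only [id, this]; ring

theorem Flow.tendsto_m_atBot (h : Flow k T C r v b m) {t : ℝ} (h0 : 0 ≤ t) (hT : t < T)
    (hi : Integrable fun ξ => r (ξ, t)) (x : ℝ) :
    Tendsto (fun y => m (y, t)) atBot (𝓝 (m (x, t) - ∫ ξ in Iic x, r (ξ, t))) := by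
  have h1 := intervalIntegral_tendsto_integral_Iic x hi.integrableOn tendsto_id
  have h2 := h1.const_sub (m (x, t))
  refine h2.congr fun y => ?_
  have : ∫ ξ in y..x, r (ξ, t) = m (x, t) - m (y, t) :=
    intervalIntegral.integral_eq_sub_of_hasDerivAt
      (fun z _ => h.m_deriv z t (mem_strip₀.2 ⟨h0, hT⟩))
      ((continuous_slice h.cont_r h0 hT).intervalIntegrable _ _)
  simp only [id, this]; ring

/-- A balanced field is itself a mass coordinate, with constant limits at infinity. -/
theorem IsNiceSolution.exists_balanced_flow (hn : 2 ≤ n) (hT : 0 < T)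
    (h : IsNiceSolution n k ρ₀ u₀ (Ico 0 T) ρ u E) (hE : IsBalancedField (Ico 0 T) ρ E) :
    ∃ C H, 0 ≤ C ∧ 0 < H ∧ Flow k T C (unc ρ) (unc u) (unc (ratio ρ u)) (unc E) ∧
      ∀ t ∈ Ico 0 T, Tendsto (fun x => E x t) atTop (𝓝 H) ∧
        Tendsto (fun x => E x t) atBot (𝓝 (-H)) := by
  obtain ⟨C, hC, hf⟩ := h.exists_flow hn
  set m := massCoord (unc ρ) (unc u)
  have hi : ∀ t ∈ Ico 0 T, Integrable fun ξ => unc ρ (ξ, t) := fun t ht => (hE t ht).1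
  set P : ℝ → ℝ := fun t => m (0, t) + ∫ ξ in Ioi (0 : ℝ), unc ρ (ξ, t)
  set Q : ℝ → ℝ := fun t => m (0, t) - ∫ ξ in Iic (0 : ℝ), unc ρ (ξ, t)
  have hP : ∀ t ∈ Ico 0 T, Tendsto (fun y => m (y, t)) atTop (𝓝 (P t)) := fun t ht =>
    hf.tendsto_m_atTop ht.1 ht.2 (hi t ht) 0
  have hQ : ∀ t ∈ Ico 0 T, Tendsto (fun y => m (y, t)) atBot (𝓝 (Q t)) := fun t ht =>
    hf.tendsto_m_atBot ht.1 ht.2 (hi t ht) 0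
  -- `cone_abs` works in both directions of time, so letting x → ∞ gives P s ≤ P t for all pairs:
  -- the limits of m are constant, that is, no mass enters or leaves at infinity.
  have hPle : ∀ s ∈ Ico 0 T, ∀ t ∈ Ico 0 T, P s ≤ P t := fun s hs t ht =>
    le_of_tendsto_of_tendsto' (hP s hs)
      ((hP t ht).comp (tendsto_atTop_add_const_right _ (C * |t - s|) tendsto_id))
      fun x => (hf.cone_abs hs.1 hs.2 ht.1 ht.2).1
  have hQle : ∀ s ∈ Ico 0 T, ∀ t ∈ Ico 0 T, Q t ≤ Q s := fun s hs t ht =>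
    le_of_tendsto_of_tendsto'
      ((hQ t ht).comp (tendsto_atBot_add_const_right _ (-(C * |t - s|)) tendsto_id)) (hQ s hs)
      fun x => by simpa [sub_eq_add_neg] using (hf.cone_abs (x := x) hs.1 hs.2 ht.1 ht.2).2
  have h0 : (0 : ℝ) ∈ Ico 0 T := ⟨le_rfl, hT⟩
  have hPc : ∀ t ∈ Ico 0 T, P t = P 0 := fun t ht => le_antisymm (hPle t ht 0 h0) (hPle 0 h0 t ht)
  have hQc : ∀ t ∈ Ico 0 T, Q t = Q 0 := fun t ht => le_antisymm (hQle 0 h0 t ht) (hQle t ht 0 h0)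
  -- Centring m makes its limits opposite; the half difference of the masses on both sides of x is
  -- then exactly m - c, and H is half the total mass.
  set c := (P 0 + Q 0) / 2
  have hEm : ∀ p ∈ strip₀ T, unc E p = m p - c := by
    rintro ⟨x, t⟩ hp
    have ht := mem_strip₀.1 hp
    have e1 := tendsto_nhds_unique (hf.tendsto_m_atTop ht.1 ht.2 (hi t ht) x) (hP t ht)
    have e2 := tendsto_nhds_unique (hf.tendsto_m_atBot ht.1 ht.2 (hi t ht) x) (hQ t ht)
    rw [hPc t ht] at e1
    rw [hQc t ht] at e2
    have e3 := (hE t ht).2 x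
    simp only [unc, c] at e1 e2 ⊢
    rw [e3]
    linarith
  have hlim : ∀ t ∈ Ico 0 T, Tendsto (fun x => E x t) atTop (𝓝 (P 0 - c)) ∧
      Tendsto (fun x => E x t) atBot (𝓝 (Q 0 - c)) := by
    intro t ht
    refine ⟨?_, ?_⟩
    · have := (hP t ht).sub_const c
      rw [hPc t ht] at this
      exact this.congr fun x => (hEm (x, t) (mem_strip₀.2 ht)).symm
    · have := (hQ t ht).sub_const c
      rw [hQc t ht] at this
      exact this.congr fun x => (hEm (x, t) (mem_strip₀.2 ht)).symm
  have hmono := hf.strictMono_m le_rfl hT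
  have hQP : Q 0 < P 0 := by
    have e1 : m (1, 0) ≤ P 0 := hmono.monotone.ge_of_tendsto (hP 0 h0) 1
    have e2 : Q 0 ≤ m (0, 0) := hmono.monotone.le_of_tendsto (hQ 0 h0) 0
    have e3 : m (0, 0) < m (1, 0) := hmono zero_lt_one
    linarith
  refine ⟨C, (P 0 - Q 0) / 2, hC, by linarith, ?_, fun t ht => ?_⟩
  · refine { hf with cont_m := ?_, m_fderiv := fun p hp => ?_, m_deriv := fun x t hp => ?_ }
    · exact (hf.cont_m.sub continuousOn_const).congr hEm
    · refine ((hf.m_fderiv p hp).sub_const c).congr_of_eventuallyEq ?_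
      filter_upwards [strip_mem_nhds hp] with q hq using hEm q (strip_subset T hq)
    · refine ((hf.m_deriv x t hp).sub_const c).congr_of_eventuallyEq ?_
      exact Eventually.of_forall fun y => hEm (y, t) (mem_strip₀.2 (mem_strip₀.1 hp))
  · have e1 : (P 0 - Q 0) / 2 = P 0 - c := by simp only [c]; ring
    have e2 : -((P 0 - Q 0) / 2) = Q 0 - c := by simp only [c]; ring
    rw [e2, e1]
    exact hlim t ht

theorem deriv_nonpos_of_right_max {g : ℝ → ℝ} {t d : ℝ} (hg : HasDerivAt g d t)
    (h : ∀ᶠ s in 𝓝[>] t, g s ≤ g t) : d ≤ 0 := by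
  have h1 := (hasDerivAt_iff_tendsto_slope.1 hg).mono_left (nhdsGT_le_nhdsNE t)
  refine le_of_tendsto h1 ?_
  filter_upwards [h, self_mem_nhdsWithin] with s hs hst
  rw [slope_def_field]
  exact div_nonpos_of_nonpos_of_nonneg (by linarith) (by linarith [mem_Ioi.1 hst])

/-- Monotonicity of m in x places the point between the two extremal cone lines, from x₁ and from
x₂, which move by at most CT; the interval does not depend on t. -/
theorem Flow.mem_Icc_of_label (h : Flow k T C r v b m) {x₁ x₂ η x t : ℝ}
    (h₁ : m (x₁, 0) ≤ -η) (h₂ : η ≤ m (x₂, 0)) (h0t : 0 ≤ t) (htT : t < T) (hm : |m (x, t)| ≤ η) :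
    x ∈ Icc (x₁ - C * T) (x₂ + C * T) := by
  rw [abs_le] at hm
  have hC := h.C_nonneg (mem_strip₀.2 ⟨h0t, htT⟩ : (x, t) ∈ strip₀ T)
  have hCt : C * (t - 0) ≤ C * T := by gcongr; linarith
  have e1 := (h.cone (x := x₁) le_rfl h0t htT).2
  have e2 := (h.cone (x := x₂) le_rfl h0t htT).1
  have e3 : x₁ - C * (t - 0) ≤ x := (h.strictMono_m h0t htT).le_iff_le.1
    (show m (x₁ - C * (t - 0), t) ≤ m (x, t) by linarith)
  have e4 : x ≤ x₂ + C * (t - 0) := (h.strictMono_m h0t htT).le_iff_le.1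
    (show m (x, t) ≤ m (x₂ + C * (t - 0), t) by linarith)
  exact ⟨by linarith, by linarith⟩

theorem Flow.isCompact_labels (h : Flow k T C r v b m) {x₁ x₂ η t₁ t₂ : ℝ}
    (h₁ : m (x₁, 0) ≤ -η) (h₂ : η ≤ m (x₂, 0)) (ht₁ : 0 ≤ t₁) (ht₂ : t₂ < T) :
    IsCompact {p : ℝ × ℝ | |m p| ≤ η ∧ p.2 ∈ Icc t₁ t₂} := by
  have hsub : Icc (x₁ - C * T) (x₂ + C * T) ×ˢ Icc t₁ t₂ ⊆ strip₀ T := fun p hp =>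
    ⟨mem_univ _, ht₁.trans hp.2.1, hp.2.2.trans_lt ht₂⟩
  have hK : IsCompact (Icc (x₁ - C * T) (x₂ + C * T) ×ˢ Icc t₁ t₂) :=
    isCompact_Icc.prod isCompact_Icc
  have : {p : ℝ × ℝ | |m p| ≤ η ∧ p.2 ∈ Icc t₁ t₂} =
      (Icc (x₁ - C * T) (x₂ + C * T) ×ˢ Icc t₁ t₂) ∩ m ⁻¹' Icc (-η) η := by
    ext ⟨x, t⟩
    refine ⟨fun ⟨h1, h2⟩ => ⟨⟨?_, h2⟩, abs_le.1 h1⟩, fun ⟨⟨_, h2⟩, h1⟩ => ⟨abs_le.2 h1, h2⟩⟩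
    exact h.mem_Icc_of_label h₁ h₂ (ht₁.trans h2.1) (h2.2.trans_lt ht₂) h1
  rw [this]
  exact hK.of_isClosed_subset
    ((h.cont_m.mono hsub).preimage_isClosed_of_isClosed hK.isClosed isClosed_Icc) inter_subset_left

/-- Comparison with a parabola in the mass coordinate, on a band of particle paths. -/
theorem Flow.velocity_le_of_band (h : Flow k T C r v b m)
    (mom : ∀ p ∈ strip T, pt v p + v p * px v p = k * m p + px b p)
    {σ N η μ S t₀ x₁ x₂ ℓ : ℝ} (hσ : |σ| = 1)
    (hN : ∀ p ∈ strip T, |b p - k * p.2| ≤ N) (hη : 0 < η) (h₁ : m (x₁, 0) ≤ -η)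
    (h₂ : η ≤ m (x₂, 0)) (ht₀ : 0 < t₀) (hμ : ∀ p ∈ strip T, t₀ ≤ p.2 → r p ≤ μ)
    (hℓ : (N + 1) / η * μ < ℓ) (hS : ∀ x, |m (x, t₀)| ≤ η → |v (x, t₀) - k * t₀ * m (x, t₀)| ≤ S)
    {x t : ℝ} (ht : t₀ ≤ t) (htT : t < T) (hx : |m (x, t)| ≤ η) :
    σ * (v (x, t) - k * t * m (x, t)) ≤ S + (N + 1) / (2 * η) * m (x, t) ^ 2 + ℓ * (t - t₀) := by
  by_contra! hcon
  have hK := h.isCompact_labels h₁ h₂ ht₀.le htT (t₁ := t₀)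
  set K := {p : ℝ × ℝ | |m p| ≤ η ∧ p.2 ∈ Icc t₀ t}
  have hKs : K ⊆ strip T := fun p hp => ⟨mem_univ _, ht₀.trans_le hp.2.1, hp.2.2.trans_lt htT⟩
  -- The parabola in m has slope ±(N + 1) at m = ±η, steeper than the slope σ(b - kt) of σ(v - ktm),
  -- so a maximum of F cannot sit on an edge of the band. The subtraction of ktm removes the force
  -- km from the equation along paths.
  set F : ℝ × ℝ → ℝ := fun p => σ * (v p - k * p.2 * m p) - (S + (N + 1) / (2 * η) * m p ^ 2 +
    ℓ * (p.2 - t₀))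
  have hFc : ContinuousOn F K := by
    have c1 : ContinuousOn v K := h.cont_v.mono (hKs.trans (strip_subset T))
    have c2 : ContinuousOn m K := h.cont_m.mono (hKs.trans (strip_subset T))
    fun_prop
  obtain ⟨⟨y, s⟩, hy, hmax⟩ := hK.exists_isMaxOn ⟨(x, t), hx, ht, le_rfl⟩ hFc
  have hF0 : 0 < F (y, s) := lt_of_lt_of_le (by simp only [F]; linarith)
    (hmax (show (x, t) ∈ K from ⟨hx, ht, le_rfl⟩))
  have hN0 : 0 ≤ N := (abs_nonneg _).trans (hN _ (hKs hy))
  have hst : s ∈ Icc t₀ t := hy.2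
  have hstr : ∀ z, (z, s) ∈ strip T := fun z => mem_strip.2 (mem_strip.1 (hKs hy))
  have hs : t₀ < s := by
    refine hst.1.lt_of_ne fun e => ?_
    subst e
    have e1 := hS y hy.1
    have e2 : σ * (v (y, t₀) - k * t₀ * m (y, t₀)) ≤ S := by
      refine (le_abs_self _).trans ?_
      rw [abs_mul, hσ, one_mul]; exact e1
    have e3 : 0 ≤ (N + 1) / (2 * η) * m (y, t₀) ^ 2 := by positivity
    simp only [F] at hF0
    linarith
  set Hf : ℝ → ℝ := fun z => σ * (b (z, s) - k * s) - (N + 1) / η * m (z, s)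
  have dm : ∀ z, HasDerivAt (fun z => m (z, s)) (r (z, s)) z := fun z =>
    h.m_deriv z s (strip_subset T (hstr z))
  have hFx : ∀ z, HasDerivAt (fun z => F (z, s)) (r (z, s) * Hf z) z := by
    intro z
    have dv := hasDerivAt_px (differentiableAt_of_strip h.diff_v (by norm_num) (hstr z))
    rw [h.px_v _ (hstr z)] at dv
    have e := ((dv.sub ((dm z).const_mul (k * s))).const_mul σ).sub
      (((((dm z).pow 2).const_mul ((N + 1) / (2 * η))).const_add S).add_const (ℓ * (s - t₀)))
    refine e.congr_deriv ?_
    simp only [Hf]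
    field_simp
    ring
  have hpos : ∀ z, 0 < r (z, s) := fun z => h.r_pos _ (strip_subset T (hstr z))
  have hNs := abs_le.1 (hN _ (hKs hy))
  have hσb : |σ * (b (y, s) - k * s)| ≤ N := by rw [abs_mul, hσ, one_mul]; exact hN _ (hKs hy)
  have hmono := h.strictMono_m (ht₀.trans hs).le (hst.2.trans_lt htT)
  have hmcont : Continuous fun z => m (z, s) :=
    continuous_slice h.cont_m (ht₀.trans hs).le (hst.2.trans_lt htT)
  have hne1 : m (y, s) ≠ η := by
    intro e
    have hd : 0 ≤ r (y, s) * Hf y := by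
      refine deriv_nonneg_of_left_max (hFx y) ?_
      have h1 : ∀ᶠ z in 𝓝[<] y, -η < m (z, s) := nhdsWithin_le_nhds
        (hmcont.continuousAt.eventually (lt_mem_nhds (show -η < m (y, s) by rw [e]; linarith)))
      filter_upwards [h1, self_mem_nhdsWithin] with z hz hzy
      exact hmax (show (z, s) ∈ K from
        ⟨abs_le.2 ⟨hz.le, (hmono (mem_Iio.1 hzy)).le.trans e.le⟩, hst⟩)
    have : 0 ≤ Hf y := nonneg_of_mul_nonneg_right hd (hpos y)
    simp only [Hf, e] at this
    rw [div_mul_cancel₀ _ hη.ne'] at this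
    linarith [(abs_le.1 hσb).2]
  have hne2 : m (y, s) ≠ -η := by
    intro e
    have hd : r (y, s) * Hf y ≤ 0 := by
      refine deriv_nonpos_of_right_max (hFx y) ?_
      have h1 : ∀ᶠ z in 𝓝[>] y, m (z, s) < η := nhdsWithin_le_nhds
        (hmcont.continuousAt.eventually (gt_mem_nhds (show m (y, s) < η by rw [e]; linarith)))
      filter_upwards [h1, self_mem_nhdsWithin] with z hz hzy
      exact hmax (show (z, s) ∈ K from
        ⟨abs_le.2 ⟨e.ge.trans (hmono (mem_Ioi.1 hzy)).le, hz.le⟩, hst⟩)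
    have : Hf y ≤ 0 := nonpos_of_mul_nonpos_right hd (hpos y)
    simp only [Hf, e] at this
    rw [mul_neg, div_mul_cancel₀ _ hη.ne'] at this
    linarith [(abs_le.1 hσb).1]
  have hint : |m (y, s)| < η := by
    have := abs_le.1 hy.1
    exact abs_lt.2 ⟨this.1.lt_of_ne (Ne.symm hne2), this.2.lt_of_ne hne1⟩
  have hloc : ∀ᶠ q in 𝓝 (y, s), q.2 ≤ s → F q ≤ F (y, s) := by
    have c1 : ContinuousAt m (y, s) := (h.differentiableAt_m (hstr y)).continuousAt
    have h1 : ∀ᶠ q in 𝓝 (y, s), |m q| < η := c1.abs.eventually (gt_mem_nhds hint)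
    have h2 : ∀ᶠ q : ℝ × ℝ in 𝓝 (y, s), t₀ < q.2 :=
      (continuous_snd.tendsto (y, s)).eventually (lt_mem_nhds hs)
    filter_upwards [h1, h2] with q hq1 hq2 hq3
    exact hmax (show q ∈ K from ⟨hq1.le, hq2.le, hq3.trans hst.2⟩)
  have hHd : HasDerivAt Hf (σ * px b (y, s) - (N + 1) / η * r (y, s)) y :=
    (((hasDerivAt_px (differentiableAt_of_strip h.diff_b (by norm_num) (hstr y))).sub_const
      (k * s)).const_mul σ).sub ((dm y).const_mul _)
  have hxx := (hasDerivAt_px (differentiableAt_of_strip h.diff_r (by norm_num) (hstr y))).mul hHd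
  have hFt : HasDerivAt (fun s => F (y, s))
      (σ * px b (y, s) - r (y, s) * v (y, s) * Hf y - ℓ) s := by
    have dv := hasDerivAt_pt (differentiableAt_of_strip h.diff_v (by norm_num) (hstr y))
    have dmt := hasDerivAt_pt (h.differentiableAt_m (hstr y))
    rw [h.pt_m (hstr y)] at dmt
    have e := ((dv.sub (((hasDerivAt_id s).const_mul k).mul dmt)).const_mul σ).sub
      ((((dmt.pow 2).const_mul ((N + 1) / (2 * η))).const_add S).add
        (((hasDerivAt_id s).sub_const t₀).const_mul ℓ))
    refine e.congr_deriv ?_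
    have e2 := mom _ (hstr y)
    rw [h.px_v _ (hstr y)] at e2
    simp only [Hf, id]
    rw [show pt v (y, s) = k * m (y, s) + px b (y, s) - v (y, s) * (b (y, s) * r (y, s)) by
      linarith]
    field_simp
    ring
  -- At an interior maximum the second order condition gives σb_x ≤ (N + 1)r/η, and the time
  -- condition gives σb_x ≥ ℓ; smallness of r makes them incompatible.
  obtain ⟨e1, e2, e3⟩ := parabolic_max_conditions hloc (Eventually.of_forall hFx) hxx hFt
  have hH0 : Hf y = 0 := (mul_eq_zero.1 e1).resolve_left (hpos y).ne'
  rw [hH0, mul_zero, zero_add] at e2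
  rw [hH0, mul_zero, sub_zero] at e3
  have e4 : σ * px b (y, s) - (N + 1) / η * r (y, s) ≤ 0 := nonpos_of_mul_nonpos_right e2 (hpos y)
  have e5 : (N + 1) / η * r (y, s) ≤ (N + 1) / η * μ := by
    gcongr; exact hμ _ (hstr y) hs.le
  linarith

end

end ViscousEP

namespace ViscousEP

open scoped Topology ContDiff

/-! ### Behaviour at fixed positions -/

section

variable {n : ℕ∞} {k T C : ℝ} {ρ₀ u₀ : ℝ → ℝ} {ρ u E : ℝ → ℝ → ℝ} {r v b m : ℝ × ℝ → ℝ}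

/-- Integrating the velocity bound, the path labelled η outruns a parabola in t; points to its left
carry smaller labels. -/
theorem Flow.displacement_ge (h : Flow k T C r v b m) {A a η t₀ z : ℝ} (ht₀ : 0 < t₀)
    (hz : m (z, t₀) = η) (hv : ∀ x t, t₀ ≤ t → t < T → m (x, t) = η → a * t - A ≤ v (x, t))
    {x t : ℝ} (ht : t₀ ≤ t) (htT : t < T)
    (hx : x ≤ z + a / 2 * (t ^ 2 - t₀ ^ 2) - A * (t - t₀)) : m (x, t) ≤ η := by
  obtain ⟨X, hX0, hXc, hX', hXm, -⟩ := h.exists_path (x₀ := z) ht₀.le (ht.trans_lt htT)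
  have hder : ∀ s ∈ Ioo 0 T, HasDerivAt (fun s => X s - (a / 2 * s ^ 2 - A * s))
      (v (X s, s) - (a * s - A)) s := by
    intro s hs
    have e : HasDerivAt (fun s : ℝ => a / 2 * s ^ 2 - A * s) (a * s - A) s :=
      ((((hasDerivAt_id s).pow 2).const_mul (a / 2)).sub
        ((hasDerivAt_id s).const_mul A)).congr_deriv (by simp; ring)
    exact (hX' s hs).sub e
  have hsub : ∀ s ∈ Icc t₀ t, s ∈ Ioo 0 T := fun s hs => ⟨ht₀.trans_le hs.1, hs.2.trans_lt htT⟩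
  have hmono := monotoneOn_of_deriv_nonneg (convex_Icc t₀ t)
    (fun s hs => (hder s (hsub s hs)).continuousAt.continuousWithinAt)
    (fun s hs => (hder s (hsub s (interior_subset hs))).differentiableAt.differentiableWithinAt)
    (fun s hs => by
      have hs' := interior_subset hs
      have hsT := hsub s hs'
      rw [(hder s hsT).deriv]
      have := hv (X s) s hs'.1 hsT.2 (by rw [hXm s (Ioo_subset_Ico_self hsT), hz])
      linarith)
  have e := hmono (left_mem_Icc.2 ht) (right_mem_Icc.2 ht) ht
  simp only [hX0] at e
  have hxX : x ≤ X t := by linarith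
  have h0t := ht₀.le.trans ht
  rw [← hz, ← hXm t ⟨h0t, htT⟩]
  exact (h.strictMono_m h0t htT).monotone hxX

theorem Flow.le_displacement (h : Flow k T C r v b m) {A a η t₀ z : ℝ} (ht₀ : 0 < t₀)
    (hz : m (z, t₀) = η) (hv : ∀ x t, t₀ ≤ t → t < T → m (x, t) = η → v (x, t) ≤ -(a * t - A))
    {x t : ℝ} (ht : t₀ ≤ t) (htT : t < T)
    (hx : z - (a / 2 * (t ^ 2 - t₀ ^ 2) - A * (t - t₀)) ≤ x) : η ≤ m (x, t) := by
  obtain ⟨X, hX0, hXc, hX', hXm, -⟩ := h.exists_path (x₀ := z) ht₀.le (ht.trans_lt htT)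
  have hder : ∀ s ∈ Ioo 0 T, HasDerivAt (fun s => X s + (a / 2 * s ^ 2 - A * s))
      (v (X s, s) + (a * s - A)) s := by
    intro s hs
    have e : HasDerivAt (fun s : ℝ => a / 2 * s ^ 2 - A * s) (a * s - A) s :=
      ((((hasDerivAt_id s).pow 2).const_mul (a / 2)).sub
        ((hasDerivAt_id s).const_mul A)).congr_deriv (by simp; ring)
    exact (hX' s hs).add e
  have hsub : ∀ s ∈ Icc t₀ t, s ∈ Ioo 0 T := fun s hs => ⟨ht₀.trans_le hs.1, hs.2.trans_lt htT⟩
  have hanti := antitoneOn_of_deriv_nonpos (convex_Icc t₀ t)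
    (fun s hs => (hder s (hsub s hs)).continuousAt.continuousWithinAt)
    (fun s hs => (hder s (hsub s (interior_subset hs))).differentiableAt.differentiableWithinAt)
    (fun s hs => by
      have hs' := interior_subset hs
      have hsT := hsub s hs'
      rw [(hder s hsT).deriv]
      have := hv (X s) s hs'.1 hsT.2 (by rw [hXm s (Ioo_subset_Ico_self hsT), hz])
      linarith)
  have e := hanti (left_mem_Icc.2 ht) (right_mem_Icc.2 ht) ht
  simp only [hX0] at e
  have hxX : X t ≤ x := by linarith
  have h0t := ht₀.le.trans ht
  rw [← hz, ← hXm t ⟨h0t, htT⟩]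
  exact (h.strictMono_m h0t htT).monotone hxX

theorem IsBalancedField.restrict (hE : IsBalancedField (Ici 0) ρ E) (T : ℝ) :
    IsBalancedField (Ico 0 T) ρ E := fun t ht => hE t ht.1

/-- For large times, a fixed position meets only a compact set of particle labels. -/
theorem IsNiceSolution.eventually_abs_field_le (hk : 0 < k) (hn : 2 ≤ n)
    (h : IsNiceSolution n k ρ₀ u₀ (Ici 0) ρ u E) (hE : IsBalancedField (Ici 0) ρ E) {M N : ℝ}
    (hM : ∀ x, M ≤ deriv u₀ x / ρ₀ x) (hN : ∀ x, deriv u₀ x / ρ₀ x ≤ N) {η x₁ x₂ : ℝ} (hη : 0 < η)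
    (h₁ : E x₁ 0 = -η) (h₂ : E x₂ 0 = η) (x : ℝ) : ∀ᶠ t in atTop, |E x t| ≤ η := by
  have hrm := fun {x t} => h.ratio_mem hn hM hN (x := x) (t := t)
  have hflow : ∀ T, 0 < T → ∃ C, Flow k T C (unc ρ) (unc u) (unc (ratio ρ u)) (unc E) := fun T hT =>
    let ⟨C, _, _, _, hf, _⟩ := (h.restrict T).exists_balanced_flow hn hT (hE.restrict T)
    ⟨C, hf⟩
  set N' := |M| + |N|
  have hN' : ∀ x t, 0 ≤ t → |unc (ratio ρ u) (x, t) - k * t| ≤ N' := by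
    intro x t ht
    obtain ⟨e1, e2⟩ := hrm (x := x) ht
    have e3 := neg_abs_le M
    have e4 := le_abs_self N
    have e5 := abs_nonneg M
    have e6 := abs_nonneg N
    rw [abs_le]; constructor <;> simp only [N'] <;> linarith
  have hN'0 : 0 ≤ N' := by positivity
  -- A quarter of the expected acceleration kη: the path labelled η keeps velocity at least a·t - A
  -- with a = 3kη/4 below.
  set ℓ := k * η / 4
  have hℓ : 0 < ℓ := by positivity
  -- the density is small after the time `t₀`
  obtain ⟨t₀, ht₀, hμ⟩ : ∃ t₀ : ℝ, 0 < t₀ ∧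
      ∀ x t, t₀ ≤ t → ρ x t ≤ ℓ * η / (2 * (N' + 1)) := by
    set μ := ℓ * η / (2 * (N' + 1))
    have hμ0 : 0 < μ := by positivity
    -- Beyond this time kt²/2 ≥ (|M| + μ⁻¹)t, so the lower parabola exceeds μ⁻¹ whatever the
    -- starting point. With this μ the requirement (N' + 1)μ/η < ℓ holds with a factor 2 to spare.
    refine ⟨max 1 (2 * (|M| + μ⁻¹) / k), lt_max_of_lt_left one_pos, fun x t ht => ?_⟩
    have ht1 : 1 ≤ t := (le_max_left _ _).trans ht
    have ht2 : 2 * (|M| + μ⁻¹) / k ≤ t := (le_max_right _ _).trans ht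
    rw [div_le_iff₀ hk] at ht2
    have ht0 : 0 ≤ t := zero_le_one.trans ht1
    obtain ⟨C, hf⟩ := hflow (t + 1) (by linarith)
    obtain ⟨X, hXt, hXc, hX', -⟩ := hf.exists_path (x₀ := x) ht0 (show t < t + 1 by linarith)
    have h1 := hf.inv_ge_along_path hXc hX' (M := M) (κ := k) (fun s hs => (hrm hs.1.le).1)
      (show t ∈ Ico 0 (t + 1) from ⟨ht0, by linarith⟩)
    rw [hXt] at h1
    have h2 : 0 < (unc ρ (X 0, 0))⁻¹ := inv_pos.2 (h.solution.density_pos 0 self_mem_Ici (X 0))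
    have h3 : μ⁻¹ ≤ (unc ρ (x, t))⁻¹ := by
      have e0 : 0 < μ⁻¹ := inv_pos.2 hμ0
      have e1 : -(|M| * t) ≤ M * t := by nlinarith [neg_abs_le M]
      have e2 : μ⁻¹ ≤ μ⁻¹ * t := le_mul_of_one_le_right e0.le ht1
      nlinarith
    exact (inv_le_inv₀ hμ0 (h.solution.density_pos t ht0 x)).1 h3
  obtain ⟨C₀, hC₀⟩ := h.bounded t₀
  set S := C₀ + k * t₀ * η
  have hS : ∀ x, |unc E (x, t₀)| ≤ η → |unc u (x, t₀) - k * t₀ * unc E (x, t₀)| ≤ S := by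
    intro x hx
    refine (abs_sub _ _).trans ?_
    rw [abs_mul, abs_of_pos (show 0 < k * t₀ by positivity)]
    have := hC₀ t₀ ht₀.le le_rfl x
    simp only [S, unc] at hx ⊢
    gcongr
  set A := S + (N' + 1) / (2 * η) * η ^ 2
  have hvel : ∀ σ : ℝ, |σ| = 1 → ∀ x t, t₀ ≤ t → |E x t| ≤ η →
      σ * (u x t - k * t * E x t) ≤ A + ℓ * t := by
    intro σ hσ x t ht hx
    obtain ⟨C, hf⟩ := hflow (t + 1) (by linarith)
    have hs := (h.restrict (t + 1)).solution
    have e := hf.velocity_le_of_band (fun p hp => hs.momentum_px hn hp) hσ (N := N') (η := η)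
      (μ := ℓ * η / (2 * (N' + 1))) (S := S) (t₀ := t₀) (x₁ := x₁) (x₂ := x₂) (ℓ := ℓ)
      (fun p hp => hN' p.1 p.2 hp.2.1.le) hη h₁.le h₂.ge ht₀ (fun p _ hpt => hμ p.1 p.2 hpt) ?_ hS
      (x := x) (t := t) ht (by linarith) hx
    · simp only [unc] at e
      have e1 : E x t ^ 2 ≤ η ^ 2 := sq_le_sq' (abs_le.1 hx).1 (abs_le.1 hx).2
      have e2 : (N' + 1) / (2 * η) * E x t ^ 2 ≤ (N' + 1) / (2 * η) * η ^ 2 := by gcongr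
      have e3 : 0 ≤ ℓ * t₀ := by positivity
      simp only [A]; linarith
    · have : (N' + 1) / η * (ℓ * η / (2 * (N' + 1))) = ℓ / 2 := by field_simp
      rw [this]; linarith
  set a := 3 * (k * η) / 4
  have ha : 0 < a := by positivity
  -- the two extreme paths
  obtain ⟨C₁, hf₁⟩ := hflow (t₀ + 1) (by linarith)
  obtain ⟨z₂, hz₂, -⟩ := hf₁.exists_level (x := x₂) (t := t₀) le_rfl (by linarith : 0 < t₀ + 1)
    ht₀.le (by linarith)
  obtain ⟨z₁, hz₁, -⟩ := hf₁.exists_level (x := x₁) (t := t₀) le_rfl (by linarith : 0 < t₀ + 1)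
    ht₀.le (by linarith)
  rw [show unc E (x₂, 0) = η from h₂] at hz₂
  rw [show unc E (x₁, 0) = -η from h₁] at hz₁
  have hgrow : Tendsto (fun t : ℝ => a / 2 * (t ^ 2 - t₀ ^ 2) - A * (t - t₀)) atTop atTop := by
    have e : (fun t : ℝ => a / 2 * (t ^ 2 - t₀ ^ 2) - A * (t - t₀)) =
        fun t => t * (a / 2 * t - A) + (A * t₀ - a / 2 * t₀ ^ 2) := by funext t; ring
    rw [e]
    refine tendsto_atTop_add_const_right _ _ (tendsto_id.atTop_mul_atTop₀ ?_)
    exact tendsto_atTop_add_const_right _ _ (tendsto_id.const_mul_atTop (by positivity))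
  filter_upwards [eventually_ge_atTop t₀, hgrow.eventually_ge_atTop (x - z₂),
    hgrow.eventually_ge_atTop (z₁ - x)] with t ht e1 e2
  obtain ⟨C, hf⟩ := hflow (t + 1) (by linarith)
  rw [abs_le]
  constructor
  · refine hf.le_displacement (A := A) (a := a) (z := z₁) ht₀ hz₁ (fun y s hs _ hy => ?_) ht
      (by linarith) (by linarith)
    simp only [unc] at hy ⊢
    have := hvel 1 (by simp) y s hs (by rw [hy, abs_neg, abs_of_pos hη])
    rw [hy] at this
    simp only [a, ℓ] at this ⊢
    linarith
  · refine hf.displacement_ge (A := A) (a := a) (z := z₂) ht₀ hz₂ (fun y s hs _ hy => ?_) ht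
      (by linarith) (by linarith)
    simp only [unc] at hy ⊢
    have := hvel (-1) (by simp) y s hs (by rw [hy, abs_of_pos hη])
    rw [hy] at this
    simp only [a, ℓ] at this ⊢
    linarith

/-- The path through (x, t) depends on t, but for large t its label is at most H/2 in size, so it
starts in a fixed compact interval. There 1/ρ₀ is bounded, and the parabolic bounds hold with
uniform constants. -/
theorem IsNiceSolution.asymptotics_at_point (hk : 0 < k) (hn : 2 ≤ n)
    (h : IsNiceSolution n k ρ₀ u₀ (Ici 0) ρ u E) (hE : IsBalancedField (Ici 0) ρ E) {M N : ℝ}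
    (hM : ∀ x, M ≤ deriv u₀ x / ρ₀ x) (hN : ∀ x, deriv u₀ x / ρ₀ x ≤ N) (x : ℝ) :
    (fun t => ρ x t) ~[atTop] (fun t => 2 / (k * t ^ 2)) ∧
      (fun t => dx u x t) ~[atTop] (fun t => 2 / t) := by
  have hrm := fun {x t} => h.ratio_mem hn hM hN (x := x) (t := t)
  obtain ⟨C, H, hC, hH, hf, hlim⟩ :=
    (h.restrict 1).exists_balanced_flow hn one_pos (hE.restrict 1)
  have hcE : Continuous fun x => E x 0 := continuous_slice hf.cont_m le_rfl one_pos
  obtain ⟨hl1, hl2⟩ := hlim 0 ⟨le_rfl, one_pos⟩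
  have hmid : ∀ c, -H < c → c < H → ∃ y, E y 0 = c := by
    intro c h1 h2
    obtain ⟨y₁, hy₁⟩ := (hl2.eventually (gt_mem_nhds h1)).exists
    obtain ⟨y₂, hy₂⟩ := (hl1.eventually (lt_mem_nhds h2)).exists
    exact mem_range_of_exists_le_of_exists_ge hcE ⟨y₁, hy₁.le⟩ ⟨y₂, hy₂.le⟩
  obtain ⟨x₁, h₁⟩ := hmid (-(H / 2)) (by linarith) (by linarith)
  obtain ⟨x₂, h₂⟩ := hmid (H / 2) (by linarith) (by linarith)
  have hev := h.eventually_abs_field_le hk hn hE hM hN (η := H / 2) (by linarith) h₁ h₂ x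
  have hpos0 : ∀ y, 0 < ρ y 0 := h.solution.density_pos 0 self_mem_Ici
  have hcρ : Continuous fun y => (ρ y 0)⁻¹ :=
    Continuous.inv₀ (continuous_slice hf.cont_r le_rfl one_pos) fun y => (hpos0 y).ne'
  obtain ⟨W, hW⟩ := (isCompact_Icc (a := x₁) (b := x₂)).exists_bound_of_continuousOn
    hcρ.continuousOn
  set W' := max W 0
  have hw : ∀ᶠ t in atTop, |(ρ x t)⁻¹ - k * t ^ 2 / 2| ≤ (W' + |M| + |N|) * (1 + t) := by
    filter_upwards [hev, eventually_ge_atTop 0] with t hxt ht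
    obtain ⟨C, -, -, -, hg, -⟩ := (h.restrict (t + 1)).exists_balanced_flow hn (by linarith)
      (hE.restrict (t + 1))
    have htI : t ∈ Ico 0 (t + 1) := ⟨ht, by linarith⟩
    obtain ⟨X, hXt, hXc, hX', hXm, -⟩ := hg.exists_path (x₀ := x) ht htI.2
    -- The label is transported back to time 0, where E is strictly increasing.
    have hX0 : X 0 ∈ Icc x₁ x₂ := by
      have e := hXm 0 ⟨le_rfl, by linarith⟩
      have hm := hg.strictMono_m le_rfl (show 0 < t + 1 by linarith)
      have e2 := abs_le.1 hxt
      refine ⟨hm.le_iff_le.1 ?_, hm.le_iff_le.1 ?_⟩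
      · change unc E (x₁, 0) ≤ unc E (X 0, 0)
        rw [e]; exact h₁.le.trans e2.1
      · change unc E (X 0, 0) ≤ unc E (x₂, 0)
        rw [e]; exact e2.2.trans h₂.ge
    have h1 := hg.inv_ge_along_path hXc hX' (M := M) (κ := k) (fun s hs => (hrm hs.1.le).1) htI
    have h2 := hg.inv_le_along_path hXc hX' (M := N) (κ := k) (fun s hs => (hrm hs.1.le).2) htI
    rw [hXt] at h1 h2
    exact abs_le_of_quadratic_bounds ht (inv_pos.2 (hpos0 (X 0))).le
      ((le_abs_self _).trans ((hW _ hX0).trans (le_max_left _ _))) h1 h2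
  have hW0 : 0 ≤ W' := le_max_right _ _
  obtain ⟨e1, e2⟩ := asymptotics_of_bounds hk (a := fun t => ρ x t)
    (c := fun t => unc (ratio ρ u) (x, t)) hw ((eventually_ge_atTop 0).mono fun t ht => by
      obtain ⟨e1, e2⟩ := hrm (x := x) ht
      have e3 := neg_abs_le M
      have e4 := le_abs_self N
      have e5 := abs_nonneg M
      have e6 := abs_nonneg N
      rw [abs_le]; constructor <;> linarith)
  refine ⟨e1, e2.congr_left ?_⟩
  filter_upwards [eventually_ge_atTop 0] with t ht
  rw [h.dx_eq_mul ht]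

end

end ViscousEP

namespace ViscousEP

open scoped Topology ContDiff

/-! ### The algebra of higher derivatives

In mass coordinates the equations take the form below, where `D` is the derivative along particle
paths and `δ` the derivative in the mass coordinate `e`. -/

/-- The equations in mass coordinates, in an abstract algebra with two commuting derivations. -/
structure MassSystem {A : Type*} [CommRing A] [Algebra ℝ A] (k : ℝ) (D δ : Derivation ℝ A A)
    (w a β q u e : A) : Prop where
  comm : ∀ f, D (δ f) = δ (D f)
  w_mul_a : w * a = 1
  D_w : D w = β
  δ_β : δ β = w * q
  D_β : D β = algebraMap ℝ A k + δ q
  D_u : D u = algebraMap ℝ A k * e + q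
  δ_u : δ u = β
  D_e : D e = 0
  δ_e : δ e = 1

section

variable {A : Type*} [CommRing A] [Algebra ℝ A] {k : ℝ} {D δ : Derivation ℝ A A}
  {w a β q u e : A}

/-- The iterated derivatives of `f` up to order `n` lie in `B`. -/
def DerivsIn (B : Subalgebra ℝ A) (δ : Derivation ℝ A A) (n : ℕ) (f : A) : Prop :=
  ∀ i ≤ n, δ^[i] f ∈ B

namespace DerivsIn

variable {B : Subalgebra ℝ A} {n n' : ℕ} {f g : A}

theorem mem (h : DerivsIn B δ n f) : f ∈ B := h 0 n.zero_le

theorem mono (h : DerivsIn B δ n f) (hn : n' ≤ n) : DerivsIn B δ n' f :=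
  fun i hi => h i (hi.trans hn)

theorem zero_iff : DerivsIn B δ 0 f ↔ f ∈ B :=
  ⟨mem, fun h i hi => by rw [Nat.le_zero.1 hi]; exact h⟩

theorem succ_iff : DerivsIn B δ (n + 1) f ↔ f ∈ B ∧ DerivsIn B δ n (δ f) := by
  refine ⟨fun h => ⟨h.mem, fun i hi => ?_⟩, fun h i hi => ?_⟩
  · exact h (i + 1) (by omega)
  · rcases i with _ | i
    · exact h.1
    · exact h.2 i (by omega)

theorem succ_iff' : DerivsIn B δ (n + 1) f ↔ DerivsIn B δ n f ∧ δ^[n + 1] f ∈ B := by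
  refine ⟨fun h => ⟨h.mono n.le_succ, h _ le_rfl⟩, fun h i hi => ?_⟩
  rcases Nat.lt_or_ge i (n + 1) with h1 | h1
  · exact h.1 i (by omega)
  · rw [le_antisymm hi h1]; exact h.2

theorem iterate {i : ℕ} (h : DerivsIn B δ (n + i) f) : DerivsIn B δ n (δ^[i] f) := by
  intro j hj
  rw [← Function.iterate_add_apply]
  exact h (j + i) (by omega)

theorem add : ∀ {n : ℕ} {f g : A}, DerivsIn B δ n f → DerivsIn B δ n g → DerivsIn B δ n (f + g)
  | 0, _, _, hf, hg => zero_iff.2 (B.add_mem hf.mem hg.mem)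
  | n + 1, f, g, hf, hg => by
    rw [succ_iff] at *
    rw [map_add]
    exact ⟨B.add_mem hf.1 hg.1, add hf.2 hg.2⟩

theorem mul : ∀ {n : ℕ} {f g : A}, DerivsIn B δ n f → DerivsIn B δ n g → DerivsIn B δ n (f * g)
  | 0, _, _, hf, hg => zero_iff.2 (B.mul_mem hf.mem hg.mem)
  | n + 1, f, g, hf, hg => by
    have hf' := hf.mono n.le_succ
    have hg' := hg.mono n.le_succ
    rw [succ_iff] at *
    rw [Derivation.leibniz, smul_eq_mul, smul_eq_mul]
    exact ⟨B.mul_mem hf.1 hg.1, add (mul hf' hg.2) (mul hg' hf.2)⟩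

theorem const (c : ℝ) : ∀ n, DerivsIn B δ n (algebraMap ℝ A c)
  | 0 => zero_iff.2 (B.algebraMap_mem c)
  | n + 1 => by
    refine succ_iff.2 ⟨B.algebraMap_mem c, ?_⟩
    rw [Derivation.map_algebraMap, ← map_zero (algebraMap ℝ A)]
    exact const 0 n

theorem neg (h : DerivsIn B δ n f) : DerivsIn B δ n (-f) := by
  have := (const (B := B) (δ := δ) (-1) n).mul h
  simpa using this

theorem natCast_mul (c : ℕ) (h : DerivsIn B δ n f) : DerivsIn B δ n (c * f) := by
  have := (const (B := B) (δ := δ) (c : ℝ) n).mul h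
  simpa using this

theorem one (n : ℕ) : DerivsIn B δ n (1 : A) := by
  simpa using const (B := B) (δ := δ) 1 n

theorem zero (n : ℕ) : DerivsIn B δ n (0 : A) := by
  simpa using const (B := B) (δ := δ) 0 n

end DerivsIn

theorem iterate_derivation_succ (i : ℕ) (f : A) : δ^[i + 1] f = δ (δ^[i] f) :=
  Function.iterate_succ_apply' _ _ _

theorem derivation_natCast_mul (c : ℕ) (f : A) : δ ((c : A) * f) = c * δ f := by
  rw [Derivation.leibniz, Derivation.map_natCast, smul_zero, add_zero, smul_eq_mul]

/-- Zeroth order coefficient in the equation for the `j`-th derivative of the flux. -/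
def zeroCoeff (δ : Derivation ℝ A A) (a β : A) (j : ℕ) : A := (j.choose 2 : A) * δ (δ a) - a * β

/-- Lower order terms in the equation for the `j`-th derivative of the flux. -/
def lowerTerms (δ : Derivation ℝ A A) (a β q : A) : ℕ → A
  | 0 => 0
  | j + 1 => δ (zeroCoeff δ a β j) * δ^[j] q + δ (lowerTerms δ a β q j)

namespace MassSystem

theorem δ_a (h : MassSystem k D δ w a β q u e) : δ a = -(a * a * δ w) := by
  have e1 : δ (w * a) = 0 := by rw [h.w_mul_a, Derivation.map_one_eq_zero]
  rw [Derivation.leibniz, smul_eq_mul, smul_eq_mul] at e1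
  linear_combination a * e1 - δ a * h.w_mul_a

theorem D_a (h : MassSystem k D δ w a β q u e) : D a = -(a * a * β) := by
  have e1 : D (w * a) = 0 := by rw [h.w_mul_a, Derivation.map_one_eq_zero]
  rw [Derivation.leibniz, smul_eq_mul, smul_eq_mul, h.D_w] at e1
  linear_combination a * e1 - D a * h.w_mul_a

/-- Apply `comm` to β: D(wq) = δδq, and multiplication by a = w⁻¹ isolates Dq. -/
theorem D_q (h : MassSystem k D δ w a β q u e) : D q = a * δ (δ q) - a * β * q := by
  have e1 := h.comm β
  rw [h.δ_β, h.D_β, map_add, Derivation.map_algebraMap, zero_add, Derivation.leibniz,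
    smul_eq_mul, smul_eq_mul, h.D_w] at e1
  linear_combination a * e1 - D q * h.w_mul_a

theorem D_iterate (h : MassSystem k D δ w a β q u e) (j : ℕ) (f : A) :
    D (δ^[j] f) = δ^[j] (D f) := by
  induction j with
  | zero => rfl
  | succ j ih => rw [iterate_derivation_succ, h.comm, ih, iterate_derivation_succ]

/-- Each further δ that hits the leading coefficient adds δa to the first order coefficient. When it
hits jδa it adds jδ²a to the zeroth order one, and these sum to the binomial coefficient in
`zeroCoeff`. -/
theorem D_iterate_q (h : MassSystem k D δ w a β q u e) (j : ℕ) :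
    D (δ^[j] q) = a * δ (δ (δ^[j] q)) + j * δ a * δ (δ^[j] q) +
    zeroCoeff δ a β j * δ^[j] q + lowerTerms δ a β q j := by
  induction j with
  | zero => simp [zeroCoeff, lowerTerms, h.D_q]; ring
  | succ j ih =>
    have e2 : zeroCoeff δ a β (j + 1) = zeroCoeff δ a β j + j * δ (δ a) := by
      simp only [zeroCoeff, Nat.choose_succ_succ' j 1, Nat.choose_one_right]
      push_cast; ring
    rw [iterate_derivation_succ, h.comm, ih]
    simp only [map_add, Derivation.leibniz, smul_eq_mul, lowerTerms, e2, Derivation.map_natCast]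
    push_cast
    ring

variable {B : Subalgebra ℝ A}

theorem derivsIn_a (h : MassSystem k D δ w a β q u e) (ha : a ∈ B) :
    ∀ {n : ℕ}, DerivsIn B δ n w → DerivsIn B δ n a
  | 0, _ => DerivsIn.zero_iff.2 ha
  | n + 1, hw => by
    have hn := derivsIn_a h ha (hw.mono n.le_succ)
    refine DerivsIn.succ_iff.2 ⟨ha, ?_⟩
    rw [h.δ_a]
    exact ((hn.mul hn).mul (DerivsIn.succ_iff.1 hw).2).neg

/-- A count of derivatives that closes the induction: δ³a appears in δ of `zeroCoeff` only with a
factor `j.choose 2`, which is 0 for j < 2. So at most n + 1 derivatives of a and β and n of q occur.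
-/
theorem derivsIn_lowerTerms {n : ℕ} (ha : DerivsIn B δ (n + 1) a) (hβ : DerivsIn B δ (n + 1) β)
    (hq : DerivsIn B δ n q) (j : ℕ) :
    ∀ i, i + j = n + 1 → DerivsIn B δ i (lowerTerms δ a β q j) := by
  induction j with
  | zero => exact fun i _ => DerivsIn.zero i
  | succ j ih =>
    intro i hij
    refine DerivsIn.add (DerivsIn.mul ?_ ?_) (DerivsIn.succ_iff.1 (ih (i + 1) (by omega))).2
    · have e : δ (zeroCoeff δ a β j) = (j.choose 2 : A) * δ^[3] a + -δ (a * β) := by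
        rw [zeroCoeff, map_sub, derivation_natCast_mul, sub_eq_add_neg]
        rfl
      rw [e]
      refine DerivsIn.add ?_ ?_
      · rcases Nat.lt_or_ge j 2 with hj | hj
        · rw [Nat.choose_eq_zero_of_lt hj, Nat.cast_zero, zero_mul]; exact DerivsIn.zero i
        · exact ((ha.mono (by omega : i + 3 ≤ n + 1)).iterate).natCast_mul _
      · exact (DerivsIn.succ_iff.1 ((ha.mul hβ).mono (by omega : i + 1 ≤ n + 1))).2.neg
    · exact (hq.mono (by omega : i + j ≤ n)).iterate

theorem zeroCoeff_mem {j n : ℕ} (hjn : j ≤ n) (ha : DerivsIn B δ n a) (hβ : β ∈ B) :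
    zeroCoeff δ a β j ∈ B := by
  refine B.sub_mem ?_ (B.mul_mem ha.mem hβ)
  rcases Nat.lt_or_ge j 2 with hj | hj
  · rw [Nat.choose_eq_zero_of_lt hj, Nat.cast_zero, zero_mul]; exact B.zero_mem
  · exact B.mul_mem (natCast_mem B _) (ha 2 (by omega))

/-- Boundedness of all derivatives in the mass coordinate, from transport estimates and an
estimate for the first derivative of solutions of linear parabolic equations. -/
theorem derivsIn_all (h : MassSystem k D δ w a β q u e) (hw : w ∈ B) (ha : a ∈ B) (hβ : β ∈ B)
    (hq : q ∈ B)
    (transport : ∀ f, D f ∈ B → f ∈ B)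
    (parabolic : ∀ f c₀ c₁ d₀ d₁ d₂, f ∈ B → c₀ ∈ B → c₁ ∈ B → d₀ ∈ B → d₁ ∈ B → d₂ ∈ B →
      D f = a * δ (δ f) + c₁ * δ f + c₀ →
      D (δ f) = a * δ (δ (δ f)) + d₂ * δ (δ f) + d₁ * δ f + d₀ → δ f ∈ B) (n : ℕ) :
    DerivsIn B δ n q ∧ DerivsIn B δ (n + 1) w ∧ DerivsIn B δ (n + 1) a ∧
      DerivsIn B δ (n + 1) β := by
  induction n with
  | zero =>
    -- The bound on q gives δβ; then D(δw) = δβ gives δw by transport, and δa is algebraic in δw.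
    have hδβ : δ β ∈ B := by rw [h.δ_β]; exact B.mul_mem hw hq
    have hw1 : DerivsIn B δ 1 w := by
      refine DerivsIn.succ_iff.2 ⟨hw, DerivsIn.zero_iff.2 (transport _ ?_)⟩
      rw [h.comm, h.D_w]; exact hδβ
    exact ⟨DerivsIn.zero_iff.2 hq, hw1, h.derivsIn_a ha hw1,
      DerivsIn.succ_iff.2 ⟨hβ, DerivsIn.zero_iff.2 hδβ⟩⟩
  | succ n ih =>
    obtain ⟨iq, iw, ia, iβ⟩ := ih
    have ha1 : δ a ∈ B := ia 1 (by omega)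
    -- The equation of order n provides the bounded function, the one of order n + 1 the equation of
    -- its derivative; all coefficients are covered by the induction hypothesis.
    have hqn : δ^[n + 1] q ∈ B := by
      rw [iterate_derivation_succ]
      refine parabolic (δ^[n] q) (zeroCoeff δ a β n * δ^[n] q + lowerTerms δ a β q n) (n * δ a)
        (lowerTerms δ a β q (n + 1)) (zeroCoeff δ a β (n + 1)) ((n + 1 : ℕ) * δ a)
        (iq n le_rfl) ?_ ?_ ?_ ?_ ?_ ?_ ?_
      · refine B.add_mem (B.mul_mem (zeroCoeff_mem (by omega : n ≤ n + 1) ia hβ) (iq n le_rfl)) ?_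
        exact (derivsIn_lowerTerms ia iβ iq n 1 (by omega)).mem
      · exact B.mul_mem (natCast_mem B _) ha1
      · exact (derivsIn_lowerTerms ia iβ iq (n + 1) 0 (by omega)).mem
      · exact zeroCoeff_mem le_rfl ia hβ
      · exact B.mul_mem (natCast_mem B _) ha1
      · rw [h.D_iterate_q]; ring
      · rw [← iterate_derivation_succ, h.D_iterate_q]
    have jq : DerivsIn B δ (n + 1) q := DerivsIn.succ_iff'.2 ⟨iq, hqn⟩
    have jβ : DerivsIn B δ (n + 2) β := by
      refine DerivsIn.succ_iff.2 ⟨hβ, ?_⟩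
      rw [h.δ_β]; exact iw.mul jq
    have jw : DerivsIn B δ (n + 2) w := by
      refine DerivsIn.succ_iff'.2 ⟨iw, transport _ ?_⟩
      rw [h.D_iterate, h.D_w]
      exact jβ _ le_rfl
    exact ⟨jq, jw, h.derivsIn_a ha jw, jβ⟩

end MassSystem

/-- The elements obtained from the unknowns by algebraic operations and differentiation in the
mass coordinate. -/
inductive Generated (δ : Derivation ℝ A A) (w a β q u e : A) : A → Prop
  | w : Generated δ w a β q u e w
  | a : Generated δ w a β q u e a
  | β : Generated δ w a β q u e β
  | q : Generated δ w a β q u e q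
  | u : Generated δ w a β q u e u
  | e : Generated δ w a β q u e e
  | const (c : ℝ) : Generated δ w a β q u e (algebraMap ℝ A c)
  | add {f g : A} : Generated δ w a β q u e f → Generated δ w a β q u e g →
      Generated δ w a β q u e (f + g)
  | mul {f g : A} : Generated δ w a β q u e f → Generated δ w a β q u e g →
      Generated δ w a β q u e (f * g)
  | deriv {f : A} : Generated δ w a β q u e f → Generated δ w a β q u e (δ f)

namespace Generated

variable {f : A}

theorem neg (hf : Generated δ w a β q u e f) : Generated δ w a β q u e (-f) := by
  have := (const (δ := δ) (w := w) (a := a) (β := β) (q := q) (u := u) (e := e) (-1)).mul hf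
  simpa using this

/-- The equations express D of each unknown through the unknowns and their δ-derivatives, and D
commutes with δ. Hence derivatives along paths create nothing new. -/
theorem deriv_path (h : MassSystem k D δ w a β q u e) (hf : Generated δ w a β q u e f) :
    Generated δ w a β q u e (D f) := by
  induction hf with
  | w => rw [h.D_w]; exact .β
  | a => rw [h.D_a]; exact ((Generated.a.mul .a).mul .β).neg
  | β => rw [h.D_β]; exact (const k).add Generated.q.deriv
  | q => rw [h.D_q, sub_eq_add_neg]
         exact (Generated.a.mul Generated.q.deriv.deriv).add ((Generated.a.mul .β).mul .q).neg
  | u => rw [h.D_u]; exact ((const k).mul .e).add .q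
  | e => rw [h.D_e, ← map_zero (algebraMap ℝ A)]; exact const 0
  | const c => rw [Derivation.map_algebraMap, ← map_zero (algebraMap ℝ A)]; exact const 0
  | add _ _ h1 h2 => rw [map_add]; exact h1.add h2
  | mul f1 f2 h1 h2 => rw [Derivation.leibniz, smul_eq_mul, smul_eq_mul]
                       exact (f1.mul h2).add (f2.mul h1)
  | deriv _ h1 => rw [h.comm]; exact h1.deriv

theorem derivsIn {B : Subalgebra ℝ A} (h : MassSystem k D δ w a β q u e)
    (hall : ∀ n, DerivsIn B δ n q ∧ DerivsIn B δ (n + 1) w ∧ DerivsIn B δ (n + 1) a ∧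
      DerivsIn B δ (n + 1) β) (hu : u ∈ B) (he : e ∈ B) (hf : Generated δ w a β q u e f) :
    ∀ n, DerivsIn B δ n f := by
  induction hf with
  | w => exact fun n => (hall n).2.1.mono n.le_succ
  | a => exact fun n => (hall n).2.2.1.mono n.le_succ
  | β => exact fun n => (hall n).2.2.2.mono n.le_succ
  | q => exact fun n => (hall n).1
  | u =>
    intro n
    refine DerivsIn.mono (DerivsIn.succ_iff.2 ⟨hu, ?_⟩) n.le_succ
    rw [h.δ_u]; exact (hall n).2.2.2.mono n.le_succ
  | e =>
    intro n
    refine DerivsIn.mono (DerivsIn.succ_iff.2 ⟨he, ?_⟩) n.le_succ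
    rw [h.δ_e]; exact DerivsIn.one n
  | const c => exact fun n => DerivsIn.const c n
  | add _ _ h1 h2 => exact fun n => (h1 n).add (h2 n)
  | mul _ _ h1 h2 => exact fun n => (h1 n).mul (h2 n)
  | deriv _ h1 => exact fun n => (DerivsIn.succ_iff.1 (h1 (n + 1))).2

end Generated

end

end ViscousEP

namespace ViscousEP

open scoped Topology ContDiff

/-! ### Smooth functions on the strip -/

/-- The algebra of smooth functions on the open strip. -/
def smoothAlg (T : ℝ) : Subalgebra ℝ (strip T → ℝ) where
  carrier := {f | ∃ F : ℝ × ℝ → ℝ, ContDiffOn ℝ ∞ F (strip T) ∧ ∀ p : strip T, F p = f p}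
  mul_mem' := by
    rintro f g ⟨F, hF, hf⟩ ⟨G, hG, hg⟩
    exact ⟨fun p => F p * G p, hF.mul hG, fun p => by simp [hf, hg]⟩
  add_mem' := by
    rintro f g ⟨F, hF, hf⟩ ⟨G, hG, hg⟩
    exact ⟨fun p => F p + G p, hF.add hG, fun p => by simp [hf, hg]⟩
  algebraMap_mem' c := ⟨fun _ => c, contDiffOn_const, fun _ => rfl⟩

namespace smoothAlg

variable {T : ℝ}

/-- An extension of a smooth function on the strip to the plane. -/
noncomputable def ext (f : smoothAlg T) : ℝ × ℝ → ℝ := Classical.choose f.2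

theorem contDiffOn_ext (f : smoothAlg T) : ContDiffOn ℝ ∞ (ext f) (strip T) :=
  (Classical.choose_spec f.2).1

theorem ext_apply (f : smoothAlg T) (p : strip T) : ext f p = f.1 p :=
  (Classical.choose_spec f.2).2 p

theorem ext_apply' (f : smoothAlg T) {p : ℝ × ℝ} (hp : p ∈ strip T) : ext f p = f.1 ⟨p, hp⟩ :=
  ext_apply f ⟨p, hp⟩

theorem differentiableAt_ext (f : smoothAlg T) {p : ℝ × ℝ} (hp : p ∈ strip T) :
    DifferentiableAt ℝ (ext f) p :=
  ((contDiffOn_ext f).contDiffAt (strip_mem_nhds hp)).differentiableAt (by simp)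

theorem eventuallyEq_ext (f : smoothAlg T) {F : ℝ × ℝ → ℝ} (hF : ∀ p : strip T, F p = f.1 p)
    {p : ℝ × ℝ} (hp : p ∈ strip T) : ext f =ᶠ[𝓝 p] F := by
  filter_upwards [strip_mem_nhds hp] with q hq
  rw [ext_apply' f hq, ← hF ⟨q, hq⟩]

theorem continuous (f : smoothAlg T) : Continuous f.1 := by
  have := (contDiffOn_ext f).continuousOn.domRestrict
  refine this.congr fun p => ?_
  exact ext_apply f p

/-- The restriction of a function to the strip. -/
def lift (F : ℝ × ℝ → ℝ) (hF : ContDiffOn ℝ ∞ F (strip T)) : smoothAlg T :=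
  ⟨fun p => F p, F, hF, fun _ => rfl⟩

theorem contDiffOn_fderiv_ext (f : smoothAlg T) (d : ℝ × ℝ) :
    ContDiffOn ℝ ∞ (fun p => fderiv ℝ (ext f) p d) (strip T) :=
  ((contDiffOn_ext f).fderiv_of_isOpen (isOpen_strip T) (by simp)).clm_apply contDiffOn_const

/-- The derivative in a fixed direction, as a derivation. -/
noncomputable def dir (T : ℝ) (d : ℝ × ℝ) : Derivation ℝ (smoothAlg T) (smoothAlg T) :=
  Derivation.mk'
    { toFun := fun f => lift (fun p => fderiv ℝ (ext f) p d) (contDiffOn_fderiv_ext f d)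
      map_add' := fun f g => by
        refine Subtype.ext (funext fun p => ?_)
        change fderiv ℝ (ext (f + g)) p d = fderiv ℝ (ext f) p d + fderiv ℝ (ext g) p d
        have e := eventuallyEq_ext (f + g) (F := fun q => ext f q + ext g q)
          (fun q => by rw [ext_apply, ext_apply]; rfl) p.2
        rw [e.fderiv_eq, fderiv_fun_add (differentiableAt_ext f p.2) (differentiableAt_ext g p.2)]
        rfl
      map_smul' := fun c f => by
        refine Subtype.ext (funext fun p => ?_)
        change fderiv ℝ (ext (c • f)) p d = c * fderiv ℝ (ext f) p d
        have e := eventuallyEq_ext (c • f) (F := fun q => c * ext f q)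
          (fun q => by rw [ext_apply]; rfl) p.2
        rw [e.fderiv_eq, fderiv_const_mul (differentiableAt_ext f p.2)]
        rfl }
    (fun f g => by
      refine Subtype.ext (funext fun p => ?_)
      change fderiv ℝ (ext (f * g)) p d =
        f.1 p * fderiv ℝ (ext g) p d + g.1 p * fderiv ℝ (ext f) p d
      have e := eventuallyEq_ext (f * g) (F := fun q => ext f q * ext g q)
        (fun q => by rw [ext_apply, ext_apply]; rfl) p.2
      rw [e.fderiv_eq, fderiv_fun_mul (differentiableAt_ext f p.2) (differentiableAt_ext g p.2),
        ← ext_apply f, ← ext_apply g]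
      rfl)

/-- The spatial derivative. -/
noncomputable abbrev dX (T : ℝ) : Derivation ℝ (smoothAlg T) (smoothAlg T) := dir T (1, 0)

/-- The time derivative. -/
noncomputable abbrev dT (T : ℝ) : Derivation ℝ (smoothAlg T) (smoothAlg T) := dir T (0, 1)

theorem dX_apply (f : smoothAlg T) (p : strip T) : (dX T f).1 p = px (ext f) p := rfl

theorem dT_apply (f : smoothAlg T) (p : strip T) : (dT T f).1 p = pt (ext f) p := rfl

theorem ext_dX (f : smoothAlg T) {p : ℝ × ℝ} (hp : p ∈ strip T) :
    ext (dX T f) =ᶠ[𝓝 p] px (ext f) := eventuallyEq_ext _ (fun q => (dX_apply f q).symm) hp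

theorem ext_dT (f : smoothAlg T) {p : ℝ × ℝ} (hp : p ∈ strip T) :
    ext (dT T f) =ᶠ[𝓝 p] pt (ext f) := eventuallyEq_ext _ (fun q => (dT_apply f q).symm) hp

theorem dX_dT_comm (f : smoothAlg T) : dX T (dT T f) = dT T (dX T f) := by
  refine Subtype.ext (funext fun p => ?_)
  rw [dX_apply, dT_apply, px_congr (ext_dT f p.2), pt_congr (ext_dX f p.2)]
  exact px_pt_comm (((contDiffOn_ext f).contDiffAt (strip_mem_nhds p.2)).of_le (by norm_cast))

theorem dX_lift {F : ℝ × ℝ → ℝ} (hF : ContDiffOn ℝ ∞ F (strip T)) (p : strip T) :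
    (dX T (lift F hF)).1 p = px F p :=
  px_congr (eventuallyEq_ext (lift F hF) (fun _ => rfl) p.2)

theorem dT_lift {F : ℝ × ℝ → ℝ} (hF : ContDiffOn ℝ ∞ F (strip T)) (p : strip T) :
    (dT T (lift F hF)).1 p = pt F p :=
  pt_congr (eventuallyEq_ext (lift F hF) (fun _ => rfl) p.2)

/-- Differentiation along particle paths. -/
noncomputable def pathD (u : smoothAlg T) : Derivation ℝ (smoothAlg T) (smoothAlg T) :=
  dT T + u • dX T

/-- Differentiation in the mass coordinate. -/
noncomputable def massD (w : smoothAlg T) : Derivation ℝ (smoothAlg T) (smoothAlg T) := w • dX T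

theorem pathD_apply (u f : smoothAlg T) : pathD u f = dT T f + u * dX T f := rfl

theorem massD_apply (w f : smoothAlg T) : massD w f = w * dX T f := rfl

/-- The commutator is (Dw - δu)∂ₓ; its vanishing is conservation of mass. -/
theorem pathD_massD_comm {u w : smoothAlg T} (h : pathD u w = massD w u) (f : smoothAlg T) :
    pathD u (massD w f) = massD w (pathD u f) := by
  simp only [pathD_apply, massD_apply, Derivation.leibniz, smul_eq_mul, map_add, dX_dT_comm]
    at h ⊢
  linear_combination dX T f * h

/-- The time coordinate. -/
def time (T : ℝ) : smoothAlg T := lift (fun p => p.2) contDiff_snd.contDiffOn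

theorem dX_time : dX T (time T) = 0 := by
  refine Subtype.ext (funext fun p => ?_)
  rw [time, dX_lift, px, fderiv_snd]; rfl

theorem dT_time : dT T (time T) = 1 := by
  refine Subtype.ext (funext fun p => ?_)
  rw [time, dT_lift, pt, fderiv_snd]; rfl

/-- First and second order conditions at a maximum over the past. -/
theorem max_conditions {G u w : smoothAlg T} {p : strip T}
    (hmax : ∀ᶠ q in 𝓝 p, q.1.2 ≤ p.1.2 → G.1 q ≤ G.1 p) :
    (massD w G).1 p = 0 ∧ (massD w (massD w G)).1 p ≤ 0 ∧ 0 ≤ (pathD u G).1 p := by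
  have hN := strip_mem_nhds p.2
  have hmax' : ∀ᶠ q in 𝓝 (p : ℝ × ℝ), q.2 ≤ p.1.2 → ext G q ≤ ext G p := by
    have h1 : ∀ᶠ q in 𝓝[strip T] (p : ℝ × ℝ), q.2 ≤ p.1.2 → ext G q ≤ ext G p := by
      rw [← eventually_nhds_subtype_iff (strip T) p fun q => q.2 ≤ p.1.2 → ext G q ≤ ext G p]
      simpa only [ext_apply] using hmax
    rwa [nhdsWithin_eq_nhds.2 hN] at h1
  have hs := contDiffOn_ext G
  have hline : ∀ᶠ y in 𝓝 p.1.1, (y, p.1.2) ∈ strip T :=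
    Eventually.of_forall fun y => mem_strip.2 (mem_strip.1 p.2)
  obtain ⟨e1, e2, e3⟩ := parabolic_max_conditions (F := ext G) (x := p.1.1) (t := p.1.2) hmax'
    (hline.mono fun y hy => hasDerivAt_px (differentiableAt_ext G hy))
    (hasDerivAt_px_px (hs.of_le (by norm_cast)) p.2) (hasDerivAt_pt (differentiableAt_ext G p.2))
  have hX : (dX T G).1 p = 0 := e1
  have hXX : (dX T (dX T G)).1 p ≤ 0 := by
    rw [dX_apply, px_congr (ext_dX G p.2)]; exact e2
  have hTt : 0 ≤ (dT T G).1 p := e3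
  refine ⟨?_, ?_, ?_⟩
  · change w.1 p * (dX T G).1 p = 0
    rw [hX, mul_zero]
  -- The term in which w is differentiated carries the factor ∂ₓG, which vanishes at the maximum.
  · have : (massD w (massD w G)).1 p =
        w.1 p * (w.1 p * (dX T (dX T G)).1 p + (dX T G).1 p * (dX T w).1 p) := by
      have e : massD w (massD w G) = w * (w * dX T (dX T G) + dX T G * dX T w) := by
        simp only [massD_apply, Derivation.leibniz, smul_eq_mul]
        ring
      rw [e]; rfl
    rw [this, hX, zero_mul, add_zero, ← mul_assoc]
    exact mul_nonpos_of_nonneg_of_nonpos (mul_self_nonneg _) hXX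
  · change 0 ≤ (dT T G).1 p + u.1 p * (dX T G).1 p
    rw [hX, mul_zero, add_zero]; exact hTt

end smoothAlg

end ViscousEP

namespace ViscousEP

open scoped Topology ContDiff

/-! ### Estimates on bands of particle paths -/

namespace smoothAlg

variable {T H : ℝ} {e w u : smoothAlg T}

/-- The part of the strip between the particle paths with labels `±η` and the times `t₀`, `t₁`. -/
def band (e : smoothAlg T) (η t₀ t₁ : ℝ) : Set (strip T) :=
  {p | |e.1 p| ≤ η ∧ p.1.2 ∈ Icc t₀ t₁}

/-- `e` is a mass coordinate, constant on particle paths, with compact bands. -/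
structure IsLabel (H : ℝ) (u w e : smoothAlg T) : Prop where
  compact : ∀ η < H, ∀ t₀ t₁, 0 < t₀ → t₁ < T → IsCompact (band e η t₀ t₁)
  path : pathD u e = 0
  mass : massD w e = 1

/-- Compactness of the band provides a maximum: it lies on the initial face, on an edge |e| = η, or
at a point where the parabolic first and second order conditions hold. -/
theorem IsLabel.le_of_band (h : IsLabel H u w e) {G : smoothAlg T} {η t₀ t₁ c : ℝ} (hη : η < H)
    (ht₀ : 0 < t₀) (ht₁ : t₁ < T)
    (hinit : ∀ p : strip T, |e.1 p| ≤ η → p.1.2 = t₀ → G.1 p ≤ c)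
    (hside : ∀ p ∈ band e η t₀ t₁, |e.1 p| = η → G.1 p ≤ c)
    (hint : ∀ p ∈ band e η t₀ t₁, (massD w G).1 p = 0 → (massD w (massD w G)).1 p ≤ 0 →
      0 ≤ (pathD u G).1 p → G.1 p ≤ c) {p : strip T} (hp : p ∈ band e η t₀ t₁) : G.1 p ≤ c := by
  obtain ⟨z, hz, hmax⟩ := (h.compact η hη t₀ t₁ ht₀ ht₁).exists_isMaxOn ⟨p, hp⟩
    (continuous G).continuousOn
  refine (hmax hp).trans ?_
  rcases hz.1.lt_or_eq with h1 | h1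
  swap
  · exact hside z hz h1
  rcases hz.2.1.lt_or_eq with h2 | h2
  swap
  · exact hinit z hz.1 h2.symm
  have hloc : ∀ᶠ q in 𝓝 z, q.1.2 ≤ z.1.2 → G.1 q ≤ G.1 z := by
    have e1 : ∀ᶠ q in 𝓝 z, |e.1 q| < η :=
      (continuous e).abs.continuousAt.eventually (gt_mem_nhds h1)
    have e2 : ∀ᶠ q : strip T in 𝓝 z, t₀ < q.1.2 :=
      (continuous_snd.comp continuous_subtype_val).continuousAt.eventually (lt_mem_nhds h2)
    filter_upwards [e1, e2] with q h1 h2 h3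
    exact hmax ⟨h1.le, h2.le, h3.trans hz.2.2⟩
  obtain ⟨c1, c2, c3⟩ := max_conditions (u := u) (w := w) hloc
  exact hint z hz c1 c2 c3

/-- The cut-off function of a band. -/
noncomputable def cutoff (e : smoothAlg T) (η : ℝ) : smoothAlg T :=
  algebraMap ℝ (smoothAlg T) (η ^ 2) - e * e

theorem cutoff_apply (η : ℝ) (p : strip T) : (cutoff e η).1 p = η ^ 2 - e.1 p ^ 2 := by
  change η ^ 2 - e.1 p * e.1 p = _
  ring

theorem cutoff_nonneg {η : ℝ} {p : strip T} (hp : |e.1 p| ≤ η) : 0 ≤ (cutoff e η).1 p := by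
  rw [cutoff_apply]
  have := sq_le_sq' (abs_le.1 hp).1 (abs_le.1 hp).2
  linarith

theorem cutoff_eq_zero {η : ℝ} {p : strip T} (hp : |e.1 p| = η) : (cutoff e η).1 p = 0 := by
  rw [cutoff_apply, ← sq_abs (e.1 p), hp, sub_self]

theorem cutoff_le (η : ℝ) (p : strip T) : (cutoff e η).1 p ≤ η ^ 2 := by
  rw [cutoff_apply]; nlinarith [sq_nonneg (e.1 p)]

theorem IsLabel.pathD_cutoff (h : IsLabel H u w e) (η : ℝ) : pathD u (cutoff e η) = 0 := by
  rw [cutoff, map_sub, Derivation.map_algebraMap, Derivation.leibniz, h.path]; simp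

theorem IsLabel.massD_cutoff (h : IsLabel H u w e) (η : ℝ) : massD w (cutoff e η) = -(2 * e) := by
  rw [cutoff, map_sub, Derivation.map_algebraMap, Derivation.leibniz, h.mass]; simp; ring

theorem pathD_time : pathD u (time T) = 1 := by rw [pathD_apply, dX_time, dT_time]; simp

/-- Since Dζ = 0, subtracting (A + 1)(t - t₀) from ζf makes D of the result negative, so no maximum
is interior. Only ζ·Df needs a bound, which is the form available inside the Bernstein argument. -/
theorem IsLabel.transport_le (h : IsLabel H u w e) {f : smoothAlg T} {η t₀ t₁ A B : ℝ} (hη : η < H)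
    (ht₀ : 0 < t₀) (ht₁ : t₁ < T) (hA : 0 ≤ A)
    (hD : ∀ p ∈ band e η t₀ t₁, (cutoff e η).1 p * (pathD u f).1 p ≤ A) (hB : 0 ≤ B)
    (hinit : ∀ p : strip T, |e.1 p| ≤ η → p.1.2 = t₀ → (cutoff e η).1 p * f.1 p ≤ B)
    {p : strip T} (hp : p ∈ band e η t₀ t₁) :
    (cutoff e η).1 p * f.1 p ≤ B + (A + 1) * (t₁ - t₀) := by
  set ζ := cutoff e η
  have hval : ∀ q : strip T, (ζ * f - algebraMap ℝ (smoothAlg T) (A + 1) *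
      (time T - algebraMap ℝ (smoothAlg T) t₀)).1 q = ζ.1 q * f.1 q - (A + 1) * (q.1.2 - t₀) :=
    fun q => rfl
  have key := h.le_of_band (G := ζ * f - algebraMap ℝ (smoothAlg T) (A + 1) *
    (time T - algebraMap ℝ (smoothAlg T) t₀)) (c := B) hη ht₀ ht₁ ?_ ?_ ?_ hp
  · rw [hval] at key
    have : (A + 1) * (p.1.2 - t₀) ≤ (A + 1) * (t₁ - t₀) := by gcongr; exact hp.2.2
    linarith
  · intro q hq hqt
    rw [hval, hqt]
    linarith [hinit q hq hqt]
  · intro q hq hqe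
    rw [hval, cutoff_eq_zero hqe]
    have : 0 ≤ (A + 1) * (q.1.2 - t₀) := mul_nonneg (by linarith) (by linarith [hq.2.1])
    linarith
  · intro q hq _ _ h3
    exfalso
    have e1 : pathD u (ζ * f - algebraMap ℝ (smoothAlg T) (A + 1) *
        (time T - algebraMap ℝ (smoothAlg T) t₀)) =
        ζ * pathD u f - algebraMap ℝ (smoothAlg T) (A + 1) := by
      simp only [map_sub, Derivation.leibniz, Derivation.map_algebraMap, smul_eq_mul, pathD_time, ζ,
        h.pathD_cutoff]
      ring
    rw [e1] at h3
    have h4 : 0 ≤ ζ.1 q * (pathD u f).1 q - (A + 1) := h3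
    linarith [hD q hq]

theorem IsLabel.abs_transport_le (h : IsLabel H u w e) {f : smoothAlg T} {η t₀ t₁ A B : ℝ}
    (hη : η < H) (ht₀ : 0 < t₀) (ht₁ : t₁ < T) (hA : 0 ≤ A)
    (hD : ∀ p ∈ band e η t₀ t₁, (cutoff e η).1 p * |(pathD u f).1 p| ≤ A) (hB : 0 ≤ B)
    (hinit : ∀ p : strip T, |e.1 p| ≤ η → p.1.2 = t₀ → (cutoff e η).1 p * |f.1 p| ≤ B)
    {p : strip T} (hp : p ∈ band e η t₀ t₁) :
    (cutoff e η).1 p * |f.1 p| ≤ B + (A + 1) * (t₁ - t₀) := by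
  have h1 := h.transport_le (f := f) hη ht₀ ht₁ hA (fun q hq =>
    (mul_le_mul_of_nonneg_left (le_abs_self _) (cutoff_nonneg hq.1)).trans (hD q hq)) hB
    (fun q hq hqt => (mul_le_mul_of_nonneg_left (le_abs_self _) (cutoff_nonneg hq)).trans
      (hinit q hq hqt)) hp
  have h2 := h.transport_le (f := -f) hη ht₀ ht₁ hA (fun q hq => by
    rw [map_neg]
    exact (mul_le_mul_of_nonneg_left (neg_le_abs _) (cutoff_nonneg hq.1)).trans (hD q hq)) hB
    (fun q hq hqt => (mul_le_mul_of_nonneg_left (neg_le_abs _) (cutoff_nonneg hq)).trans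
      (hinit q hq hqt)) hp
  rcases abs_cases (f.1 p) with hc | hc
  · rw [hc.1]; exact h1
  · rw [hc.1]; exact h2

/-- The pointwise inequality behind the gradient estimate. Here `ζ` is a cut-off, `g` the quantity
to be estimated, `s` stands for `ζ` times its derivative. -/
theorem gradient_inequality {A Z E₀ ζ g dg f c₀ c₁ d₀ d₁ d₂ a h ε lam : ℝ} (hA : 1 ≤ A)
    (hζ0 : 0 ≤ ζ) (hζ : ζ ≤ Z) (hε : |ε| ≤ E₀) (hf : |f| ≤ A) (hc₀ : |c₀| ≤ A) (hd₀ : |d₀| ≤ A)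
    (hd₁ : |d₁| ≤ A) (hd₂ : |d₂| ≤ A) (ha : a ≤ A) (ha' : A⁻¹ ≤ a) (hh : A⁻¹ ≤ h)
    (hlam : lam = A ^ 3 * (3 * Z ^ 2 * A + 4 * A * Z + (2 * Z * A + 16 * A * E₀) ^ 2 * A / 8 + 1))
    (hL : 0 ≤ 2 * ζ ^ 2 * g * (d₂ * dg + d₁ * g + d₀) + 2 * lam * f * (c₁ * g + c₀) -
      a * (8 * ε ^ 2 * g ^ 2 - 4 * ζ * g ^ 2 - 16 * ζ * ε * g * dg + 2 * ζ ^ 2 * dg ^ 2 +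
        2 * lam * h ^ 2 * g ^ 2)) :
    g ^ 2 ≤ Z ^ 2 * A + lam * (A ^ 5 * c₁ ^ 2 + 2 * A ^ 2) := by
  have hA0 : 0 < A := by linarith
  have hAi : 0 < A⁻¹ := inv_pos.2 hA0
  have ha0 : 0 < a := hAi.trans_le ha'
  have hZ : 0 ≤ Z := hζ0.trans hζ
  have hE0 : 0 ≤ E₀ := (abs_nonneg _).trans hε
  -- The total coefficient of the cross terms |g|s, to be absorbed by the good term in s².
  set C₂ := 2 * Z * A + 16 * A * E₀
  have hC₂ : 0 ≤ C₂ := by positivity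
  have hlam0 : 0 ≤ lam := by rw [hlam]; positivity
  set s := ζ * |dg|
  have hs : 0 ≤ s := by positivity
  have g2 := sq_nonneg g
  have gabs : |g| ^ 2 = g ^ 2 := sq_abs g
  have t1 : 2 * ζ ^ 2 * g * (d₂ * dg) ≤ 2 * Z * A * (|g| * s) := by
    have : 2 * ζ ^ 2 * g * (d₂ * dg) ≤ |2 * ζ ^ 2 * g * (d₂ * dg)| := le_abs_self _
    refine this.trans ?_
    have e : |2 * ζ ^ 2 * g * (d₂ * dg)| = 2 * ζ * |d₂| * (|g| * s) := by
      simp only [abs_mul, abs_pow, abs_two, abs_of_nonneg hζ0, s]; ring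
    rw [e]; gcongr
  have t2 : 2 * ζ ^ 2 * g * (d₁ * g) ≤ 2 * Z ^ 2 * A * g ^ 2 := by
    have e : 2 * ζ ^ 2 * g * (d₁ * g) = 2 * ζ ^ 2 * d₁ * g ^ 2 := by ring
    rw [e]
    have : d₁ ≤ A := (le_abs_self _).trans hd₁
    calc 2 * ζ ^ 2 * d₁ * g ^ 2 ≤ 2 * ζ ^ 2 * A * g ^ 2 := by gcongr
      _ ≤ _ := by gcongr
  have t3 : 2 * ζ ^ 2 * g * d₀ ≤ Z ^ 2 * A + Z ^ 2 * A * g ^ 2 := by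
    have e1 : 2 * (g * d₀) ≤ A + A * g ^ 2 := by
      have h1 : g * d₀ ≤ |g| * A := by
        refine (le_abs_self _).trans ?_
        rw [abs_mul]; gcongr
      have h2 : 0 ≤ A * (1 - |g|) ^ 2 := by positivity
      nlinarith
    have e2 : ζ ^ 2 ≤ Z ^ 2 := by gcongr
    have e3 : 0 ≤ A + A * g ^ 2 := by positivity
    calc 2 * ζ ^ 2 * g * d₀ = ζ ^ 2 * (2 * (g * d₀)) := by ring
      _ ≤ ζ ^ 2 * (A + A * g ^ 2) := by gcongr
      _ ≤ Z ^ 2 * (A + A * g ^ 2) := by gcongr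
      _ = _ := by ring
  have t4 : a * (4 * ζ * g ^ 2) ≤ 4 * A * Z * g ^ 2 := by
    calc a * (4 * ζ * g ^ 2) ≤ A * (4 * Z * g ^ 2) := by gcongr
      _ = _ := by ring
  have t5 : a * (16 * ζ * ε * g * dg) ≤ 16 * A * E₀ * (|g| * s) := by
    refine (le_abs_self _).trans ?_
    have e : |a * (16 * ζ * ε * g * dg)| = 16 * a * |ε| * (|g| * s) := by
      simp only [abs_mul, abs_of_nonneg hζ0, abs_of_pos ha0, s]
      rw [abs_of_pos (by norm_num : (0 : ℝ) < 16)]; ring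
    rw [e]; gcongr
  have t6 : 2 * A⁻¹ * s ^ 2 ≤ a * (2 * ζ ^ 2 * dg ^ 2) := by
    have e : s ^ 2 = ζ ^ 2 * dg ^ 2 := by simp only [s, mul_pow, sq_abs]
    rw [e]
    calc 2 * A⁻¹ * (ζ ^ 2 * dg ^ 2) ≤ 2 * a * (ζ ^ 2 * dg ^ 2) := by gcongr
      _ = _ := by ring
  have t7 : C₂ * (|g| * s) - 2 * A⁻¹ * s ^ 2 ≤ C₂ ^ 2 * A / 8 * g ^ 2 := by
    have e : C₂ ^ 2 * A / 8 * g ^ 2 - (C₂ * (|g| * s) - 2 * A⁻¹ * s ^ 2) =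
        2 * A⁻¹ * (C₂ * A / 4 * |g| - s) ^ 2 := by
      rw [← gabs]; field_simp; ring
    have : 0 ≤ 2 * A⁻¹ * (C₂ * A / 4 * |g| - s) ^ 2 := by positivity
    linarith
  have t8 : A⁻¹ ^ 3 * g ^ 2 ≤ a * (h ^ 2 * g ^ 2) := by
    calc A⁻¹ ^ 3 * g ^ 2 = A⁻¹ * (A⁻¹ ^ 2 * g ^ 2) := by ring
      _ ≤ a * (h ^ 2 * g ^ 2) := by gcongr
  have t9 : 2 * f * (c₁ * g + c₀) ≤ A⁻¹ ^ 3 * g ^ 2 + A ^ 5 * c₁ ^ 2 + 2 * A ^ 2 := by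
    have e1 : 2 * f * (c₁ * g) ≤ 2 * A * (|c₁| * |g|) := by
      refine (le_abs_self _).trans ?_
      simp only [abs_mul, abs_two]; gcongr
    have e2 : 2 * f * c₀ ≤ 2 * A ^ 2 := by
      refine (le_abs_self _).trans ?_
      simp only [abs_mul, abs_two]
      calc 2 * |f| * |c₀| ≤ 2 * A * A := by gcongr
        _ = _ := by ring
    have e3 : A⁻¹ ^ 3 * g ^ 2 + A ^ 5 * c₁ ^ 2 - 2 * A * (|c₁| * |g|) =
        A⁻¹ ^ 3 * (|g| - A ^ 4 * |c₁|) ^ 2 := by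
      rw [← gabs, ← sq_abs c₁]; field_simp; ring
    have e4 : 0 ≤ A⁻¹ ^ 3 * (|g| - A ^ 4 * |c₁|) ^ 2 := by positivity
    linarith
  have t10 : lam * (2 * f * (c₁ * g + c₀)) ≤
      lam * (A⁻¹ ^ 3 * g ^ 2) + lam * (A ^ 5 * c₁ ^ 2 + 2 * A ^ 2) := by
    rw [← mul_add, ← add_assoc]; gcongr
  have t11 : 2 * lam * (A⁻¹ ^ 3 * g ^ 2) ≤ 2 * lam * (a * (h ^ 2 * g ^ 2)) := by gcongr
  -- The choice of lam: of the good term 2·lam·A⁻³g², one half pays for all g² terms and leaves one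
  -- g² over, the other half is spent on c₁g by Young's inequality.
  have t12 : lam * A⁻¹ ^ 3 =
      3 * Z ^ 2 * A + 4 * A * Z + C₂ ^ 2 * A / 8 + 1 := by
    rw [hlam]; field_simp
  have t13 : lam * (A⁻¹ ^ 3 * g ^ 2) =
      2 * Z ^ 2 * A * g ^ 2 + Z ^ 2 * A * g ^ 2 + 4 * A * Z * g ^ 2 + C₂ ^ 2 * A / 8 * g ^ 2 +
        g ^ 2 := by linear_combination g ^ 2 * t12
  have t14 : 0 ≤ a * (8 * ε ^ 2 * g ^ 2) := by positivity
  have t15 : C₂ * (|g| * s) = 2 * Z * A * (|g| * s) + 16 * A * E₀ * (|g| * s) := by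
    simp only [C₂]; ring
  have hexp : 2 * ζ ^ 2 * g * (d₂ * dg + d₁ * g + d₀) + 2 * lam * f * (c₁ * g + c₀) -
      a * (8 * ε ^ 2 * g ^ 2 - 4 * ζ * g ^ 2 - 16 * ζ * ε * g * dg + 2 * ζ ^ 2 * dg ^ 2 +
        2 * lam * h ^ 2 * g ^ 2) =
      2 * ζ ^ 2 * g * (d₂ * dg) + 2 * ζ ^ 2 * g * (d₁ * g) + 2 * ζ ^ 2 * g * d₀ +
      lam * (2 * f * (c₁ * g + c₀)) - a * (8 * ε ^ 2 * g ^ 2) + a * (4 * ζ * g ^ 2) +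
      a * (16 * ζ * ε * g * dg) - a * (2 * ζ ^ 2 * dg ^ 2) - 2 * lam * (a * (h ^ 2 * g ^ 2)) := by
    ring
  rw [hexp] at hL
  generalize lam * (2 * f * (c₁ * g + c₀)) = y₁ at *
  generalize a * (16 * ζ * ε * g * dg) = y₂ at *
  generalize lam * (A ^ 5 * c₁ ^ 2 + 2 * A ^ 2) = y₃ at *
  linarith only [hL, t1, t2, t3, t4, t5, t6, t7, t10, t11, t13, t14, t15]

end smoothAlg

end ViscousEP

namespace ViscousEP

open scoped Topology ContDiff

/-! ### Bernstein's gradient estimate -/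

namespace smoothAlg

variable {T H : ℝ} {e w u : smoothAlg T}

/-- Evaluation at a point of the strip. -/
def ev (p : strip T) : smoothAlg T →+* ℝ :=
  (Pi.evalRingHom (fun _ : strip T => ℝ) p).comp (smoothAlg T).val.toRingHom

theorem ev_algebraMap (p : strip T) (c : ℝ) : ev p (algebraMap ℝ (smoothAlg T) c) = c := rfl

/-- The second derivatives of f and g cancel between D and aδ² by their equations. What remains has
two good terms: (δg)², and g² with the free factor lam, because δf is a multiple of g. The cut-off
enters only through δζ = -2e. -/
theorem IsLabel.parabolic_identity (h : IsLabel H u w e) {f g hh a c₀ c₁ d₀ d₁ d₂ : smoothAlg T}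
    {η lam : ℝ} (hδf : massD w f = hh * g)
    (hf : pathD u f = a * massD w (massD w f) + c₁ * g + c₀)
    (hg : pathD u g = a * massD w (massD w g) + d₂ * massD w g + d₁ * g + d₀) {ζ : smoothAlg T}
    (hζ : ζ = cutoff e η) {G : smoothAlg T}
    (hG : G = ζ * ζ * (g * g) + algebraMap ℝ (smoothAlg T) lam * (f * f)) (p : strip T) :
    (pathD u G).1 p - a.1 p * (massD w (massD w G)).1 p =
      2 * ζ.1 p ^ 2 * g.1 p * (d₂.1 p * (massD w g).1 p + d₁.1 p * g.1 p + d₀.1 p) +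
      2 * lam * f.1 p * (c₁.1 p * g.1 p + c₀.1 p) -
      a.1 p * (8 * e.1 p ^ 2 * g.1 p ^ 2 - 4 * ζ.1 p * g.1 p ^ 2 -
        16 * ζ.1 p * e.1 p * g.1 p * (massD w g).1 p + 2 * ζ.1 p ^ 2 * (massD w g).1 p ^ 2 +
        2 * lam * hh.1 p ^ 2 * g.1 p ^ 2) := by
  have hDζ : pathD u ζ = 0 := by rw [hζ]; exact h.pathD_cutoff η
  have hδζ : massD w ζ = -(e + e) := by rw [hζ, h.massD_cutoff]; ring
  have key : pathD u G - a * massD w (massD w G) =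
      2 * ζ ^ 2 * g * (d₂ * massD w g + d₁ * g + d₀) +
      2 * algebraMap ℝ (smoothAlg T) lam * f * (c₁ * g + c₀) -
      a * (8 * e ^ 2 * g ^ 2 - 4 * ζ * g ^ 2 - 16 * ζ * e * g * massD w g +
        2 * ζ ^ 2 * massD w g ^ 2 + 2 * algebraMap ℝ (smoothAlg T) lam * hh ^ 2 * g ^ 2) := by
    have e1 : pathD u G = 2 * ζ ^ 2 * g * pathD u g +
        2 * algebraMap ℝ (smoothAlg T) lam * f * pathD u f := by
      rw [hG]
      simp only [map_add, Derivation.leibniz, smul_eq_mul, hDζ, Derivation.map_algebraMap]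
      ring
    have e2 : massD w G = -(4 * ζ * e * g ^ 2) + 2 * ζ ^ 2 * g * massD w g +
        2 * algebraMap ℝ (smoothAlg T) lam * f * massD w f := by
      rw [hG]
      simp only [map_add, Derivation.leibniz, smul_eq_mul, hδζ, Derivation.map_algebraMap]
      ring
    have e3 : massD w (massD w G) = 8 * e ^ 2 * g ^ 2 - 4 * ζ * g ^ 2 -
        16 * ζ * e * g * massD w g + 2 * ζ ^ 2 * massD w g ^ 2 +
        2 * ζ ^ 2 * g * massD w (massD w g) +
        2 * algebraMap ℝ (smoothAlg T) lam * massD w f ^ 2 +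
        2 * algebraMap ℝ (smoothAlg T) lam * f * massD w (massD w f) := by
      have n2 : massD w (2 : smoothAlg T) = 0 := by
        have := (massD w).map_natCast 2; simpa using this
      have n4 : massD w (4 : smoothAlg T) = 0 := by
        have := (massD w).map_natCast 4; simpa using this
      rw [e2]
      simp only [map_add, map_neg, Derivation.leibniz, smul_eq_mul, hδζ, Derivation.map_algebraMap,
        pow_two, h.mass, n2, n4]
      ring
    rw [e1, e3, hf, hg, hδf]
    ring
  have := congrArg (ev p) key
  simp only [map_add, map_sub, map_mul, map_pow, map_ofNat, ev_algebraMap] at this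
  exact this

/-- After multiplication by ζ², smallness of θ leaves K² with a coefficient at most 1/2, so that K
can later be absorbed. -/
theorem le_of_gradient_inequality {A Z ζ g c₁ lam θ B K : ℝ} (hA : 0 < A) (hlam : 0 ≤ lam)
    (hθ : 4 * lam * A ^ 5 * θ ^ 2 ≤ 1) (hζ0 : 0 ≤ ζ) (hζ : ζ ≤ Z)
    (hg : g ^ 2 ≤ Z ^ 2 * A + lam * (A ^ 5 * c₁ ^ 2 + 2 * A ^ 2)) (hc : ζ * |c₁| ≤ B + θ * K) :
    (ζ * |g|) ^ 2 ≤ Z ^ 2 * (Z ^ 2 * A + lam * (2 * A ^ 2)) + lam * A ^ 5 * (2 * B ^ 2) +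
      K ^ 2 / 2 := by
  have h2 : (ζ * |c₁|) ^ 2 ≤ 2 * B ^ 2 + 2 * θ ^ 2 * K ^ 2 := by
    have e2 : 0 ≤ ζ * |c₁| := mul_nonneg hζ0 (abs_nonneg _)
    calc (ζ * |c₁|) ^ 2 ≤ (B + θ * K) ^ 2 := by gcongr
      _ ≤ _ := by nlinarith only [sq_nonneg (B - θ * K)]
  have e1 : ζ ^ 2 ≤ Z ^ 2 := by gcongr
  have e2 : 0 ≤ Z ^ 2 * A + lam * (2 * A ^ 2) := by positivity
  calc (ζ * |g|) ^ 2 = ζ ^ 2 * g ^ 2 := by rw [mul_pow, sq_abs]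
    _ ≤ ζ ^ 2 * (Z ^ 2 * A + lam * (A ^ 5 * c₁ ^ 2 + 2 * A ^ 2)) := by gcongr
    _ = ζ ^ 2 * (Z ^ 2 * A + lam * (2 * A ^ 2)) + lam * A ^ 5 * (ζ * |c₁|) ^ 2 := by
        rw [mul_pow, sq_abs]; ring
    _ ≤ Z ^ 2 * (Z ^ 2 * A + lam * (2 * A ^ 2)) +
        lam * A ^ 5 * (2 * B ^ 2 + 2 * θ ^ 2 * K ^ 2) := by gcongr
    _ = Z ^ 2 * (Z ^ 2 * A + lam * (2 * A ^ 2)) + lam * A ^ 5 * (2 * B ^ 2) +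
        (4 * lam * A ^ 5 * θ ^ 2) * (K ^ 2 / 2) := by ring
    _ ≤ Z ^ 2 * (Z ^ 2 * A + lam * (2 * A ^ 2)) + lam * A ^ 5 * (2 * B ^ 2) +
        1 * (K ^ 2 / 2) := by gcongr
    _ = _ := by ring

/-- The value of lam is the one in `gradient_inequality` with Z = η², E₀ = |η|. With y = 4·lam·A⁵
the choice θ = 1/(y + 1) works because y ≤ (y + 1)². -/
theorem exists_gradient_constants {A : ℝ} (hA : 0 < A) (η : ℝ) : ∃ lam θ : ℝ, 0 < lam ∧ 0 < θ ∧
    4 * lam * A ^ 5 * θ ^ 2 ≤ 1 ∧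
    lam = A ^ 3 * (3 * (η ^ 2) ^ 2 * A + 4 * A * η ^ 2 +
      (2 * η ^ 2 * A + 16 * A * |η|) ^ 2 * A / 8 + 1) := by
  obtain ⟨lam, hlam⟩ : ∃ lam, lam = A ^ 3 * (3 * (η ^ 2) ^ 2 * A + 4 * A * η ^ 2 +
      (2 * η ^ 2 * A + 16 * A * |η|) ^ 2 * A / 8 + 1) := ⟨_, rfl⟩
  have hlam0 : 0 < lam := by rw [hlam]; positivity
  refine ⟨lam, 1 / (4 * lam * A ^ 5 + 1), hlam0, by positivity, ?_, hlam⟩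
  have hd : 0 < 4 * lam * A ^ 5 + 1 := by positivity
  rw [div_pow, one_pow, mul_one_div, div_le_one (by positivity)]
  have : 0 ≤ 4 * lam * A ^ 5 := by positivity
  nlinarith only [this]

/-- Interior gradient estimate, with a coefficient `c₁` that may depend on the past of `g`. -/
theorem IsLabel.gradient_estimate (h : IsLabel H u w e) {A η : ℝ} (hA : 1 ≤ A) (hη0 : 0 ≤ η)
    (hη : η < H) : ∃ θ > 0, ∀ (f g hh a c₀ c₁ d₀ d₁ d₂ : smoothAlg T) (t₀ B : ℝ), 0 < t₀ → t₀ < T →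
      massD w f = hh * g →
      pathD u f = a * massD w (massD w f) + c₁ * g + c₀ →
      pathD u g = a * massD w (massD w g) + d₂ * massD w g + d₁ * g + d₀ →
      (∀ p : strip T, |e.1 p| ≤ η → t₀ ≤ p.1.2 → |f.1 p| ≤ A ∧ |c₀.1 p| ≤ A ∧ |d₀.1 p| ≤ A ∧
        |d₁.1 p| ≤ A ∧ |d₂.1 p| ≤ A ∧ a.1 p ≤ A ∧ A⁻¹ ≤ a.1 p ∧ A⁻¹ ≤ hh.1 p) →
      (∀ t₁ K, t₁ < T → 0 ≤ K → (∀ p ∈ band e η t₀ t₁, (cutoff e η).1 p * |g.1 p| ≤ K) →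
        ∀ p ∈ band e η t₀ t₁, (cutoff e η).1 p * |c₁.1 p| ≤ B + θ * K) →
      ∃ K, ∀ p : strip T, |e.1 p| ≤ η → t₀ ≤ p.1.2 → (cutoff e η).1 p * |g.1 p| ≤ K := by
  have hA0 : 0 < A := by linarith
  obtain ⟨lam, θ, hlam0, hθ0, hθ1, hlam⟩ := exists_gradient_constants hA0 η
  rw [abs_of_nonneg hη0] at hlam
  refine ⟨θ, hθ0, ?_⟩
  intro f g hh a c₀ c₁ d₀ d₁ d₂ t₀ B ht₀ ht₀T hδf hf hg hbd hmem
  obtain ⟨ζ, hζ⟩ : ∃ ζ, ζ = cutoff e η := ⟨_, rfl⟩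
  have hζ0 : ∀ q : strip T, |e.1 q| ≤ η → 0 ≤ ζ.1 q := fun q hq => by
    rw [hζ]; exact cutoff_nonneg hq
  have hζZ : ∀ q : strip T, ζ.1 q ≤ η ^ 2 := fun q => by rw [hζ]; exact cutoff_le η q
  rw [← hζ] at hmem ⊢
  have hgζ : Continuous fun p => ζ.1 p * |g.1 p| := (continuous ζ).mul (continuous g).abs
  obtain ⟨K₀, hK₀⟩ := (h.compact η hη t₀ t₀ ht₀ ht₀T).exists_bound_of_continuousOn
    hgζ.continuousOn
  obtain ⟨C₁, hC₁⟩ : ∃ C₁, C₁ = (η ^ 2) ^ 2 * ((η ^ 2) ^ 2 * A + lam * (2 * A ^ 2)) +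
    lam * A ^ 5 * (2 * B ^ 2) := ⟨_, rfl⟩
  have hC₁0 : 0 ≤ C₁ := by rw [hC₁]; positivity
  -- Obtained from K² ≤ C₁ + K₀² + lam·A² + K²/2, where K is the maximum of ζ|g| on the band up to
  -- the time of p. The bound does not see that time.
  refine ⟨√(2 * (C₁ + K₀ ^ 2 + lam * A ^ 2)), fun p hpe hpt => ?_⟩
  obtain ⟨t₁, ht₁p⟩ : ∃ t₁, t₁ = p.1.2 := ⟨_, rfl⟩
  have ht₁ : t₁ < T := ht₁p ▸ p.2.2.2
  have hpb : p ∈ band e η t₀ t₁ := ⟨hpe, hpt, ht₁p.ge⟩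
  have ht₀₁ : t₀ ≤ t₁ := ht₁p ▸ hpt
  obtain ⟨z, hz, hzmax⟩ := (h.compact η hη t₀ t₁ ht₀ ht₁).exists_isMaxOn ⟨p, hpb⟩
    hgζ.continuousOn
  obtain ⟨K, hKz⟩ : ∃ K, K = ζ.1 z * |g.1 z| := ⟨_, rfl⟩
  have hmax : ∀ q ∈ band e η t₀ t₁, ζ.1 q * |g.1 q| ≤ K := fun q hq => hKz ▸ hzmax hq
  have hK : 0 ≤ K := by rw [hKz]; exact mul_nonneg (hζ0 z hz.1) (abs_nonneg _)
  have hc₁ := hmem t₁ K ht₁ hK hmax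
  obtain ⟨G, hG⟩ : ∃ G, G = ζ * ζ * (g * g) + algebraMap ℝ (smoothAlg T) lam * (f * f) := ⟨_, rfl⟩
  have hGv : ∀ q, G.1 q = (ζ.1 q * |g.1 q|) ^ 2 + lam * f.1 q ^ 2 := by
    intro q
    have : G.1 q = ζ.1 q * ζ.1 q * (g.1 q * g.1 q) + lam * (f.1 q * f.1 q) := by rw [hG]; rfl
    rw [this, mul_pow, sq_abs]; ring
  have hf2 : ∀ q ∈ band e η t₀ t₁, lam * f.1 q ^ 2 ≤ lam * A ^ 2 := by
    intro q hq
    have h1 := (hbd q hq.1 hq.2.1).1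
    have : f.1 q ^ 2 ≤ A ^ 2 := sq_le_sq' (abs_le.1 h1).1 (abs_le.1 h1).2
    gcongr
  have hKsq := sq_nonneg K
  have hK₀sq := sq_nonneg K₀
  have hle : G.1 z ≤ C₁ + K₀ ^ 2 + lam * A ^ 2 + K ^ 2 / 2 := by
    refine h.le_of_band hη ht₀ ht₁ ?_ ?_ ?_ hz
    · intro q hq hqt
      rw [hGv]
      have h1 := hK₀ q ⟨hq, hqt.ge, hqt.le⟩
      have h2 : (ζ.1 q * |g.1 q|) ^ 2 ≤ K₀ ^ 2 :=
        sq_le_sq' (abs_le.1 h1).1 (abs_le.1 h1).2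
      have h3 := hf2 q ⟨hq, hqt.ge, hqt.le.trans ht₀₁⟩
      linarith only [h2, h3, hKsq, hC₁0]
    · intro q hq hqe
      have h0 : ζ.1 q = 0 := by rw [hζ]; exact cutoff_eq_zero hqe
      rw [hGv, h0]
      have h3 := hf2 q hq
      linarith only [h3, hKsq, hK₀sq, hC₁0]
    · intro q hq m1 m2 m3
      obtain ⟨b1, b2, b3, b4, b5, b6, b7, b8⟩ := hbd q hq.1 hq.2.1
      have ha0 : 0 < a.1 q := (inv_pos.2 hA0).trans_le b7
      have hL : 0 ≤ (pathD u G).1 q - a.1 q * (massD w (massD w G)).1 q := by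
        have := mul_nonpos_of_nonneg_of_nonpos ha0.le m2
        linarith only [this, m3]
      rw [h.parabolic_identity hδf hf hg hζ hG q] at hL
      have hgr := gradient_inequality hA (hζ0 q hq.1) (hζZ q) hq.1 b1 b2 b3 b4 b5 b6 b7 b8 hlam hL
      have h1 := le_of_gradient_inequality hA0 hlam0.le hθ1 (hζ0 q hq.1) (hζZ q) hgr (hc₁ q hq)
      rw [← hC₁] at h1
      rw [hGv]
      have h4 := hf2 q hq
      linarith only [h1, h4, hK₀sq]
  rw [hGv, ← hKz] at hle
  have hKK : K ^ 2 ≤ 2 * (C₁ + K₀ ^ 2 + lam * A ^ 2) := by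
    have : 0 ≤ lam * f.1 z ^ 2 := by positivity
    linarith only [this, hle]
  exact (hmax p hpb).trans (Real.le_sqrt_of_sq_le hKK)

/-! ### Functions bounded near the final time -/

/-- Neighbourhoods of the final time within a band. -/
def near (e : smoothAlg T) (η : ℝ) : Filter (strip T) :=
  comap (fun p : strip T => p.1.2) (𝓝[<] T) ⊓ 𝓟 {p | |e.1 p| ≤ η}

theorem eventually_near (hT : 0 < T) {η : ℝ} {P : strip T → Prop} :
    (∀ᶠ p in near e η, P p) ↔
      ∃ t₀, 0 < t₀ ∧ t₀ < T ∧ ∀ p : strip T, |e.1 p| ≤ η → t₀ ≤ p.1.2 → P p := by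
  rw [near, eventually_inf_principal, eventually_comap]
  constructor
  · intro h
    obtain ⟨t₁, ht₁, h1⟩ := (mem_nhdsLT_iff_exists_Ioo_subset' hT).1 h
    have ht₁' : t₁ < T := ht₁
    obtain ⟨t₀, h2, h3⟩ := exists_between (max_lt ht₁' hT)
    refine ⟨t₀, (le_max_right _ _).trans_lt h2, h3, fun p hp hpt => ?_⟩
    exact h1 ⟨((le_max_left _ _).trans_lt h2).trans_le hpt, p.2.2.2⟩ p rfl hp
  · rintro ⟨t₀, -, h1, h2⟩
    filter_upwards [Ioo_mem_nhdsLT h1] with t ht p hp hpe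
    exact h2 p hpe (by rw [hp]; exact ht.1.le)

/-- The algebra of functions that are bounded near the final time on every band. -/
def bounded (H : ℝ) (e : smoothAlg T) : Subalgebra ℝ (smoothAlg T) where
  carrier := {f | ∀ η < H, f.1 =O[near e η] fun _ => (1 : ℝ)}
  mul_mem' := fun {f g} hf hg η hη => by simpa using (hf η hη).mul (hg η hη)
  add_mem' := fun {f g} hf hg η hη => (hf η hη).add (hg η hη)
  algebraMap_mem' := fun c η hη => isBigO_const_const c one_ne_zero _

theorem mem_bounded_iff (hT : 0 < T) {f : smoothAlg T} : f ∈ bounded H e ↔ ∀ η < H, ∃ A t₀, 0 < t₀ ∧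
    t₀ < T ∧ ∀ p : strip T, |e.1 p| ≤ η → t₀ ≤ p.1.2 → |f.1 p| ≤ A := by
  refine forall₂_congr fun η _ => ?_
  rw [isBigO_iff]
  refine exists_congr fun A => ?_
  rw [eventually_near hT]
  simp

/-- A slightly wider band η' < H removes the weight: its cut-off is at least η'² - η² on the band η.
-/
theorem mem_bounded_of_cutoff (hT : 0 < T) {f : smoothAlg T}
    (h : ∀ η, 0 < η → η < H → ∃ K t₀, 0 < t₀ ∧ t₀ < T ∧ ∀ p : strip T,
      |e.1 p| ≤ η → t₀ ≤ p.1.2 → (cutoff e η).1 p * |f.1 p| ≤ K) :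
    f ∈ bounded H e := by
  rw [mem_bounded_iff hT]
  intro η hη
  rcases lt_or_ge η 0 with hneg | hpos
  · exact ⟨0, T / 2, by linarith, by linarith, fun p hp => absurd (hp.trans_lt hneg)
      (not_lt.2 (abs_nonneg _))⟩
  obtain ⟨η', h1, h2⟩ := exists_between hη
  obtain ⟨K, t₀, h3, h4, hK⟩ := h η' (hpos.trans_lt h1) h2
  have hd : 0 < η' ^ 2 - η ^ 2 := by nlinarith
  refine ⟨K / (η' ^ 2 - η ^ 2), t₀, h3, h4, fun p hp hpt => ?_⟩
  rw [le_div_iff₀ hd, mul_comm]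
  refine le_trans ?_ (hK p (hp.trans h1.le) hpt)
  refine mul_le_mul_of_nonneg_right ?_ (abs_nonneg _)
  rw [cutoff_apply]
  have := sq_le_sq' (abs_le.1 hp).1 (abs_le.1 hp).2
  linarith

theorem IsLabel.mem_bounded_of_pathD (hT : 0 < T) (h : IsLabel H u w e) {f : smoothAlg T}
    (hf : pathD u f ∈ bounded H e) : f ∈ bounded H e := by
  refine mem_bounded_of_cutoff hT fun η hη0 hη => ?_
  obtain ⟨A, t₀, ht₀, ht₀T, hA⟩ := (mem_bounded_iff hT).1 hf η hη
  have hfζ : Continuous fun p => (cutoff e η).1 p * |f.1 p| :=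
    (continuous (cutoff e η)).mul (continuous f).abs
  obtain ⟨K₀, hK₀⟩ := (h.compact η hη t₀ t₀ ht₀ ht₀T).exists_bound_of_continuousOn
    hfζ.continuousOn
  refine ⟨|K₀| + (η ^ 2 * |A| + 1) * T, t₀, ht₀, ht₀T, fun p hp hpt => ?_⟩
  have key := h.abs_transport_le (f := f) (t₁ := p.1.2) (A := η ^ 2 * |A|) (B := |K₀|) hη ht₀
    p.2.2.2
    (by positivity) (fun q hq => ?_) (abs_nonneg _) (fun q hq hqt => ?_) (p := p) ⟨hp, hpt, le_rfl⟩
  · refine key.trans ?_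
    gcongr
    linarith [p.2.2.2]
  · refine mul_le_mul (cutoff_le η q) ?_ (abs_nonneg _) (by positivity)
    exact (hA q hq.1 hq.2.1).trans (le_abs_self _)
  · exact (le_abs_self _).trans ((hK₀ q ⟨hq, hqt.ge, hqt.le⟩).trans (le_abs_self _))

end smoothAlg

end ViscousEP

namespace ViscousEP

open scoped Topology ContDiff

/-! ### Boundedness of the flux and of all derivatives near the final time -/

namespace smoothAlg

variable {T H : ℝ} {e w a u : smoothAlg T}

theorem eventually_le_of_mem_bounded {f : smoothAlg T} (hf : f ∈ bounded H e) {η : ℝ} (hη : η < H) :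
    ∀ᶠ A in atTop, ∀ᶠ p in near e η, |f.1 p| ≤ A := by
  obtain ⟨c, hc⟩ := (hf η hη).bound
  filter_upwards [eventually_ge_atTop c] with A hA
  filter_upwards [hc] with p hp
  simp only [Real.norm_eq_abs, abs_one, mul_one] at hp
  exact hp.trans hA

theorem inv_le_of_mul_eq_one {A x y : ℝ} (hA : 0 < A) (hy : 0 < y) (hxy : x * y = 1)
    (hx : |x| ≤ A) : A⁻¹ ≤ y := by
  rw [inv_le_iff_one_le_mul₀ hA, ← hxy, mul_comm]
  exact mul_le_mul_of_nonneg_left ((le_abs_self _).trans hx) hy.le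

theorem mul_apply_eq_one (hwa : w * a = 1) (p : strip T) : w.1 p * a.1 p = 1 :=
  congrFun (congrArg Subtype.val hwa) p

/-- The first derivative of a bounded solution of a linear parabolic equation is bounded. -/
theorem IsLabel.mem_bounded_of_parabolic (hT : 0 < T) (h : IsLabel H u w e) (hwa : w * a = 1)
    (ha0 : ∀ p, 0 < a.1 p) (hw : w ∈ bounded H e) (ha : a ∈ bounded H e)
    {f c₀ c₁ d₀ d₁ d₂ : smoothAlg T} (hf : f ∈ bounded H e) (hc₀ : c₀ ∈ bounded H e)
    (hc₁ : c₁ ∈ bounded H e) (hd₀ : d₀ ∈ bounded H e) (hd₁ : d₁ ∈ bounded H e)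
    (hd₂ : d₂ ∈ bounded H e)
    (hD : pathD u f = a * massD w (massD w f) + c₁ * massD w f + c₀)
    (hDδ : pathD u (massD w f) = a * massD w (massD w (massD w f)) + d₂ * massD w (massD w f) +
      d₁ * massD w f + d₀) : massD w f ∈ bounded H e := by
  refine mem_bounded_of_cutoff hT fun η hη0 hη => ?_
  obtain ⟨A, hA, b1, b2, b3, b4, b5, b6, b7, b8⟩ := ((eventually_ge_atTop 1).and
    ((eventually_le_of_mem_bounded hf hη).and ((eventually_le_of_mem_bounded hc₀ hη).and
    ((eventually_le_of_mem_bounded hd₀ hη).and ((eventually_le_of_mem_bounded hd₁ hη).and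
    ((eventually_le_of_mem_bounded hd₂ hη).and ((eventually_le_of_mem_bounded ha hη).and
    ((eventually_le_of_mem_bounded hw hη).and (eventually_le_of_mem_bounded hc₁ hη))))))))).exists
  have hA0 : 0 < A := by linarith
  obtain ⟨θ, hθ, key⟩ := h.gradient_estimate hA hη0.le hη
  obtain ⟨t₀, ht₀, ht₀T, hb⟩ := (eventually_near hT).1
    (b1.and (b2.and (b3.and (b4.and (b5.and (b6.and (b7.and b8)))))))
  refine (key f (massD w f) 1 a c₀ c₁ d₀ d₁ d₂ t₀ (η ^ 2 * A) ht₀ ht₀T (one_mul _).symm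
    hD hDδ (fun p hp hpt => ?_) (fun t₁ K ht₁ hK0 hK p hp => ?_)).imp
      fun K hK => ⟨t₀, ht₀, ht₀T, hK⟩
  · obtain ⟨h1, h2, h3, h4, h5, h6, h7, h8⟩ := hb p hp hpt
    exact ⟨h1, h2, h3, h4, h5, (le_abs_self _).trans h6,
      inv_le_of_mul_eq_one hA0 (ha0 p) (mul_apply_eq_one hwa p) h7, inv_le_one_of_one_le₀ hA⟩
  -- Here c₁ is bounded outright, so the allowance θK is not needed.
  · have h8 := (hb p hp.1 hp.2.1).2.2.2.2.2.2.2
    have : (cutoff e η).1 p * |c₁.1 p| ≤ η ^ 2 * A :=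
      mul_le_mul (cutoff_le η p) h8 (abs_nonneg _) (by positivity)
    linarith [mul_nonneg hθ.le hK0]

/-- The spatial derivative of the ratio is bounded. -/
theorem IsLabel.flux_mem_bounded {k : ℝ} {β q : smoothAlg T} (hT : 0 < T) (h : IsLabel H u w e)
    (hS : MassSystem k (pathD u) (massD w) w a β q u e) (ha0 : ∀ p, 0 < a.1 p)
    (hw : w ∈ bounded H e) (ha : a ∈ bounded H e) (hβ : β ∈ bounded H e) : q ∈ bounded H e := by
  refine mem_bounded_of_cutoff hT fun η hη0 hη => ?_
  have hwa := mul_apply_eq_one hS.w_mul_a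
  have hw0 : ∀ p, 0 < w.1 p := fun p => by
    have := hwa p
    exact pos_of_mul_pos_left (this ▸ one_pos) (ha0 p).le
  have hd₁ : -(a * β) ∈ bounded H e := neg_mem (mul_mem ha hβ)
  obtain ⟨A, ⟨hA, hkA⟩, b1, b2, b3, b4⟩ :=
    (((eventually_ge_atTop 1).and (eventually_ge_atTop |k|)).and
    ((eventually_le_of_mem_bounded hβ hη).and ((eventually_le_of_mem_bounded hd₁ hη).and
    ((eventually_le_of_mem_bounded ha hη).and (eventually_le_of_mem_bounded hw hη))))).exists
  have hA0 : 0 < A := by linarith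
  obtain ⟨θ, hθ, key⟩ := h.gradient_estimate hA hη0.le hη
  obtain ⟨t', ht', ht'T, hb⟩ := (eventually_near hT).1 (b1.and (b2.and (b3.and b4)))
  -- The interval [t₀, T) is so short that the feedback factor A²(T - t₀) of q on its own
  -- coefficient is at most θ.
  obtain ⟨t₀, h1, ht₀T⟩ := exists_between (max_lt ht'T (sub_lt_self T (div_pos hθ (pow_pos hA0 2))))
  have htt : t' ≤ t₀ := (le_max_left _ _).trans h1.le
  have ht₀ : 0 < t₀ := ht'.trans_le htt
  have hθt : A ^ 2 * (T - t₀) ≤ θ := by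
    have : T - θ / A ^ 2 < t₀ := (le_max_right _ _).trans_lt h1
    have h2 : T - t₀ ≤ θ / A ^ 2 := by linarith
    rwa [le_div_iff₀ (by positivity), mul_comm] at h2
  have hcont : Continuous fun p => (cutoff e η).1 p * |(massD w w).1 p| :=
    (continuous (cutoff e η)).mul (continuous (massD w w)).abs
  obtain ⟨B₀, hB₀⟩ := (h.compact η hη t₀ t₀ ht₀ ht₀T).exists_bound_of_continuousOn
    hcont.continuousOn
  have hδβ := hS.δ_β
  -- Here f = β and g = q = ρδβ. Expanding δq in the equation of β produces the coefficient c₁ =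
  -- -ρδw, which is not yet known to be bounded.
  refine (key β q w a (algebraMap ℝ _ k) (-(a * massD w w)) 0 (-(a * β)) 0 t₀
    (A * (|B₀| + T)) ht₀ ht₀T hδβ ?_ ?_ (fun p hp hpt => ?_) (fun t₁ K ht₁ hK0 hK p hp => ?_)).imp
      fun K hK => ⟨t₀, ht₀, ht₀T, hK⟩
  · rw [hS.D_β, hδβ, Derivation.leibniz, smul_eq_mul, smul_eq_mul]
    linear_combination (-massD w q) * hS.w_mul_a
  · rw [hS.D_q]; ring
  · obtain ⟨h1, h2, h3, h4⟩ := hb p hp (htt.trans hpt)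
    refine ⟨h1, hkA, ?_, h2, ?_, (le_abs_self _).trans h3,
      inv_le_of_mul_eq_one hA0 (ha0 p) (hwa p) h4,
      inv_le_of_mul_eq_one hA0 (hw0 p) (by rw [mul_comm]; exact hwa p) h3⟩ <;>
    · change |(0 : ℝ)| ≤ A
      rw [abs_zero]; exact hA0.le
  -- Since D(δw) = δβ = wq, the past of q controls δw, with a gain of the elapsed time.
  · have htr := h.abs_transport_le (f := massD w w) (A := A * K) (B := |B₀|) hη ht₀ ht₁
      (by positivity) (fun r hr => ?_) (abs_nonneg _) (fun r hr hrt => ?_) hp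
    · have h3 := (hb p hp.1 (htt.trans hp.2.1)).2.2.1
      have hle : t₁ - t₀ ≤ T - t₀ := by linarith
      have h0 : 0 ≤ t₁ - t₀ := by linarith [hp.2.1, hp.2.2]
      have hval : |(-(a * massD w w)).1 p| = |a.1 p| * |(massD w w).1 p| := by
        rw [← abs_mul, ← abs_neg (a.1 p * (massD w w).1 p)]; rfl
      rw [hval]
      have hc0 : 0 ≤ (cutoff e η).1 p * |(massD w w).1 p| :=
        mul_nonneg (cutoff_nonneg hp.1) (abs_nonneg _)
      calc (cutoff e η).1 p * (|a.1 p| * |(massD w w).1 p|)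
          = |a.1 p| * ((cutoff e η).1 p * |(massD w w).1 p|) := by ring
        _ ≤ A * (|B₀| + (A * K + 1) * (t₁ - t₀)) := by gcongr
        _ ≤ A * (|B₀| + (A * K + 1) * (T - t₀)) := by gcongr
        _ = A * (|B₀| + (T - t₀)) + A ^ 2 * (T - t₀) * K := by ring
        _ ≤ A * (|B₀| + T) + θ * K := by gcongr; linarith
    · have e1 : pathD u (massD w w) = w * q := by rw [hS.comm, hS.D_w, hδβ]
      rw [e1]
      have h4 := (hb r hr.1 (htt.trans hr.2.1)).2.2.2
      have hval : |(w * q).1 r| = |w.1 r| * |q.1 r| := by rw [← abs_mul]; rfl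
      rw [hval]
      calc (cutoff e η).1 r * (|w.1 r| * |q.1 r|)
          = |w.1 r| * ((cutoff e η).1 r * |q.1 r|) := by ring
        _ ≤ A * K := by
          gcongr
          · exact mul_nonneg (cutoff_nonneg hr.1) (abs_nonneg _)
          · exact hK r hr
    · exact (le_abs_self _).trans ((hB₀ r ⟨hr, hrt.ge, hrt.le⟩).trans (le_abs_self _))

/-- All functions generated by the unknowns are bounded near the final time. -/
theorem IsLabel.mem_bounded_of_generated {k : ℝ} {β q : smoothAlg T} (hT : 0 < T)
    (h : IsLabel H u w e) (hS : MassSystem k (pathD u) (massD w) w a β q u e)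
    (ha0 : ∀ p, 0 < a.1 p) (hw : w ∈ bounded H e) (ha : a ∈ bounded H e) (hβ : β ∈ bounded H e)
    (hu : u ∈ bounded H e) (he : e ∈ bounded H e) {f : smoothAlg T}
    (hf : Generated (massD w) w a β q u e f) : f ∈ bounded H e := by
  have hq := h.flux_mem_bounded hT hS ha0 hw ha hβ
  refine (hf.derivsIn hS (hS.derivsIn_all hw ha hβ hq (fun f => h.mem_bounded_of_pathD hT)
    fun f c₀ c₁ d₀ d₁ d₂ h0 h1 h2 h3 h4 h5 => ?_) hu he 0).mem
  exact h.mem_bounded_of_parabolic hT hS.w_mul_a ha0 hw ha h0 h1 h2 h3 h4 h5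

end smoothAlg

end ViscousEP

namespace ViscousEP

open scoped Topology ContDiff

/-! ### Smooth solutions as elements of the algebra -/

namespace smoothAlg

variable {T : ℝ}

theorem pathD_lift {F v : ℝ × ℝ → ℝ} (hv : ContDiffOn ℝ ∞ v (strip T))
    (hF : ContDiffOn ℝ ∞ F (strip T)) (p : strip T) :
    (pathD (lift v hv) (lift F hF)).1 p = pt F p + v p * px F p := by
  rw [← dX_lift hF, ← dT_lift hF]; rfl

theorem massD_lift {F w : ℝ × ℝ → ℝ} (hw : ContDiffOn ℝ ∞ w (strip T))
    (hF : ContDiffOn ℝ ∞ F (strip T)) (p : strip T) :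
    (massD (lift w hw) (lift F hF)).1 p = w p * px F p := by
  rw [← dX_lift hF]; rfl

/-- A family of smooth functions closed under differentiation, all of them locally bounded near
the final time. -/
structure IsTame (S : Set (smoothAlg T)) : Prop where
  dX_mem : ∀ f ∈ S, dX T f ∈ S
  dT_mem : ∀ f ∈ S, dT T f ∈ S
  bounded : ∀ f ∈ S, ∀ R, ∃ A t₀, 0 < t₀ ∧ t₀ < T ∧
    ∀ p : strip T, |p.1.1| ≤ R → t₀ ≤ p.1.2 → |f.1 p| ≤ A

end smoothAlg

open smoothAlg

namespace Flow

variable {k T C H : ℝ} {r v b m w : ℝ × ℝ → ℝ}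

theorem contDiffOn_m (h : Flow k T C r v b m) (hr : ContDiffOn ℝ ∞ r (strip T))
    (hv : ContDiffOn ℝ ∞ v (strip T)) : ContDiffOn ℝ ∞ m (strip T) := by
  rw [contDiffOn_infty_iff_fderiv_of_isOpen (isOpen_strip T)]
  refine ⟨fun p hp => (h.m_fderiv p hp).differentiableAt.differentiableWithinAt, ?_⟩
  refine ContDiffOn.congr ?_ fun p hp => (h.m_fderiv p hp).fderiv
  exact (hr.smul contDiffOn_const).sub ((hr.mul hv).smul contDiffOn_const)

theorem massSystem (h : Flow k T C r v b m)
    (mom : ∀ p ∈ strip T, pt v p + v p * px v p = k * m p + px b p)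
    (hr : ContDiffOn ℝ ∞ r (strip T)) (hv : ContDiffOn ℝ ∞ v (strip T))
    (hb : ContDiffOn ℝ ∞ b (strip T)) (hm : ContDiffOn ℝ ∞ m (strip T))
    (hw : ContDiffOn ℝ ∞ (fun p => (r p)⁻¹) (strip T)) (hq : ContDiffOn ℝ ∞ (px b) (strip T)) :
    MassSystem k (pathD (lift v hv)) (massD (lift _ hw)) (lift _ hw) (lift r hr) (lift b hb)
      (lift _ hq) (lift v hv) (lift m hm) := by
  have hr0 : ∀ p : strip T, r p ≠ 0 := fun p => (h.r_pos p (strip_subset T p.2)).ne'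
  have dr : ∀ p : strip T, DifferentiableAt ℝ r p := fun p =>
    (hr.contDiffAt (strip_mem_nhds p.2)).differentiableAt (by simp)
  have D_w : pathD (lift v hv) (lift _ hw) = lift b hb := by
    refine Subtype.ext (funext fun p => ?_)
    rw [pathD_lift, pt_inv (dr p) (hr0 p), px_inv (dr p) (hr0 p)]
    change _ = b p
    have e := h.mass p p.2
    rw [h.px_v p p.2] at e
    have := hr0 p
    field_simp
    linear_combination -e
  have δ_u : massD (lift _ hw) (lift v hv) = lift b hb := by
    refine Subtype.ext (funext fun p => ?_)
    rw [massD_lift, h.px_v p p.2]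
    change _ = b p
    have := hr0 p
    field_simp
  refine ⟨pathD_massD_comm (D_w.trans δ_u.symm), ?_, D_w, ?_, ?_, ?_, δ_u, ?_, ?_⟩ <;>
    refine Subtype.ext (funext fun p => ?_)
  · exact inv_mul_cancel₀ (hr0 p)
  · rw [massD_lift]; rfl
  · rw [pathD_lift, h.b_pde p p.2]
    have : (algebraMap ℝ (smoothAlg T) k + massD (lift _ hw) (lift _ hq)).1 p =
      k + (massD (lift _ hw) (lift _ hq)).1 p := rfl
    rw [this, massD_lift, div_eq_inv_mul]
  · rw [pathD_lift, mom p p.2]; rfl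
  · rw [pathD_lift, h.px_m p.2, h.pt_m p.2]
    change _ = (0 : ℝ)
    ring
  · rw [massD_lift, h.px_m p.2]
    exact inv_mul_cancel₀ (hr0 p)

theorem exists_labels (h₁ : Tendsto (fun x => m (x, 0)) atTop (𝓝 H))
    (h₂ : Tendsto (fun x => m (x, 0)) atBot (𝓝 (-H))) {η : ℝ} (hη : η < H) :
    ∃ x₁ x₂, m (x₁, 0) ≤ -η ∧ η ≤ m (x₂, 0) := by
  obtain ⟨x₁, hx₁⟩ := (h₂.eventually (gt_mem_nhds (neg_lt_neg hη))).exists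
  obtain ⟨x₂, hx₂⟩ := (h₁.eventually (lt_mem_nhds hη)).exists
  exact ⟨x₁, x₂, hx₁.le, hx₂.le⟩

/-- Tracing back to time 0 by the cone property, labels over [-R, R] lie between those at ±(R + CT),
which are strictly inside (-H, H). This converts bounds on bands into bounds on compact sets of x.
-/
theorem exists_label_bound (h : Flow k T C r v b m) (hT : 0 < T)
    (h₁ : Tendsto (fun x => m (x, 0)) atTop (𝓝 H)) (h₂ : Tendsto (fun x => m (x, 0)) atBot (𝓝 (-H)))
    (R : ℝ) : ∃ η < H, ∀ x t, |x| ≤ R → 0 ≤ t → t < T → |m (x, t)| ≤ η := by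
  have hmono := h.strictMono_m le_rfl hT
  set y := R + C * T
  have e1 : m (y, 0) < H := (hmono (lt_add_one y)).trans_le (hmono.monotone.ge_of_tendsto h₁ _)
  have e2 : -H < m (-y, 0) :=
    (hmono.monotone.le_of_tendsto h₂ (-y - 1)).trans_lt (hmono (sub_one_lt (-y)))
  refine ⟨max (m (y, 0)) (-m (-y, 0)), max_lt e1 (by linarith), fun x t hx h0 htT => ?_⟩
  have hC := h.C_nonneg (mem_strip₀.2 ⟨h0, htT⟩ : (x, t) ∈ strip₀ T)
  have hCt : C * t ≤ C * T := by gcongr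
  obtain ⟨hx1, hx2⟩ := abs_le.1 hx
  obtain ⟨c1, c2⟩ := h.cone_abs (x := x) h0 htT le_rfl hT
  rw [zero_sub, abs_neg, abs_of_nonneg h0] at c1 c2
  have c3 : m (x + C * t, 0) ≤ m (y, 0) := hmono.monotone (by simp only [y]; linarith)
  have c4 : m (-y, 0) ≤ m (x - C * t, 0) := hmono.monotone (by simp only [y]; linarith)
  rw [abs_le]
  have f1 := le_max_left (m (y, 0)) (-m (-y, 0))
  have f2 := le_max_right (m (y, 0)) (-m (-y, 0))
  exact ⟨by linarith, by linarith⟩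

theorem isLabel (h : Flow k T C r v b m)
    (h₁ : Tendsto (fun x => m (x, 0)) atTop (𝓝 H)) (h₂ : Tendsto (fun x => m (x, 0)) atBot (𝓝 (-H)))
    {u w : smoothAlg T} (hm : ContDiffOn ℝ ∞ m (strip T)) (hD : pathD u (lift m hm) = 0)
    (hδ : massD w (lift m hm) = 1) : IsLabel H u w (lift m hm) := by
  refine ⟨fun η hη t₀ t₁ ht₀ ht₁ => ?_, hD, hδ⟩
  obtain ⟨x₁, x₂, e1, e2⟩ := exists_labels h₁ h₂ hη
  rw [Subtype.isCompact_iff]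
  convert h.isCompact_labels e1 e2 ht₀.le ht₁ using 1
  ext p
  constructor
  · rintro ⟨q, hq, rfl⟩
    exact hq
  · intro hp
    exact ⟨⟨p, mem_univ _, ht₀.trans_le hp.2.1, hp.2.2.trans_lt ht₁⟩, hp, rfl⟩

theorem mem_bounded_of_local (h : Flow k T C r v b m) (hT : 0 < T)
    (h₁ : Tendsto (fun x => m (x, 0)) atTop (𝓝 H)) (h₂ : Tendsto (fun x => m (x, 0)) atBot (𝓝 (-H)))
    (hm : ContDiffOn ℝ ∞ m (strip T)) {F : ℝ × ℝ → ℝ} (hF : ContDiffOn ℝ ∞ F (strip T))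
    (hloc : ∀ R, ∃ A, ∀ x t, |x| ≤ R → 0 ≤ t → t < T → |F (x, t)| ≤ A) :
    lift F hF ∈ smoothAlg.bounded H (lift m hm) := by
  rw [mem_bounded_iff hT]
  intro η hη
  obtain ⟨x₁, x₂, e1, e2⟩ := exists_labels h₁ h₂ hη
  obtain ⟨A, hA⟩ := hloc (max |x₁ - C * T| |x₂ + C * T|)
  refine ⟨A, T / 2, by linarith, by linarith, fun p hp _ => hA p.1.1 p.1.2 ?_ p.2.2.1.le p.2.2.2⟩
  have := h.mem_Icc_of_label e1 e2 p.2.2.1.le p.2.2.2 hp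
  exact abs_le_max_abs_abs this.1 this.2

end Flow

section

variable {k T : ℝ} {ρ₀ u₀ : ℝ → ℝ} {ρ u E : ℝ → ℝ → ℝ}

theorem IsSolution.smooth_ratio (h : IsSolution ⊤ k (Ico 0 T) ρ u E) :
    ContDiffOn ℝ ∞ (unc (ratio ρ u)) (strip T) := by
  have hu : ContDiffOn ℝ ∞ (unc u) (strip T) := h.smooth_velocity.mono (strip_subset T)
  refine ((contDiffOn_px (isOpen_strip T) hu (by simp)).div
    (h.smooth_density.mono (strip_subset T)) (fun _ hp =>
    (h.unc_density_pos (strip_subset T hp)).ne')).congr fun _ hp => h.ratio_eq le_top hp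

/-- All derivatives of a smooth solution stay bounded, if the density stays bounded from above and
below, and the ratio stays bounded. -/
theorem IsNiceSolution.exists_isTame (hT : 0 < T) (h : IsNiceSolution ⊤ k ρ₀ u₀ (Ico 0 T) ρ u E)
    (hE : IsBalancedField (Ico 0 T) ρ E)
    (hloc : ∀ R, ∃ A, 0 < A ∧ ∀ x t, |x| ≤ R → 0 ≤ t → t < T →
      A⁻¹ ≤ unc ρ (x, t) ∧ unc ρ (x, t) ≤ A ∧ |unc (ratio ρ u) (x, t)| ≤ A) :
    ∃ S : Set (smoothAlg T), IsTame S ∧ (∃ f ∈ S, ∀ p : strip T, f.1 p = unc ρ p) ∧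
      (∃ f ∈ S, ∀ p : strip T, f.1 p = unc u p) ∧ (∃ f ∈ S, ∀ p : strip T, f.1 p = unc E p) := by
  obtain ⟨C, H, hC, hH, hf, hlim⟩ := h.exists_balanced_flow le_top hT hE
  obtain ⟨h₁, h₂⟩ := hlim 0 ⟨le_rfl, hT⟩
  have hs := h.solution
  have hr : ContDiffOn ℝ ∞ (unc ρ) (strip T) := hs.smooth_density.mono (strip_subset T)
  have hu : ContDiffOn ℝ ∞ (unc u) (strip T) := hs.smooth_velocity.mono (strip_subset T)
  have hb := hs.smooth_ratio
  have hm := hf.contDiffOn_m hr hu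
  have hr0 : ∀ p ∈ strip T, unc ρ p ≠ 0 := fun p hp => (hf.r_pos p (strip_subset T hp)).ne'
  have hw : ContDiffOn ℝ ∞ (fun p => (unc ρ p)⁻¹) (strip T) := hr.inv hr0
  have hq : ContDiffOn ℝ ∞ (px (unc (ratio ρ u))) (strip T) :=
    contDiffOn_px (isOpen_strip T) hb (by simp)
  have hS := hf.massSystem (fun p hp => hs.momentum_px le_top hp) hr hu hb hm hw hq
  have hL := hf.isLabel h₁ h₂ hm hS.D_e hS.δ_e
  have hB := fun {F} (hF : ContDiffOn ℝ ∞ F (strip T)) => hf.mem_bounded_of_local hT h₁ h₂ hm hF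
  have hbdd := fun {f} => hL.mem_bounded_of_generated (f := f) hT hS
    (fun p => hf.r_pos p (strip_subset T p.2))
    (hB hw fun R => ?_) (hB hr fun R => ?_) (hB hb fun R => ?_) (hB hu fun R => ?_)
    (hB hm fun R => ?_)
  rotate_left
  · obtain ⟨A, hA, h3⟩ := hloc R
    refine ⟨A, fun x t hx h0 htT => ?_⟩
    have h4 := (h3 x t hx h0 htT).1
    rw [abs_of_nonneg (inv_nonneg.2 ((inv_pos.2 hA).le.trans h4)),
      inv_le_comm₀ ((inv_pos.2 hA).trans_le h4) hA]
    exact h4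
  · obtain ⟨A, hA, h3⟩ := hloc R
    refine ⟨A, fun x t hx h0 htT => ?_⟩
    have h4 := h3 x t hx h0 htT
    rw [abs_of_nonneg ((inv_pos.2 hA).le.trans h4.1)]
    exact h4.2.1
  · obtain ⟨A, -, h3⟩ := hloc R
    exact ⟨A, fun x t hx h0 htT => (h3 x t hx h0 htT).2.2⟩
  · exact ⟨C, fun x t _ h0 htT => hf.v_le _ (mem_strip₀.2 ⟨h0, htT⟩)⟩
  · obtain ⟨η, -, h3⟩ := hf.exists_label_bound hT h₁ h₂ R
    exact ⟨η, h3⟩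
  -- As ∂ₓ = ρδ and ∂_t = D - u∂ₓ, the generated family is closed under both partial derivatives.
  have hdX : ∀ f, Generated (massD (lift _ hw)) (lift _ hw) (lift _ hr) (lift _ hb) (lift _ hq)
      (lift _ hu) (lift _ hm) f → Generated (massD (lift _ hw)) (lift _ hw) (lift _ hr) (lift _ hb)
      (lift _ hq) (lift _ hu) (lift _ hm) (dX T f) := fun f hf => by
    have e : dX T f = lift _ hr * massD (lift _ hw) f := by
      rw [massD_apply, ← mul_assoc, mul_comm (lift _ hr), hS.w_mul_a, one_mul]
    rw [e]; exact Generated.a.mul hf.deriv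
  refine ⟨{f | Generated (massD (lift _ hw)) (lift _ hw) (lift _ hr) (lift _ hb) (lift _ hq)
    (lift _ hu) (lift _ hm) f}, ⟨hdX, fun f hf => ?_, fun f hf' R => ?_⟩, ⟨_, .a, fun _ => rfl⟩,
    ⟨_, .u, fun _ => rfl⟩, ⟨_, .e, fun _ => rfl⟩⟩
  · have e : dT T f = pathD (lift _ hu) f + -(lift _ hu * dX T f) := by
      rw [pathD_apply]; ring
    rw [e]
    exact (hf.deriv_path hS).add (Generated.u.mul (hdX f hf)).neg
  · obtain ⟨η, hη, h3⟩ := hf.exists_label_bound hT h₁ h₂ R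
    obtain ⟨A, t₀, ht₀, ht₀T, hA⟩ := (mem_bounded_iff hT).1 (hbdd hf') η hη
    exact ⟨A, t₀, ht₀, ht₀T, fun p hp hpt => hA p (h3 _ _ hp p.2.2.1.le p.2.2.2) hpt⟩

end

end ViscousEP

namespace ViscousEP

open scoped Topology ContDiff NNReal

/-! ### Extension to the final time -/

namespace smoothAlg

variable {T : ℝ} {S : Set (smoothAlg T)} {f : smoothAlg T}

/-- The strip including the final time. -/
def strip₁ (T : ℝ) : Set (ℝ × ℝ) := univ ×ˢ Ioc 0 T

theorem uniqueDiffOn_strip₁ (T : ℝ) : UniqueDiffOn ℝ (strip₁ T) :=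
  uniqueDiffOn_univ.prod (uniqueDiffOn_Ioc 0 T)

theorem strip₁_subset_closure (T : ℝ) : strip₁ T ⊆ closure (strip T) := by
  rintro ⟨x, t⟩ ⟨-, h0, hT⟩
  rw [strip, closure_prod_eq, closure_univ, closure_Ioo (h0.trans_le hT).ne]
  exact ⟨mem_univ _, h0.le, hT⟩

theorem norm_fderiv_le {F : ℝ × ℝ → ℝ} {p : ℝ × ℝ} {A B : ℝ} (hA : |px F p| ≤ A)
    (hB : |pt F p| ≤ B) : ‖fderiv ℝ F p‖ ≤ A + B := by
  refine ContinuousLinearMap.opNorm_le_bound _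
    (add_nonneg ((abs_nonneg _).trans hA) ((abs_nonneg _).trans hB)) fun z => ?_
  have e : fderiv ℝ F p z = z.1 * px F p + z.2 * pt F p := by
    have : z = z.1 • ((1, 0) : ℝ × ℝ) + z.2 • ((0, 1) : ℝ × ℝ) := by ext <;> simp
    conv_lhs => rw [this, map_add, map_smul, map_smul]
    rfl
  rw [e, add_mul]
  refine (norm_add_le _ _).trans (add_le_add ?_ ?_)
  · rw [norm_mul, mul_comm]
    exact mul_le_mul hA (norm_fst_le z) (norm_nonneg _) ((abs_nonneg _).trans hA)
  · rw [norm_mul, mul_comm]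
    exact mul_le_mul hB (norm_snd_le z) (norm_nonneg _) ((abs_nonneg _).trans hB)

namespace IsTame

/-- Bounded first derivatives make f Lipschitz on a convex box below the final time; a Lipschitz
extension to the plane supplies the limit. -/
theorem exists_tendsto (hS : IsTame S) (hf : f ∈ S) {p : ℝ × ℝ} (hp : p ∈ strip₁ T) :
    ∃ y, Tendsto (ext f) (𝓝[strip T] p) (𝓝 y) := by
  rcases hp.2.2.lt_or_eq with hlt | heq
  · exact ⟨_, (contDiffOn_ext f).continuousOn p ⟨mem_univ _, hp.2.1, hlt⟩⟩
  obtain ⟨A, t₀, ht₀, ht₀T, hA⟩ := hS.bounded _ (hS.dX_mem f hf) (|p.1| + 1)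
  obtain ⟨B, t₁, ht₁, ht₁T, hB⟩ := hS.bounded _ (hS.dT_mem f hf) (|p.1| + 1)
  obtain ⟨τ, hτ, hτT⟩ := exists_between (max_lt ht₀T ht₁T)
  have hτ₀ : t₀ < τ := (le_max_left _ _).trans_lt hτ
  have hτ₁ : t₁ < τ := (le_max_right _ _).trans_lt hτ
  set U : Set (ℝ × ℝ) := Ioo (p.1 - 1) (p.1 + 1) ×ˢ Ioo τ T
  have hUs : U ⊆ strip T := fun q hq => ⟨mem_univ _, (ht₀.trans hτ₀).trans hq.2.1, hq.2.2⟩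
  have hUR : ∀ q ∈ U, |q.1| ≤ |p.1| + 1 := by
    rintro q ⟨hq, -⟩
    rw [abs_le]
    exact ⟨by linarith [neg_abs_le p.1, hq.1], by linarith [le_abs_self p.1, hq.2]⟩
  have hLip : LipschitzOnWith (A + B).toNNReal (ext f) U := by
    refine Convex.lipschitzOnWith_of_nnnorm_fderiv_le (𝕜 := ℝ)
      (fun q hq => differentiableAt_ext f (hUs hq)) (fun q hq => ?_)
      ((convex_Ioo _ _).prod (convex_Ioo _ _))
    rw [← norm_toNNReal]
    refine Real.toNNReal_le_toNNReal (norm_fderiv_le ?_ ?_)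
    · exact hA ⟨q, hUs hq⟩ (hUR q hq) (hτ₀.trans hq.2.1).le
    · exact hB ⟨q, hUs hq⟩ (hUR q hq) (hτ₁.trans hq.2.1).le
  obtain ⟨g, hg, hfg⟩ := hLip.extend_real
  refine ⟨g p, ((hg.continuous.tendsto p).mono_left nhdsWithin_le_nhds).congr' ?_⟩
  have hN : Ioo (p.1 - 1) (p.1 + 1) ×ˢ Ioi τ ∈ 𝓝 p := by
    rw [← Prod.mk.eta (p := p)]
    exact prod_mem_nhds (Ioo_mem_nhds (by linarith) (by linarith)) (Ioi_mem_nhds (heq ▸ hτT))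
  filter_upwards [self_mem_nhdsWithin, nhdsWithin_le_nhds hN] with q hq hq'
  exact (hfg ⟨hq'.1, hq'.2, hq.2.2⟩).symm

theorem continuousOn_extend (hS : IsTame S) (hf : f ∈ S) :
    ContinuousOn (extendFrom (strip T) (ext f)) (strip₁ T) :=
  continuousOn_extendFrom (strip₁_subset_closure T) fun _ hp => hS.exists_tendsto hf hp

theorem extend_apply {p : ℝ × ℝ} (hp : p ∈ strip T) : extendFrom (strip T) (ext f) p = ext f p :=
  extendFrom_extends (contDiffOn_ext f).continuousOn p hp

theorem eventuallyEq_extend {p : ℝ × ℝ} (hp : p ∈ strip T) :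
    extendFrom (strip T) (ext f) =ᶠ[𝓝 p] ext f := by
  filter_upwards [strip_mem_nhds hp] with q hq using extend_apply hq

theorem fderiv_extend {p : ℝ × ℝ} (hp : p ∈ strip T) :
    fderiv ℝ (extendFrom (strip T) (ext f)) p =
      extendFrom (strip T) (ext (dX T f)) p • ContinuousLinearMap.fst ℝ ℝ ℝ +
      extendFrom (strip T) (ext (dT T f)) p • ContinuousLinearMap.snd ℝ ℝ ℝ := by
  rw [(eventuallyEq_extend hp).fderiv_eq, extend_apply hp, extend_apply hp,
    (ext_dX f hp).self_of_nhds, (ext_dT f hp).self_of_nhds]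
  refine ContinuousLinearMap.ext fun z => ?_
  have : z = z.1 • ((1, 0) : ℝ × ℝ) + z.2 • ((0, 1) : ℝ × ℝ) := by ext <;> simp
  conv_lhs => rw [this, map_add, map_smul, map_smul]
  change z.1 * px (ext f) p + z.2 * pt (ext f) p = px (ext f) p * z.1 + pt (ext f) p * z.2
  ring

/-- On a convex open slab, a function continuous up to the boundary whose derivative has a limit
there is differentiable at the boundary. The limit exists because ∂ₓf and ∂_t f are again in S. -/
theorem hasFDerivWithinAt_extend (hS : IsTame S) (hf : f ∈ S) {p : ℝ × ℝ} (hp : p ∈ strip₁ T) :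
    HasFDerivWithinAt (extendFrom (strip T) (ext f))
      (extendFrom (strip T) (ext (dX T f)) p • ContinuousLinearMap.fst ℝ ℝ ℝ +
        extendFrom (strip T) (ext (dT T f)) p • ContinuousLinearMap.snd ℝ ℝ ℝ) (strip₁ T) p := by
  have hT : 0 < T := hp.2.1.trans_le hp.2.2
  have hdiff : ∀ q ∈ strip T, DifferentiableAt ℝ (extendFrom (strip T) (ext f)) q := fun q hq =>
    (differentiableAt_ext f hq).congr_of_eventuallyEq (eventuallyEq_extend hq)
  obtain ⟨τ, hτ0, hτ⟩ := exists_between hp.2.1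
  have hτT : τ < T := hτ.trans_le hp.2.2
  set s : Set (ℝ × ℝ) := univ ×ˢ Ioo τ T
  have hs : s ⊆ strip T := fun q hq => ⟨mem_univ _, hτ0.trans hq.2.1, hq.2.2⟩
  have hs₁ : s ⊆ strip₁ T := fun q hq => ⟨mem_univ _, hτ0.trans hq.2.1, hq.2.2.le⟩
  have hcl : closure s = univ ×ˢ Icc τ T := by
    rw [closure_prod_eq, closure_univ, closure_Ioo hτT.ne]
  have key := hasFDerivWithinAt_closure_of_tendsto_fderiv (s := s) (x := p)
    (f := extendFrom (strip T) (ext f))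
    (f' := extendFrom (strip T) (ext (dX T f)) p • ContinuousLinearMap.fst ℝ ℝ ℝ +
      extendFrom (strip T) (ext (dT T f)) p • ContinuousLinearMap.snd ℝ ℝ ℝ)
    (fun q hq => (hdiff q (hs hq)).differentiableWithinAt) (convex_univ.prod (convex_Ioo _ _))
    (isOpen_univ.prod isOpen_Ioo) (fun q hq => ?_) ?_
  · refine key.mono_of_mem_nhdsWithin ?_
    rw [hcl]
    have hN : univ ×ˢ Ioi τ ∈ 𝓝 p := by
      rw [← Prod.mk.eta (p := p)]
      exact prod_mem_nhds univ_mem (Ioi_mem_nhds hτ)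
    filter_upwards [self_mem_nhdsWithin, nhdsWithin_le_nhds hN] with q hq hq'
    exact ⟨mem_univ _, le_of_lt hq'.2, hq.2.2⟩
  · rw [hcl] at hq
    exact ((hS.continuousOn_extend hf) q ⟨mem_univ _, hτ0.trans_le hq.2.1, hq.2.2⟩).mono hs₁
  · have h1 := ((hS.continuousOn_extend (hS.dX_mem f hf)) p hp).mono hs₁
    have h2 := ((hS.continuousOn_extend (hS.dT_mem f hf)) p hp).mono hs₁
    refine Tendsto.congr' ?_ ((h1.smul continuousWithinAt_const).add
      (h2.smul continuousWithinAt_const))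
    filter_upwards [self_mem_nhdsWithin] with q hq
    exact (fderiv_extend (hs hq)).symm

/-- The derivative of an extension is built from extensions of members of S, so the order of
smoothness increases by induction over all of S simultaneously. -/
theorem contDiffOn_extend (hS : IsTame S) (hf : f ∈ S) :
    ContDiffOn ℝ ∞ (extendFrom (strip T) (ext f)) (strip₁ T) := by
  rw [contDiffOn_infty]
  intro n
  induction n generalizing f with
  | zero => exact contDiffOn_zero.2 (hS.continuousOn_extend hf)
  | succ n ih =>
    rw [Nat.cast_succ,
      contDiffOn_succ_iff_hasFDerivWithinAt_of_uniqueDiffOn (uniqueDiffOn_strip₁ T)]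
    refine ⟨fun h => absurd h (by simp), _, ?_, fun p hp => hS.hasFDerivWithinAt_extend hf hp⟩
    exact ((ih (hS.dX_mem f hf)).smul contDiffOn_const).add
      ((ih (hS.dT_mem f hf)).smul contDiffOn_const)

/-- A tame function extends smoothly to the final time. -/
theorem exists_extension (hS : IsTame S) (hf : f ∈ S) {G : ℝ → ℝ → ℝ}
    (hG : ∀ p : strip T, f.1 p = unc G p) : ∃ G' : ℝ → ℝ → ℝ,
      ContDiffOn ℝ ∞ (unc G') (strip₁ T) ∧ ∀ t < T, ∀ x, G' x t = G x t := by
  -- Keeping G itself for t < T preserves its values at t = 0, which the open strip does not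
  -- contain.
  refine ⟨fun x t => if t < T then G x t else extendFrom (strip T) (ext f) (x, t), ?_,
    fun t ht x => if_pos ht⟩
  refine (hS.contDiffOn_extend hf).congr fun p hp => ?_
  rcases hp.2.2.lt_or_eq with hlt | heq
  · have hps : p ∈ strip T := ⟨mem_univ _, hp.2.1, hlt⟩
    simp only [unc, if_pos hlt]
    rw [extend_apply hps, ext_apply' f hps, hG ⟨p, hps⟩]
    rfl
  · simp only [unc, if_neg (not_lt.2 heq.ge)]

end IsTame

end smoothAlg

end ViscousEP

namespace ViscousEP

open scoped Topology ContDiff NNReal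

open smoothAlg

/-! ### Passage of the equations and of the balance condition to the final time -/

section

variable {k T : ℝ} {ρ₀ u₀ : ℝ → ℝ} {ρ u E f : ℝ → ℝ → ℝ} {I : Set ℝ}

theorem hasDerivWithinAt_snd {x t : ℝ} (hf : DifferentiableWithinAt ℝ (unc f) (univ ×ˢ I) (x, t)) :
    HasDerivWithinAt (fun s => f x s) (fderivWithin ℝ (unc f) (univ ×ˢ I) (x, t) (0, 1)) I t :=
  HasFDerivWithinAt.comp_hasDerivWithinAt (f := fun s : ℝ => ((x, s) : ℝ × ℝ)) t
    hf.hasFDerivWithinAt ((hasDerivAt_const t x).prodMk (hasDerivAt_id t)).hasDerivWithinAt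
    fun _ hs => ⟨mem_univ _, hs⟩

theorem contDiffOn_fderivWithin_apply (hI : UniqueDiffOn ℝ I)
    (hf : ContDiffOn ℝ ∞ (unc f) (univ ×ˢ I)) (z : ℝ × ℝ) :
    ContDiffOn ℝ ∞ (fun p => fderivWithin ℝ (unc f) (univ ×ˢ I) p z) (univ ×ˢ I) :=
  (hf.fderivWithin (uniqueDiffOn_univ.prod hI) (by simp)).clm_apply contDiffOn_const

theorem contDiffOn_dx (hI : UniqueDiffOn ℝ I) (hf : ContDiffOn ℝ ∞ (unc f) (univ ×ˢ I)) :
    ContDiffOn ℝ ∞ (unc (dx f)) (univ ×ˢ I) :=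
  (contDiffOn_fderivWithin_apply hI hf (1, 0)).congr fun p hp =>
    (dx_eq_fderivWithin (x := p.1) hp.2 (hf.differentiableOn (by simp) p hp)).deriv

theorem contDiffOn_dt (hI : UniqueDiffOn ℝ I) (hf : ContDiffOn ℝ ∞ (unc f) (univ ×ˢ I)) :
    ContDiffOn ℝ ∞ (unc (dt I f)) (univ ×ˢ I) :=
  (contDiffOn_fderivWithin_apply hI hf (0, 1)).congr fun p hp =>
    (hasDerivWithinAt_snd (x := p.1) (hf.differentiableOn (by simp) p hp)).derivWithin
      (hI p.2 hp.2)

theorem contDiffOn_Icc (hT : 0 < T) (h₀ : ContDiffOn ℝ ∞ (unc f) (univ ×ˢ Ico 0 T))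
    (h₁ : ContDiffOn ℝ ∞ (unc f) (strip₁ T)) : ContDiffOn ℝ ∞ (unc f) (univ ×ˢ Icc 0 T) := by
  intro p hp
  rcases hp.2.2.lt_or_eq with hlt | heq
  · refine (h₀ p ⟨mem_univ _, hp.2.1, hlt⟩).mono_of_mem_nhdsWithin ?_
    filter_upwards [self_mem_nhdsWithin,
      nhdsWithin_le_nhds (continuous_snd.continuousAt.eventually (gt_mem_nhds hlt))] with q hq hq'
    exact ⟨mem_univ _, hq.2.1, hq'⟩
  · refine (h₁ p ⟨mem_univ _, heq ▸ hT, heq.le⟩).mono_of_mem_nhdsWithin ?_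
    filter_upwards [self_mem_nhdsWithin, nhdsWithin_le_nhds
      (continuous_snd.continuousAt.eventually (lt_mem_nhds (heq ▸ hT : 0 < p.2)))] with q hq hq'
    exact ⟨mem_univ _, hq', hq.2.2⟩

theorem tendsto_final (hT : 0 < T) {F : ℝ × ℝ → ℝ} (hF : ContinuousOn F (strip₁ T)) (x : ℝ) :
    Tendsto (fun t => F (x, t)) (𝓝[<] T) (𝓝 (F (x, T))) := by
  have h1 : Tendsto (fun t : ℝ => ((x, t) : ℝ × ℝ)) (𝓝[<] T) (𝓝[strip₁ T] (x, T)) := by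
    refine tendsto_nhdsWithin_iff.2 ⟨?_, ?_⟩
    · exact ((continuous_const.prodMk continuous_id).tendsto T).mono_left nhdsWithin_le_nhds
    · filter_upwards [Ioo_mem_nhdsLT hT] with t ht
      exact ⟨mem_univ _, ht.1, ht.2.le⟩
  exact Tendsto.comp (hF (x, T) ⟨mem_univ _, hT, le_rfl⟩) h1

theorem le_final (hT : 0 < T) {F G : ℝ × ℝ → ℝ} (hF : ContinuousOn F (strip₁ T))
    (hG : ContinuousOn G (strip₁ T)) {x : ℝ} (h : ∀ t, 0 < t → t < T → F (x, t) ≤ G (x, t)) :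
    F (x, T) ≤ G (x, T) := by
  refine le_of_tendsto_of_tendsto (tendsto_final hT hF x) (tendsto_final hT hG x) ?_
  filter_upwards [Ioo_mem_nhdsLT hT] with t ht using h t ht.1 ht.2

theorem eq_final (hT : 0 < T) {F G : ℝ × ℝ → ℝ} (hF : ContinuousOn F (strip₁ T))
    (hG : ContinuousOn G (strip₁ T)) {x : ℝ} (h : ∀ t, 0 < t → t < T → F (x, t) = G (x, t)) :
    F (x, T) = G (x, T) :=
  le_antisymm (le_final hT hF hG fun t h1 h2 => (h t h1 h2).le)
    (le_final hT hG hF fun t h1 h2 => (h t h1 h2).ge)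

theorem dt_Icc_eq {f g : ℝ → ℝ → ℝ} (h : ∀ t < T, ∀ x, f x t = g x t) {x t : ℝ} (ht : t < T) :
    dt (Icc 0 T) f x t = dt (Ico 0 T) g x t := by
  have e : derivWithin (fun s => f x s) (Icc 0 T) t = derivWithin (fun s => f x s) (Ico 0 T) t := by
    refine derivWithin_congr_set ?_
    filter_upwards [Iio_mem_nhds ht] with s hs
    exact propext ⟨fun h => ⟨h.1, hs⟩, fun h => ⟨h.1, h.2.le⟩⟩
  rw [dt, e, dt]
  refine Filter.EventuallyEq.derivWithin_eq_of_nhds ?_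
  filter_upwards [Iio_mem_nhds ht] with s hs using h s hs x

theorem integrable_of_monotone_limits {g g' : ℝ → ℝ} {l₁ l₂ : ℝ} (hg : ∀ x, HasDerivAt g (g' x) x)
    (hc : Continuous g') (h0 : ∀ x, 0 ≤ g' x) (h₁ : Tendsto g atTop (𝓝 l₁))
    (h₂ : Tendsto g atBot (𝓝 l₂)) : Integrable g' := by
  have hmono : Monotone g := monotone_of_hasDerivAt_nonneg hg h0
  refine integrable_of_intervalIntegral_norm_bounded (l := atTop) (a := fun n : ℝ => -n)
    (b := fun n : ℝ => n) (l₁ - l₂)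
    (fun n => (hc.integrableOn_Icc).mono_set Ioc_subset_Icc_self) tendsto_neg_atTop_atBot
    tendsto_id ?_
  refine Eventually.of_forall fun n => ?_
  have e : ∫ x in -n..n, ‖g' x‖ = g n - g (-n) := by
    simp only [Real.norm_eq_abs, abs_of_nonneg (h0 _)]
    exact intervalIntegral.integral_eq_sub_of_hasDerivAt (fun x _ => hg x)
      (hc.intervalIntegrable _ _)
  rw [e]
  linarith [hmono.ge_of_tendsto h₁ n, hmono.le_of_tendsto h₂ (-n)]

theorem half_difference_of_limits {g g' : ℝ → ℝ} {H : ℝ} (hg : ∀ x, HasDerivAt g (g' x) x)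
    (hi : Integrable g') (h₁ : Tendsto g atTop (𝓝 H)) (h₂ : Tendsto g atBot (𝓝 (-H))) (x : ℝ) :
    g x = ((∫ ξ in Iic x, g' ξ) - ∫ ξ in Ioi x, g' ξ) / 2 := by
  rw [integral_Iic_of_hasDerivAt_of_tendsto' (fun y _ => hg y) hi.integrableOn h₂,
    integral_Ioi_of_hasDerivAt_of_tendsto' (fun y _ => hg y) hi.integrableOn h₁]
  ring

/-- A solution on `[0, T)` whose components extend smoothly to the time `T` extends as a
solution. -/
theorem IsNiceSolution.extend (hT : 0 < T) (h : IsNiceSolution ⊤ k ρ₀ u₀ (Ico 0 T) ρ u E)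
    (hpos : ∀ x, ∃ c > 0, ∀ t, 0 < t → t < T → c ≤ ρ x t) {ρ' u' E' : ℝ → ℝ → ℝ}
    (hρ : ContDiffOn ℝ ∞ (unc ρ') (strip₁ T)) (eρ : ∀ t < T, ∀ x, ρ' x t = ρ x t)
    (hu : ContDiffOn ℝ ∞ (unc u') (strip₁ T)) (eu : ∀ t < T, ∀ x, u' x t = u x t)
    (hE : ContDiffOn ℝ ∞ (unc E') (strip₁ T)) (eE : ∀ t < T, ∀ x, E' x t = E x t) :
    IsNiceSolution ⊤ k ρ₀ u₀ (Icc 0 T) ρ' u' E' := by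
  have hs := h.solution
  have hsub : strip₁ T ⊆ univ ×ˢ Icc 0 T := prod_mono subset_rfl Ioc_subset_Icc_self
  have hUD := uniqueDiffOn_Icc hT
  have hρI : ContDiffOn ℝ ∞ (unc ρ') (univ ×ˢ Icc 0 T) :=
    contDiffOn_Icc hT (hs.smooth_density.congr fun p hp => eρ p.2 hp.2.2 p.1) hρ
  have huI : ContDiffOn ℝ ∞ (unc u') (univ ×ˢ Icc 0 T) :=
    contDiffOn_Icc hT (hs.smooth_velocity.congr fun p hp => eu p.2 hp.2.2 p.1) hu
  have hpos' : ∀ t ∈ Icc 0 T, ∀ x, 0 < ρ' x t := by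
    intro t ht x
    rcases ht.2.lt_or_eq with hlt | rfl
    · rw [eρ t hlt]; exact hs.density_pos t ⟨ht.1, hlt⟩ x
    · obtain ⟨c, hc, hcle⟩ := hpos x
      refine hc.trans_le (le_final (F := fun _ => c) hT continuousOn_const hρ.continuousOn
        fun s h0 hsT => ?_)
      change c ≤ ρ' x s
      rw [eρ s hsT]; exact hcle s h0 hsT
  have hdu := contDiffOn_dx hUD huI
  have hratio : ContDiffOn ℝ ∞ (unc (ratio ρ' u')) (univ ×ˢ Icc 0 T) :=
    hdu.div hρI fun p hp => (hpos' p.2 hp.2 p.1).ne'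
  have eratio : ∀ t < T, ∀ x, ratio ρ' u' x t = ratio ρ u x t := by
    intro t ht x
    have : (fun y => u' y t) = fun y => u y t := funext (eu t ht)
    simp only [ratio, dx, this, eρ t ht]
  have edx : ∀ {f g : ℝ → ℝ → ℝ} {t : ℝ}, (∀ x, f x t = g x t) → ∀ x, dx f x t = dx g x t := by
    intro f g t hfg x
    simp only [dx]
    congr 1
    exact funext hfg
  refine ⟨⟨hρI, huI, hpos', ?_, ?_, ?_⟩, ?_, ?_, ?_, ?_⟩
  · have hlt : ∀ t, 0 ≤ t → t < T → ∀ x,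
        dt (Icc 0 T) ρ' x t + dx (fun y s => ρ' y s * u' y s) x t = 0 := by
      intro t h0 ht x
      rw [dt_Icc_eq eρ ht, edx (g := fun y s => ρ y s * u y s) (fun y => by rw [eρ t ht, eu t ht])]
      exact hs.mass t ⟨h0, ht⟩ x
    intro t ht x
    rcases ht.2.lt_or_eq with h1 | rfl
    · exact hlt t ht.1 h1 x
    -- Both sides are continuous up to the final time, so the equation there is a limit of earlier
    -- ones; the momentum and Poisson equations follow in the same way.
    · refine eq_final (F := fun p => unc (dt (Icc 0 t) ρ') p +
        unc (dx fun y s => ρ' y s * u' y s) p) (G := fun _ => 0) hT ?_ continuousOn_const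
        fun s h0 hsT => hlt s h0.le hsT x
      exact ((contDiffOn_dt hUD hρI).continuousOn.add
        (contDiffOn_dx hUD (f := fun y s => ρ' y s * u' y s) (hρI.mul huI)).continuousOn).mono hsub
  · have hlt : ∀ t, 0 ≤ t → t < T → ∀ x, dt (Icc 0 T) u' x t + u' x t * dx u' x t =
        k * E' x t + dx (ratio ρ' u') x t := by
      intro t h0 ht x
      rw [dt_Icc_eq eu ht, edx (eu t ht), edx (eratio t ht), eu t ht, eE t ht]
      exact hs.momentum t ⟨h0, ht⟩ x
    intro t ht x
    rcases ht.2.lt_or_eq with h1 | rfl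
    · exact hlt t ht.1 h1 x
    · refine eq_final (F := fun p => unc (dt (Icc 0 t) u') p + unc u' p * unc (dx u') p)
        (G := fun p => k * unc E' p + unc (dx (ratio ρ' u')) p) hT ?_ ?_
        fun s h0 hsT => hlt s h0.le hsT x
      · exact ((contDiffOn_dt hUD huI).continuousOn.add
          (huI.continuousOn.mul hdu.continuousOn)).mono hsub
      · exact (continuousOn_const.mul hE.continuousOn).add
          ((contDiffOn_dx hUD hratio).continuousOn.mono hsub)
  · intro t ht x
    rcases ht.2.lt_or_eq with h1 | rfl
    · have : (fun y => E' y t) = fun y => E y t := funext (eE t h1)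
      rw [this, eρ t h1]
      exact hs.poisson t ⟨ht.1, h1⟩ x
    -- Smoothness of E at time 0 is not part of the hypotheses, so derivatives of E' are taken
    -- within positive times.
    · have e : dx E' x t = ρ' x t := by
        refine eq_final (F := unc (dx E')) (G := unc ρ') hT
          (contDiffOn_dx (uniqueDiffOn_Ioc 0 t) hE).continuousOn hρ.continuousOn
          fun s h0 hsT => ?_
        change dx E' x s = ρ' x s
        rw [edx (eE s hsT), eρ s hsT]
        exact (hs.poisson s ⟨h0.le, hsT⟩ x).deriv
      have htT : t ∈ Ioc 0 t := ⟨hT, le_rfl⟩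
      have hd := dx_eq_fderivWithin (x := x) htT
        (hE.differentiableOn (by simp) (x, t) ⟨mem_univ _, htT⟩)
      rw [← e]
      exact hd.congr_deriv hd.deriv.symm
  · intro τ
    obtain ⟨C, hC⟩ := h.bounded T
    refine ⟨C, fun t ht _ x => ?_⟩
    rcases ht.2.lt_or_eq with h1 | rfl
    · rw [eu t h1]; exact hC t ⟨ht.1, h1⟩ h1.le x
    · refine le_final (F := fun p => |unc u' p|) (G := fun _ => C) hT hu.continuousOn.abs
        continuousOn_const fun s h0 hsT => ?_
      change |u' x s| ≤ C
      rw [eu s hsT]; exact hC s ⟨h0.le, hsT⟩ hsT.le x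
  · obtain ⟨γ, hγ, hsubl⟩ := h.sublinear
    refine ⟨γ, hγ, fun ε hε => ?_⟩
    obtain ⟨R, hR⟩ := hsubl ε hε
    refine ⟨R, fun t ht x hx => ?_⟩
    rcases ht.2.lt_or_eq with h1 | rfl
    · rw [eratio t h1]; exact hR t ⟨ht.1, h1⟩ x hx
    · refine le_final (F := fun p => |unc (ratio ρ' u') p|)
        (G := fun p => ε * Real.exp (γ * p.2) * |p.1|) hT (hratio.continuousOn.mono hsub).abs
        (by fun_prop) fun s h0 hsT => ?_
      change |ratio ρ' u' x s| ≤ _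
      rw [eratio s hsT]; exact hR s ⟨h0.le, hsT⟩ x hx
  · intro x; rw [eρ 0 hT]; exact h.initial_density x
  · intro x; rw [eu 0 hT]; exact h.initial_velocity x

/-- The extended field is balanced. -/
theorem IsNiceSolution.extend_balanced (hT : 0 < T) (h : IsNiceSolution ⊤ k ρ₀ u₀ (Ico 0 T) ρ u E)
    (hbal : IsBalancedField (Ico 0 T) ρ E) {ρ' u' E' : ℝ → ℝ → ℝ}
    (h' : IsNiceSolution ⊤ k ρ₀ u₀ (Icc 0 T) ρ' u' E') (eρ : ∀ t < T, ∀ x, ρ' x t = ρ x t)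
    (hE : ContDiffOn ℝ ∞ (unc E') (strip₁ T)) (eE : ∀ t < T, ∀ x, E' x t = E x t) :
    IsBalancedField (Icc 0 T) ρ' E' := by
  intro t ht
  rcases ht.2.lt_or_eq with h1 | rfl
  · simp only [eρ t h1, eE t h1]; exact hbal t ⟨ht.1, h1⟩
  obtain ⟨C, H, hC, hH, hf, hlim⟩ := h.exists_balanced_flow le_top hT hbal
  obtain ⟨h₁, h₂⟩ := hlim 0 ⟨le_rfl, hT⟩
  have hmono : ∀ s, 0 ≤ s → s < t → Monotone fun x => E x s := fun s h0 hs =>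
    (hf.strictMono_m h0 hs).monotone
  have cE : ∀ y : ℝ, ContinuousOn (fun _ : ℝ × ℝ => y) (strip₁ t) := fun y => continuousOn_const
  -- Finite speed squeezes the final field between translates of the initial one, so its limits at
  -- ±∞ are still ±H: no mass escapes at the final time.
  have lower : ∀ x, E (x - C * t) 0 ≤ E' x t := fun x => by
    refine le_final hT (cE _) hE.continuousOn fun s h0 hs => ?_
    change _ ≤ E' x s
    rw [eE s hs]
    refine (hf.cone (x := x - C * t) le_rfl h0.le hs).1.trans (hmono s h0.le hs ?_)
    have : C * (s - 0) ≤ C * t := by gcongr; linarith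
    linarith
  have upper : ∀ x, E' x t ≤ E (x + C * t) 0 := fun x => by
    refine le_final hT hE.continuousOn (cE _) fun s h0 hs => ?_
    change E' x s ≤ _
    rw [eE s hs]
    refine (hmono s h0.le hs ?_).trans (hf.cone (x := x + C * t) le_rfl h0.le hs).2
    have : C * (s - 0) ≤ C * t := by gcongr; linarith
    linarith
  have upperH : ∀ x, E' x t ≤ H := fun x =>
    (upper x).trans ((hmono 0 le_rfl hT).ge_of_tendsto h₁ _)
  have lowerH : ∀ x, -H ≤ E' x t := fun x =>
    ((hmono 0 le_rfl hT).le_of_tendsto h₂ _).trans (lower x)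
  have l₁ : Tendsto (fun x => E' x t) atTop (𝓝 H) :=
    tendsto_of_tendsto_of_tendsto_of_le_of_le
      (h₁.comp (tendsto_atTop_add_const_right _ (-(C * t)) tendsto_id)) tendsto_const_nhds
      (fun x => by simpa [sub_eq_add_neg] using lower x) upperH
  have l₂ : Tendsto (fun x => E' x t) atBot (𝓝 (-H)) :=
    tendsto_of_tendsto_of_tendsto_of_le_of_le tendsto_const_nhds
      (h₂.comp (tendsto_atBot_add_const_right _ (C * t) tendsto_id)) lowerH upper
  have hd : ∀ x, HasDerivAt (fun y => E' y t) (ρ' x t) x := h'.solution.poisson t ht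
  have hc : Continuous fun x => ρ' x t := by
    rw [← continuousOn_univ]
    exact h'.solution.smooth_density.continuousOn.comp
      (f := fun x : ℝ => ((x, t) : ℝ × ℝ)) (by fun_prop) (fun x _ => ⟨mem_univ _, ht⟩)
  have hi := integrable_of_monotone_limits hd hc
    (fun x => (h'.solution.density_pos t ht x).le) l₁ l₂
  exact ⟨hi, half_difference_of_limits hd hi l₁ l₂⟩

/-- Smooth solutions with locally bounded density, inverse density and ratio can be continued to
the final time. -/
theorem IsNiceSolution.exists_extension (hT : 0 < T)
    (h : IsNiceSolution ⊤ k ρ₀ u₀ (Ico 0 T) ρ u E) (hE : IsBalancedField (Ico 0 T) ρ E)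
    (hloc : ∀ R, ∃ A, 0 < A ∧ ∀ x t, |x| ≤ R → 0 ≤ t → t < T →
      A⁻¹ ≤ unc ρ (x, t) ∧ unc ρ (x, t) ≤ A ∧ |unc (ratio ρ u) (x, t)| ≤ A) :
    ∃ ρ' u' E' : ℝ → ℝ → ℝ,
      IsNiceSolution ⊤ k ρ₀ u₀ (Icc 0 T) ρ' u' E' ∧ IsBalancedField (Icc 0 T) ρ' E' ∧
      ∀ t ∈ Ico 0 T, ∀ x : ℝ, ρ' x t = ρ x t ∧ u' x t = u x t ∧ E' x t = E x t := by
  obtain ⟨S, hS, ⟨f₁, hf₁, e₁⟩, ⟨f₂, hf₂, e₂⟩, ⟨f₃, hf₃, e₃⟩⟩ := h.exists_isTame hT hE hloc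
  obtain ⟨ρ', hρ', eρ⟩ := hS.exists_extension hf₁ e₁
  obtain ⟨u', hu', eu⟩ := hS.exists_extension hf₂ e₂
  obtain ⟨E', hE', eE⟩ := hS.exists_extension hf₃ e₃
  have h' := h.extend hT (fun x => ?_) hρ' eρ hu' eu hE' eE
  · exact ⟨ρ', u', E', h', h.extend_balanced hT hE h' eρ hE' eE,
      fun t ht x => ⟨eρ t ht.2 x, eu t ht.2 x, eE t ht.2 x⟩⟩
  · obtain ⟨A, hA, hb⟩ := hloc |x|
    exact ⟨A⁻¹, inv_pos.2 hA, fun t h0 ht => (hb x t le_rfl h0.le ht).1⟩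

end

end ViscousEP

/-! ### The theorem -/

open ViscousEP in
theorem theorem4p2 (k : ℝ) (hk : 0 < k) (ρ₀ u₀ : ℝ → ℝ) (hρ₀ : ∀ x, 0 < ρ₀ x) :
    -- finite-time breakdown: the lifespan of every well-behaved solution is bounded by `Tc`
    (∀ α : ℝ, supRatio ρ₀ u₀ < (threshold k ρ₀ α : EReal) →
      ∃ Tc : ℝ, 0 < Tc ∧ ∀ n : ℕ∞, 2 ≤ n → ∀ ρ u E : ℝ → ℝ → ℝ,
        (∀ T : ℝ, IsNiceSolution n k ρ₀ u₀ (Ico 0 T) ρ u E → T ≤ Tc) ∧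
        ¬ IsNiceSolution n k ρ₀ u₀ (Ici 0) ρ u E) ∧
    ((∀ α : ℝ, (threshold k ρ₀ α : EReal) < infRatio ρ₀ u₀) →
      -- no blow-up and no vacuum at any finite time
      (∀ n : ℕ∞, 2 ≤ n → ∀ ρ u E : ℝ → ℝ → ℝ, ∀ T : ℝ, 0 < T →
        IsNiceSolution n k ρ₀ u₀ (Ico 0 T) ρ u E →
        ∀ R : ℝ, ∃ C : ℝ, 0 < C ∧ ∀ t ∈ Ico 0 T, ∀ x : ℝ, |x| ≤ R →
          C⁻¹ ≤ ρ x t ∧ ρ x t ≤ C ∧ |dx u x t| ≤ C) ∧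
      -- a smooth solution stays smooth up to and including any finite time
      (∀ ρ u E : ℝ → ℝ → ℝ, ∀ T : ℝ, 0 < T →
        IsNiceSolution ⊤ k ρ₀ u₀ (Ico 0 T) ρ u E → IsBalancedField (Ico 0 T) ρ E →
        ∃ ρ' u' E' : ℝ → ℝ → ℝ,
          IsNiceSolution ⊤ k ρ₀ u₀ (Icc 0 T) ρ' u' E' ∧ IsBalancedField (Icc 0 T) ρ' E' ∧
          ∀ t ∈ Ico 0 T, ∀ x : ℝ, ρ' x t = ρ x t ∧ u' x t = u x t ∧ E' x t = E x t) ∧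
      -- large-time behaviour, along particle paths and at fixed positions
      (supRatio ρ₀ u₀ < ⊤ → ∀ n : ℕ∞, 2 ≤ n → ∀ ρ u E : ℝ → ℝ → ℝ,
        IsNiceSolution n k ρ₀ u₀ (Ici 0) ρ u E →
        (∀ (α : ℝ) (X : ℝ → ℝ), IsParticlePath u α X →
          (fun t => ρ (X t) t) ~[atTop] (fun t => 2 / (k * t ^ 2)) ∧
          (fun t => dx u (X t) t) ~[atTop] (fun t => 2 / t)) ∧
        (IsBalancedField (Ici 0) ρ E → ∀ x : ℝ,
          (fun t => ρ x t) ~[atTop] (fun t => 2 / (k * t ^ 2)) ∧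
          (fun t => dx u x t) ~[atTop] (fun t => 2 / t)))) := by
  refine ⟨fun α hα => ?_, fun hα => ?_⟩
  · obtain ⟨M, hM, hle⟩ := exists_of_supRatio_lt hα
    have hM' : M < threshold k ρ₀ α := EReal.coe_lt_coe_iff.1 hM
    have hM0 : M < 0 := hM'.trans_le (neg_nonpos.2 (Real.sqrt_nonneg _))
    -- The vertex time depends on the data alone; a global solution is excluded by restricting it to
    -- a longer interval.
    refine ⟨-M / k, div_pos (by linarith) hk, fun n hn ρ u E => ⟨fun T h => ?_, fun h => ?_⟩⟩
    · exact lifespan_le hk hM' hle hn h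
    · have := lifespan_le hk hM' hle hn (h.restrict (-M / k + 1))
      linarith
  · obtain ⟨M, hM, hle⟩ := exists_of_lt_infRatio hα
    refine ⟨fun n hn ρ u E T hT h R => ?_, fun ρ u E T hT h hE => ?_,
      fun hsup n hn ρ u E h => ?_⟩
    · obtain ⟨A, hA, hb⟩ := h.exists_local_bounds hk hρ₀ hM hle hn hT R
      -- A serves for ρ and 1/ρ, and A·A for u_x = βρ.
      have hmax : A ≤ max A (A * A) := le_max_left _ _
      refine ⟨max A (A * A), hA.trans_le hmax, fun t ht x hx => ?_⟩
      obtain ⟨h1, h2, h3⟩ := hb x t hx ht.1 ht.2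
      refine ⟨(inv_anti₀ hA hmax).trans h1, h2.trans hmax, ?_⟩
      rw [h.dx_eq_mul ht, abs_mul, abs_of_pos (h.solution.density_pos t ht x)]
      exact (mul_le_mul h3 h2 (h.solution.density_pos t ht x).le hA.le).trans (le_max_right _ _)
    · exact h.exists_extension hT hE fun R => h.exists_local_bounds hk hρ₀ hM hle le_top hT R
    · obtain ⟨N, -, hN⟩ := exists_of_supRatio_lt hsup
      exact ⟨fun α X hX => h.asymptotics_along_path hk hn hle hN hX,
        fun hE x => h.asymptotics_at_point hk hn hE hle hN x⟩
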